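/- **Reduction theorem for quasi-morphisms on contactomorphism groups.** *Conventions.* Contact manifolds $(V,\xi=\ker\alpha)$ are closed (compact without boundary) and connected, $\alpha$ is a smooth contact form and $R_\alpha$ its Reeb vector field. $\widetilde{\mathrm{Cont}}_0(V,\xi)$ is the universal cover of the identity component $\mathrm{Cont}_0(V,\xi)$ of the group of contactomorphisms, i.e. the group of smooth contact isotopies $\{\phi^t\}_{t\in[0,1]}$ with $\phi^0=\mathrm{id}$ (with time-wise composition) modulo homotopy with fixed endpoints. A contact Hamiltonian is a smooth function $h:[0,1]\times V\to\mathbb R$; its contact vector field $X_{h_t}$ is defined by $\alpha(X_{h_t})=h_t$, $d\alpha(X_{h_t},\cdot)=-dh_t+dh_t(R_\alpha)\alpha$; it generates a contact isotopy $\{\phi_h^t\}$, whose class is denoted $\widetilde\phi_h\in\widetilde{\mathrm{Cont}}_0(V,\xi)$. Write $\widetilde\phi\preceq\widetilde\psi$ if $\widetilde\phi^{-1}\widetilde\psi=\widetilde\phi_h$ for some $h\ge 0$. A *quasi-morphism* on a group $G$ is a nonzero function $\mu:G\to\mathbb R$ such that $|\mu(ab)-\mu(a)-\mu(b)|\le D$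 for some $D>0$ and all $a,b\in G$, and $\mu(a^k)=k\mu(a)$ for all $a\in G$, $k\in\mathbb Z$. A quasi-morphism $\mu:\widetilde{\mathrm{Cont}}_0(V,\xi)\to\mathbb R$ is * *monotone* if $\widetilde\phi\preceq\widetilde\psi$ implies $\mu(\widetilde\phi)\le\mu(\widetilde\psi)$; * *$C^0$-continuous* if $\mu(\widetilde\phi_{h^{(i)}})\to\mu(\widetilde\phi_h)$ whenever $h^{(i)}\to h$ uniformly, for contact Hamiltonians $h^{(i)},h$; * said to have the *vanishing property* if $\mu(\widetilde\phi_h)=0$ for every contact Hamiltonian $h$ with $\mathrm{supp}(h)\subset[0,1]\times U$, where $U\subset V$ is open and $\psi(U)\cap U=\emptyset$ for some $\psi\in\mathrm{Cont}_0(V,\xi)$. A closed subset $Y\subset V$ is *$\mu$-subheavy* if $\mu(\widetilde\phi_h)=0$ for every autonomous (time-independent) contact Hamiltonian $h$ with $h|_Y=0$. A closed submanifold $Y\subset V$ transverse to $\xi$ is *strictly coisotropic with respect to $\alpha$* if for all $y\in Y$ we have $\{X\in\xi_y : d\alpha(X,Z)=0 \text{ for all } Z\in T_yY\cap\xi_y\}\subset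 T_yY\cap\xi_y$ and $R_\alpha(y)\in T_yY$. *Theorem.* Let $(V,\xi,\alpha)$ and $(\overline V,\overline\xi,\overline\alpha)$ be closed connected contact manifolds, let $Y\subset V$ be a closed submanifold that is strictly coisotropic with respect to $\alpha$, and let $\rho:Y\to\overline V$ be a smooth fiber bundle with $\rho^*\overline\alpha=\alpha|_Y$. For a contact Hamiltonian $\overline h$ on $\overline V$, call a contact Hamiltonian $h$ on $V$ an extension of $\overline h$ if $h|_{[0,1]\times Y}=\rho^*\overline h$, that is $h(t,y)=\overline h(t,\rho(y))$ for all $t\in[0,1]$, $y\in Y$. Suppose that $Y$ is $\mu$-subheavy for a monotone quasi-morphism $\mu:\widetilde{\mathrm{Cont}}_0(V,\xi)\to\mathbb R$. Then every contact Hamiltonian on $\overline V$ has an extension, and the formula $$\overline\mu(\widetilde\phi_{\overline h}):=\mu(\widetilde\phi_h),\qquad h \text{ any extension of } \overline h,$$ defines a unique function $\overline\mu:\widetilde{\mathrm{Cont}}_0(\overline V,\overline\xi)\to\mathbb R$, independent of all choices, which is a monotone quasi-morphism. If $\mu$ has the vanishing property, then so does $\overline\mu$; if $\mu$ is $C^0$-continuous,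 then so is $\overline\mu$. -/

import Mathlib

open Set Filter Topology
open scoped Manifold ContDiff unitInterval
open Manifold

noncomputable section

namespace ContactGeom

/-! ### One-forms and their exterior derivative -/

section OneForms

variable {d : ℕ} {M : Type*} [TopologicalSpace M] [ChartedSpace (EuclideanSpace ℝ (Fin d)) M]

/-- The pullback of the one-form `α` under the inverse of the preferred chart around `x`,
a one-form on (an open subset of) Euclidean space. -/
def localRep (α : ∀ x : M, TangentSpace (𝓡 d) x →L[ℝ] ℝ) (x : M) :
    EuclideanSpace ℝ (Fin d) → (EuclideanSpace ℝ (Fin d) →L[ℝ] ℝ) := fun y =>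
  (α ((extChartAt (𝓡 d) x).symm y)).comp
    (mfderiv 𝓘(ℝ, EuclideanSpace ℝ (Fin d)) (𝓡 d) (extChartAt (𝓡 d) x).symm y)

/-- The differential at `x` of the preferred chart around `x`. -/
def chartD (x : M) : TangentSpace (𝓡 d) x →L[ℝ] EuclideanSpace ℝ (Fin d) :=
  mfderiv (𝓡 d) 𝓘(ℝ, EuclideanSpace ℝ (Fin d)) (extChartAt (𝓡 d) x) x

/-- The exterior derivative of the one-form `α` at `x`, computed in the preferred chart around `x`
by `dA(u, v) = (D_u A)(v) - (D_v A)(u)`. -/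
def extD (α : ∀ x : M, TangentSpace (𝓡 d) x →L[ℝ] ℝ) (x : M) (u v : TangentSpace (𝓡 d) x) : ℝ :=
  fderiv ℝ (localRep α x) (extChartAt (𝓡 d) x x) (chartD x u) (chartD x v)
    - fderiv ℝ (localRep α x) (extChartAt (𝓡 d) x x) (chartD x v) (chartD x u)

theorem extD_self (α : ∀ x : M, TangentSpace (𝓡 d) x →L[ℝ] ℝ) (x : M)
    (u : TangentSpace (𝓡 d) x) : extD α x u u = 0 := sub_self _

theorem extD_skew (α : ∀ x : M, TangentSpace (𝓡 d) x →L[ℝ] ℝ) (x : M)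
    (u v : TangentSpace (𝓡 d) x) : extD α x u v = - extD α x v u := (neg_sub _ _).symm

/-- `dα_x` as a bilinear map. -/
def extDLin (α : ∀ x : M, TangentSpace (𝓡 d) x →L[ℝ] ℝ) (x : M) :
    TangentSpace (𝓡 d) x →ₗ[ℝ] TangentSpace (𝓡 d) x →ₗ[ℝ] ℝ :=
  LinearMap.mk₂ ℝ (extD α x)
    (fun u u' v => by simp only [extD, map_add, add_apply]; ring)
    (fun c u v => by simp only [extD, map_smul, smul_apply, smul_eq_mul]; ring)
    (fun u v v' => by simp only [extD, map_add, add_apply]; ring)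
    (fun c u v => by simp only [extD, map_smul, smul_apply, smul_eq_mul]; ring)

end OneForms

/-! ### Contact forms, Reeb vector field, contact vector fields -/

/-- A (smooth) contact form on the `2n+1`-dimensional manifold `V`: a smooth nowhere vanishing
one-form `α` such that `dα` is nondegenerate on the hyperplane `ξ = ker α`. -/
structure ContactForm (n : ℕ) (V : Type*) [TopologicalSpace V]
    [ChartedSpace (EuclideanSpace ℝ (Fin (2 * n + 1))) V]
    [IsManifold (𝓡 (2 * n + 1)) ∞ V] where
  form : ∀ x : V, TangentSpace (𝓡 (2 * n + 1)) x →L[ℝ] ℝ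
  smooth : ContMDiff (𝓡 (2 * n + 1))
    ((𝓡 (2 * n + 1)).prod 𝓘(ℝ, EuclideanSpace ℝ (Fin (2 * n + 1)) →L[ℝ] ℝ)) ∞
    (fun x => Bundle.TotalSpace.mk' (EuclideanSpace ℝ (Fin (2 * n + 1)) →L[ℝ] ℝ) x (form x))
  ne_zero : ∀ x, form x ≠ 0
  nondegenerate : ∀ x (u : TangentSpace (𝓡 (2 * n + 1)) x), form x u = 0 →
    (∀ v, form x v = 0 → extD form x u v = 0) → u = 0

section Contact

variable {n : ℕ} {V : Type*} [TopologicalSpace V]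
  [ChartedSpace (EuclideanSpace ℝ (Fin (2 * n + 1))) V] [IsManifold (𝓡 (2 * n + 1)) ∞ V]
  (α : ContactForm n V)

/-- `R` is the value at `x` of the Reeb vector field: `α(R) = 1` and `ι_R dα = 0`. -/
def IsReebVector (x : V) (R : TangentSpace (𝓡 (2 * n + 1)) x) : Prop :=
  α.form x R = 1 ∧ ∀ v, extD α.form x R v = 0

theorem exists_flat_eq (x : V) (β : TangentSpace (𝓡 (2 * n + 1)) x →ₗ[ℝ] ℝ) :
    ∃ X : TangentSpace (𝓡 (2 * n + 1)) x,
      ∀ v, α.form x X * α.form x v + extD α.form x X v = β v := by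
  let L : TangentSpace (𝓡 (2 * n + 1)) x →ₗ[ℝ] Module.Dual ℝ (TangentSpace (𝓡 (2 * n + 1)) x) :=
    { toFun := fun u => α.form x u • (α.form x : TangentSpace (𝓡 (2 * n + 1)) x →ₗ[ℝ] ℝ)
        + extDLin α.form x u
      map_add' := fun u v => by rw [map_add, map_add, add_smul]; abel
      map_smul' := fun c u => by simp [mul_smul] }
  have hL : ∀ u v, L u v = α.form x u * α.form x v + extD α.form x u v := fun u v => rfl
  have : FiniteDimensional ℝ (TangentSpace (𝓡 (2 * n + 1)) x) :=
    inferInstanceAs (FiniteDimensional ℝ (EuclideanSpace ℝ (Fin (2 * n + 1))))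
  have hinj : Function.Injective L := by
    rw [← LinearMap.ker_eq_bot, LinearMap.ker_eq_bot']
    intro u hu
    have h0 : ∀ v, α.form x u * α.form x v + extD α.form x u v = 0 := fun v => by
      rw [← hL, hu]; rfl
    have h1 : α.form x u = 0 := by
      have := h0 u
      rw [extD_self, add_zero] at this
      exact mul_self_eq_zero.mp this
    refine α.nondegenerate x u h1 fun v hv => ?_
    simpa [h1] using h0 v
  have hsurj : Function.Surjective L :=
    (LinearMap.injective_iff_surjective_of_finrank_eq_finrank
      (Subspace.dual_finrank_eq (K := ℝ) (V := TangentSpace (𝓡 (2 * n + 1)) x)).symm).mp hinj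
  obtain ⟨X, hX⟩ := hsurj β
  exact ⟨X, fun v => by rw [← hL, hX]⟩

theorem exists_isReebVector (x : V) : ∃ R, IsReebVector α x R := by
  obtain ⟨R, hR⟩ := exists_flat_eq α x (α.form x : TangentSpace (𝓡 (2 * n + 1)) x →ₗ[ℝ] ℝ)
  have hR' : ∀ v, α.form x R * α.form x v + extD α.form x R v = α.form x v := hR
  have h1 := hR' R
  rw [extD_self, add_zero] at h1
  have h2 : α.form x R = 1 := by
    by_contra hne
    have h3 : α.form x R = 0 := by
      by_contra h0
      exact hne (mul_left_cancel₀ h0 (by rw [h1, mul_one]))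
    have h4 : R = 0 := α.nondegenerate x R h3 fun v hv => by simpa [h3, hv] using hR' v
    apply α.ne_zero x
    ext v
    have h5 := hR' v
    have h6 : extD α.form x R v = 0 := by
      rw [h4]
      exact congrArg (fun l => l v) ((extDLin α.form x).map_zero)
    rw [h3, h6] at h5
    simpa using h5.symm
  exact ⟨R, h2, fun v => by simpa [h2] using hR' v⟩

/-- The Reeb vector field `R_α`. -/
def reeb (x : V) : TangentSpace (𝓡 (2 * n + 1)) x := (exists_isReebVector α x).choose

theorem reeb_spec (x : V) : IsReebVector α x (reeb α x) := (exists_isReebVector α x).choose_spec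

/-- The differential of a real-valued function, as a linear form on the tangent space. -/
def dFun (f : V → ℝ) (x : V) : TangentSpace (𝓡 (2 * n + 1)) x →L[ℝ] ℝ :=
  mfderiv (𝓡 (2 * n + 1)) 𝓘(ℝ, ℝ) f x

/-- `X` is the value at `x` of the contact vector field of the function `f`:
`α(X) = f` and `dα(X, ·) = -df + df(R_α) α`. -/
def IsContactVector (f : V → ℝ) (x : V) (X : TangentSpace (𝓡 (2 * n + 1)) x) : Prop :=
  α.form x X = f x ∧
    ∀ v, extD α.form x X v = - dFun f x v + dFun f x (reeb α x) * α.form x v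

theorem existsUnique_isContactVector (f : V → ℝ) (x : V) : ∃! X, IsContactVector α f x X := by
  obtain ⟨hR1, hR2⟩ := reeb_spec α x
  obtain ⟨X, hX⟩ := exists_flat_eq α x
    ((f x + dFun f x (reeb α x)) • (α.form x : TangentSpace (𝓡 (2 * n + 1)) x →ₗ[ℝ] ℝ)
      - ((dFun f x : TangentSpace (𝓡 (2 * n + 1)) x →L[ℝ] ℝ) :
          TangentSpace (𝓡 (2 * n + 1)) x →ₗ[ℝ] ℝ))
  have hX' : ∀ v, α.form x X * α.form x v + extD α.form x X v
      = (f x + dFun f x (reeb α x)) * α.form x v - dFun f x v := hX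
  have h1 : α.form x X = f x := by
    have := hX' (reeb α x)
    rw [extD_skew, hR1, hR2] at this
    linarith
  refine ⟨X, ⟨h1, fun v => ?_⟩, fun X' hX2 => ?_⟩
  · have := hX' v
    rw [h1] at this
    linarith
  · have h2 : X' - X = 0 := by
      refine α.nondegenerate x _ (by rw [map_sub, hX2.1, h1, sub_self]) fun v _ => ?_
      have e1 := hX2.2 v
      have e2 := hX' v
      rw [h1] at e2
      have e3 : extD α.form x (X' - X) v = extD α.form x X' v - extD α.form x X v := by
        have := congrArg (fun l => l v) ((extDLin α.form x).map_sub X' X)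
        exact this
      rw [e3]
      linarith
    exact sub_eq_zero.mp h2

/-- The contact vector field `X_f` of the function `f`. -/
def contactField (f : V → ℝ) (x : V) : TangentSpace (𝓡 (2 * n + 1)) x :=
  (existsUnique_isContactVector α f x).exists.choose

theorem contactField_spec (f : V → ℝ) (x : V) : IsContactVector α f x (contactField α f x) :=
  (existsUnique_isContactVector α f x).exists.choose_spec

end Contact

/-! ### Contact isotopies and the universal cover of the group of contactomorphisms -/

section Isotopies

variable {n : ℕ} {V : Type*} [TopologicalSpace V]
  [ChartedSpace (EuclideanSpace ℝ (Fin (2 * n + 1))) V] [IsManifold (𝓡 (2 * n + 1)) ∞ V]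
  (α : ContactForm n V)

/-- The bijection `φ` of `V` satisfies `dφ(ξ) = ξ`, where `ξ = ker α`. -/
def PreservesXi (φ : Equiv.Perm V) : Prop :=
  ∀ x (v : TangentSpace (𝓡 (2 * n + 1)) x),
    α.form (φ x) (mfderiv (𝓡 (2 * n + 1)) (𝓡 (2 * n + 1)) φ x v) = 0 ↔ α.form x v = 0

variable {E H : Type*} [NormedAddCommGroup E] [NormedSpace ℝ E] [TopologicalSpace H]
  (J : ModelWithCorners ℝ E H) (T : Type*) [TopologicalSpace T] [ChartedSpace H T]

/-- `Φ : T → Equiv.Perm V` is a smooth family of diffeomorphisms of `V` preserving `ξ = ker α`; the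
parameter space `T` is a manifold, possibly with boundary and corners. -/
structure IsContactFamily (Φ : T → Equiv.Perm V) : Prop where
  smooth : ContMDiff (J.prod (𝓡 (2 * n + 1))) (𝓡 (2 * n + 1)) ∞ (fun p : T × V => Φ p.1 p.2)
  smooth_inv : ContMDiff (J.prod (𝓡 (2 * n + 1))) (𝓡 (2 * n + 1)) ∞
    (fun p : T × V => (Φ p.1)⁻¹ p.2)
  preserves : ∀ t, PreservesXi α (Φ t)

variable {J T} {α}

theorem IsContactFamily.smooth_at {Φ : T → Equiv.Perm V} (h : IsContactFamily α J T Φ) (t : T) :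
    ContMDiff (𝓡 (2 * n + 1)) (𝓡 (2 * n + 1)) ∞ (Φ t) :=
  h.smooth.comp (contMDiff_const.prodMk contMDiff_id)

theorem IsContactFamily.smooth_inv_at {Φ : T → Equiv.Perm V} (h : IsContactFamily α J T Φ)
    (t : T) : ContMDiff (𝓡 (2 * n + 1)) (𝓡 (2 * n + 1)) ∞ ((Φ t)⁻¹ : Equiv.Perm V) :=
  h.smooth_inv.comp (contMDiff_const.prodMk contMDiff_id)

theorem PreservesXi.one : PreservesXi α 1 := fun x v => by
  have : mfderiv (𝓡 (2 * n + 1)) (𝓡 (2 * n + 1)) ((1 : Equiv.Perm V) : V → V) x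
      = ContinuousLinearMap.id ℝ _ := mfderiv_id
  rw [this]; rfl

theorem PreservesXi.mul {φ ψ : Equiv.Perm V} (hφ : PreservesXi α φ) (hψ : PreservesXi α ψ)
    (sφ : ContMDiff (𝓡 (2 * n + 1)) (𝓡 (2 * n + 1)) ∞ φ)
    (sψ : ContMDiff (𝓡 (2 * n + 1)) (𝓡 (2 * n + 1)) ∞ ψ) : PreservesXi α (φ * ψ) := by
  intro x v
  have : mfderiv (𝓡 (2 * n + 1)) (𝓡 (2 * n + 1)) ((φ * ψ : Equiv.Perm V) : V → V) x
      = (mfderiv (𝓡 (2 * n + 1)) (𝓡 (2 * n + 1)) φ (ψ x)).comp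
        (mfderiv (𝓡 (2 * n + 1)) (𝓡 (2 * n + 1)) ψ x) :=
    mfderiv_comp x (sφ.mdifferentiable (by simp) _) (sψ.mdifferentiable (by simp) _)
  rw [this]
  exact (hφ _ _).trans (hψ _ _)

theorem PreservesXi.inv {φ : Equiv.Perm V} (hφ : PreservesXi α φ)
    (sφ : ContMDiff (𝓡 (2 * n + 1)) (𝓡 (2 * n + 1)) ∞ φ)
    (sφ' : ContMDiff (𝓡 (2 * n + 1)) (𝓡 (2 * n + 1)) ∞ (φ⁻¹ : Equiv.Perm V)) :
    PreservesXi α φ⁻¹ := by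
  intro x v
  have h1 : (mfderiv (𝓡 (2 * n + 1)) (𝓡 (2 * n + 1)) φ ((φ⁻¹ : Equiv.Perm V) x)).comp
        (mfderiv (𝓡 (2 * n + 1)) (𝓡 (2 * n + 1)) (φ⁻¹ : Equiv.Perm V) x)
      = mfderiv (𝓡 (2 * n + 1)) (𝓡 (2 * n + 1)) (φ ∘ (φ⁻¹ : Equiv.Perm V)) x :=
    (mfderiv_comp x (sφ.mdifferentiable (by simp) _) (sφ'.mdifferentiable (by simp) _)).symm
  have h2 : (φ ∘ (φ⁻¹ : Equiv.Perm V) : V → V) = id := by ext y; simp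
  rw [h2, mfderiv_id] at h1
  have h3 := hφ ((φ⁻¹ : Equiv.Perm V) x)
    (mfderiv (𝓡 (2 * n + 1)) (𝓡 (2 * n + 1)) (φ⁻¹ : Equiv.Perm V) x v)
  rw [← h3]
  have h4 : mfderiv (𝓡 (2 * n + 1)) (𝓡 (2 * n + 1)) φ ((φ⁻¹ : Equiv.Perm V) x)
      (mfderiv (𝓡 (2 * n + 1)) (𝓡 (2 * n + 1)) (φ⁻¹ : Equiv.Perm V) x v) = v :=
    congrArg (fun l => l v) h1
  rw [h4]
  have h5 : φ ((φ⁻¹ : Equiv.Perm V) x) = x := by simp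
  have h6 : ∀ (z y : V) (_ : z = y) (w : EuclideanSpace ℝ (Fin (2 * n + 1))),
      (α.form z w = 0 ↔ α.form y w = 0) := by rintro z y rfl w; rfl
  exact h6 _ _ h5 v

theorem IsContactFamily.one : IsContactFamily α J T (1 : T → Equiv.Perm V) :=
  ⟨contMDiff_snd, contMDiff_snd, fun _ => PreservesXi.one⟩

theorem IsContactFamily.mul {Φ Ψ : T → Equiv.Perm V} (hΦ : IsContactFamily α J T Φ)
    (hΨ : IsContactFamily α J T Ψ) : IsContactFamily α J T (Φ * Ψ) where
  smooth := hΦ.smooth.comp (contMDiff_fst.prodMk hΨ.smooth)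
  smooth_inv := by
    have := hΨ.smooth_inv.comp (contMDiff_fst.prodMk hΦ.smooth_inv)
    simpa [Function.comp_def] using this
  preserves t := (hΦ.preserves t).mul (hΨ.preserves t) (hΦ.smooth_at t) (hΨ.smooth_at t)

theorem IsContactFamily.inv {Φ : T → Equiv.Perm V} (hΦ : IsContactFamily α J T Φ) :
    IsContactFamily α J T Φ⁻¹ where
  smooth := hΦ.smooth_inv
  smooth_inv := by simpa using hΦ.smooth
  preserves t := (hΦ.preserves t).inv (hΦ.smooth_at t) (hΦ.smooth_inv_at t)

variable (α)

/-- The group of (smooth) contact isotopies `{Φ_t}`, `t ∈ [0,1]`, of `(V, ker α)` based at the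
identity, with time-wise composition as product. -/
def ContactIsotopy : Subgroup (I → Equiv.Perm V) where
  carrier := {Φ | IsContactFamily α (𝓡∂ 1) I Φ ∧ Φ 0 = 1}
  one_mem' := ⟨IsContactFamily.one, rfl⟩
  mul_mem' := fun ha hb => ⟨ha.1.mul hb.1, by simp [ha.2, hb.2]⟩
  inv_mem' := fun ha => ⟨ha.1.inv, by simp [ha.2]⟩

/-- Two contact isotopies are homotopic with fixed endpoints, through contact isotopies:
`K (s, t)` is a smooth two-parameter family of contactomorphisms. -/
def Homotopic (Φ Ψ : ContactIsotopy α) : Prop :=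
  ∃ K : I × I → Equiv.Perm V, IsContactFamily α ((𝓡∂ 1).prod (𝓡∂ 1)) (I × I) K ∧
    (∀ t, K (0, t) = Φ.1 t) ∧ (∀ t, K (1, t) = Ψ.1 t) ∧
    (∀ s, K (s, 0) = 1) ∧ (∀ s, K (s, 1) = Φ.1 1)

theorem isContactFamily_const (Φ : ContactIsotopy α) :
    IsContactFamily α ((𝓡∂ 1).prod (𝓡∂ 1)) (I × I) (fun p => Φ.1 p.2) where
  smooth := Φ.2.1.smooth.comp ((contMDiff_snd.comp contMDiff_fst).prodMk contMDiff_snd)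
  smooth_inv := Φ.2.1.smooth_inv.comp ((contMDiff_snd.comp contMDiff_fst).prodMk contMDiff_snd)
  preserves p := Φ.2.1.preserves p.2

theorem Homotopic.end_eq {Φ Ψ : ContactIsotopy α} (h : Homotopic α Φ Ψ) : Φ.1 1 = Ψ.1 1 := by
  obtain ⟨K, -, -, h1, -, h3⟩ := h
  rw [← h3 1, h1 1]

/-- Homotopy with fixed endpoints, as a congruence relation on the group of contact isotopies. -/
def homotopyCon : Con (ContactIsotopy α) where
  r := Homotopic α
  iseqv :=
    { refl := fun Φ => ⟨fun p => Φ.1 p.2, (isContactFamily_const α Φ), fun _ => rfl, fun _ => rfl,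
        fun _ => Φ.2.2, fun _ => rfl⟩
      symm := by
        rintro Φ Ψ ⟨K, hK, h0, h1, h2, h3⟩
        have he := Homotopic.end_eq α ⟨K, hK, h0, h1, h2, h3⟩
        refine ⟨(fun p => Φ.1 p.2) * K⁻¹ * (fun p => Ψ.1 p.2), ((isContactFamily_const α Φ).mul hK.inv).mul (isContactFamily_const α Ψ),
          fun t => ?_, fun t => ?_, fun s => ?_, fun s => ?_⟩
        · simp [h0]
        · simp [h1]
        · simp [h2, Φ.2.2, Ψ.2.2]
        · simp [h3]
      trans := by
        rintro Φ Ψ Χ ⟨K, hK, h0, h1, h2, h3⟩ ⟨L, hL, l0, l1, l2, l3⟩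
        have he := Homotopic.end_eq α ⟨K, hK, h0, h1, h2, h3⟩
        refine ⟨K * (fun p => Ψ.1 p.2)⁻¹ * L, (hK.mul (isContactFamily_const α Ψ).inv).mul hL,
          fun t => ?_, fun t => ?_, fun s => ?_, fun s => ?_⟩
        · simp [h0, l0]
        · simp [h1, l1]
        · simp [h2, l2, Ψ.2.2]
        · simp [h3, l3] }
  mul' := by
    rintro Φ Ψ Φ' Ψ' ⟨K, hK, h0, h1, h2, h3⟩ ⟨L, hL, l0, l1, l2, l3⟩
    refine ⟨K * L, hK.mul hL, fun t => ?_, fun t => ?_, fun s => ?_, fun s => ?_⟩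
    · simp [h0, l0]
    · simp [h1, l1]
    · simp [h2, l2]
    · simp [h3, l3]

/-- The universal cover of the identity component `Cont_0(V, ξ)` of the group of
contactomorphisms: contact isotopies based at the identity up to homotopy with fixed endpoints. -/
abbrev UnivCont : Type _ := (homotopyCon α).Quotient

/-- `φ ∈ Cont_0(V, ξ)`: the contactomorphism `φ` is contact isotopic to the identity. -/
def MemCont0 (φ : Equiv.Perm V) : Prop := ∃ Φ : ContactIsotopy α, Φ.1 1 = φ

end Isotopies

/-! ### Contact Hamiltonians -/

/-- Contact Hamiltonians: smooth functions `h : [0,1] × V → ℝ`. -/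
abbrev Ham (n : ℕ) (V : Type*) [TopologicalSpace V]
    [ChartedSpace (EuclideanSpace ℝ (Fin (2 * n + 1))) V] : Type _ :=
  C^∞⟮(𝓡∂ 1).prod (𝓡 (2 * n + 1)), I × V; 𝓘(ℝ, ℝ), ℝ⟯

section Hamiltonians

variable {n : ℕ} {V : Type*} [TopologicalSpace V]
  [ChartedSpace (EuclideanSpace ℝ (Fin (2 * n + 1))) V] [IsManifold (𝓡 (2 * n + 1)) ∞ V]
  (α : ContactForm n V)

/-- The contact isotopy `Φ` integrates the time-dependent contact vector field `X_{h_t}`. -/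
def Generates (h : Ham n V) (Φ : ContactIsotopy α) : Prop :=
  ∀ (t : I) (x : V),
    mfderiv (𝓡∂ 1) (𝓡 (2 * n + 1)) (fun s : I => Φ.1 s x) t 1
      = contactField α (fun y => h (t, y)) (Φ.1 t x)

/-- The contact isotopy `{φ_h^t}` generated by `h` (on a closed manifold there is exactly one
isotopy with the property `Generates α h`). -/
def flow (h : Ham n V) : ContactIsotopy α := Classical.epsilon (Generates α h)

/-- The element `φ̃_h` of the universal cover represented by `{φ_h^t}`. -/
def lift (h : Ham n V) : UnivCont α := (flow α h : (homotopyCon α).Quotient)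

/-- `id ≼ φ` : `φ = φ̃_h` for some nonnegative contact Hamiltonian `h`. -/
def IsNonneg (φ : UnivCont α) : Prop := ∃ h : Ham n V, (∀ p, 0 ≤ h p) ∧ φ = lift α h

/-- The relation `φ ≼ ψ`, that is `id ≼ φ⁻¹ ψ`. -/
def Prec (φ ψ : UnivCont α) : Prop := IsNonneg α (φ⁻¹ * ψ)

end Hamiltonians

/-! ### Quasi-morphisms -/

/-- Nonzero homogeneous quasi-morphisms. -/
structure IsQuasimorphism {G : Type*} [Group G] (μ : G → ℝ) : Prop where
  quasi : ∃ D > 0, ∀ a b, |μ (a * b) - μ a - μ b| ≤ D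
  homogeneous : ∀ (a : G) (k : ℤ), μ (a ^ k) = k * μ a
  nonzero : ∃ a, μ a ≠ 0

section Properties

variable {n : ℕ} {V : Type*} [TopologicalSpace V]
  [ChartedSpace (EuclideanSpace ℝ (Fin (2 * n + 1))) V] [IsManifold (𝓡 (2 * n + 1)) ∞ V]
  (α : ContactForm n V)

/-- Monotone functions on the universal cover. -/
def IsMonotone (μ : UnivCont α → ℝ) : Prop := ∀ φ ψ, Prec α φ ψ → μ φ ≤ μ ψ

/-- `C⁰`-continuity. -/
def IsC0Continuous (μ : UnivCont α → ℝ) : Prop :=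
  ∀ (h : Ham n V) (hs : ℕ → Ham n V), TendstoUniformly (fun k p => hs k p) (fun p => h p) atTop →
    Tendsto (fun k => μ (lift α (hs k))) atTop (𝓝 (μ (lift α h)))

/-- The vanishing property. -/
def HasVanishing (μ : UnivCont α → ℝ) : Prop :=
  ∀ U : Set V, IsOpen U → (∃ ψ, MemCont0 α ψ ∧ (ψ '' U) ∩ U = ∅) →
    ∀ h : Ham n V, tsupport (fun p => h p) ⊆ univ ×ˢ U → μ (lift α h) = 0

/-- The closed subset `Y` is `μ`-subheavy: `μ(φ̃_h) = 0` for every autonomous contact Hamiltonian `h`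
vanishing on `Y`. -/
def IsSubheavy (μ : UnivCont α → ℝ) (Y : Set V) : Prop :=
  IsClosed Y ∧ ∀ h : Ham n V, (∀ s t x, h (s, x) = h (t, x)) → (∀ t, ∀ y ∈ Y, h (t, y) = 0) →
    μ (lift α h) = 0

end Properties

/-! ### Strictly coisotropic submanifolds and reduction -/

section Reduction

variable {n : ℕ} {V : Type*} [TopologicalSpace V]
  [ChartedSpace (EuclideanSpace ℝ (Fin (2 * n + 1))) V] [IsManifold (𝓡 (2 * n + 1)) ∞ V]
  (α : ContactForm n V)

/-- The differential of the inclusion `Y ⊆ V`. -/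
def inclD {k : ℕ} {Y : Set V} [ChartedSpace (EuclideanSpace ℝ (Fin k)) Y] (y : Y) :
    TangentSpace (𝓡 k) y →L[ℝ] TangentSpace (𝓡 (2 * n + 1)) (y : V) :=
  mfderiv (𝓡 k) (𝓡 (2 * n + 1)) (Subtype.val : Y → V) y

/-- The tangent space `T_y Y`, as a subspace of `T_y V`. -/
def tangentSub {k : ℕ} {Y : Set V} [ChartedSpace (EuclideanSpace ℝ (Fin k)) Y] (y : Y) :
    Submodule ℝ (TangentSpace (𝓡 (2 * n + 1)) (y : V)) :=
  LinearMap.range (inclD (n := n) (k := k) y).toLinearMap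

/-- `Y ⊆ V` is a closed submanifold of dimension `k` (the inclusion is a smooth embedding) that is
strictly coisotropic with respect to `α`. -/
structure IsStrictlyCoisotropic (k : ℕ) (Y : Set V)
    [ChartedSpace (EuclideanSpace ℝ (Fin k)) Y] : Prop where
  isClosed : IsClosed Y
  embedding : IsSmoothEmbedding (𝓡 k) (𝓡 (2 * n + 1)) ∞ (Subtype.val : Y → V)
  /-- `Y` is transverse to `ξ = ker α`. -/
  transverse : ∀ y : Y, tangentSub (n := n) (k := k) y ⊔ LinearMap.ker (α.form y).toLinearMap = ⊤
  /-- `TY ∩ ξ` is a coisotropic subbundle of `(ξ|_Y, dα)`. -/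
  coisotropic : ∀ (y : Y) (X : TangentSpace (𝓡 (2 * n + 1)) (y : V)), α.form y X = 0 →
    (∀ Z ∈ tangentSub (n := n) (k := k) y, α.form y Z = 0 → extD α.form y X Z = 0) →
    X ∈ tangentSub (n := n) (k := k) y
  /-- The Reeb vector field is tangent to `Y`. -/
  reeb_mem : ∀ y : Y, reeb α y ∈ tangentSub (n := n) (k := k) y

end Reduction

/-- `ρ : Y → B` is a smooth fiber bundle with fiber the manifold `F`. -/
def IsSmoothFiberBundle {k b f : ℕ} {Y B : Type*} (F : Type*)
    [TopologicalSpace Y] [ChartedSpace (EuclideanSpace ℝ (Fin k)) Y]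
    [TopologicalSpace B] [ChartedSpace (EuclideanSpace ℝ (Fin b)) B]
    [TopologicalSpace F] [ChartedSpace (EuclideanSpace ℝ (Fin f)) F] (ρ : Y → B) : Prop :=
  ∀ x : B, ∃ e : Bundle.Trivialization F ρ, x ∈ e.baseSet ∧
    ContMDiffOn (𝓡 k) ((𝓡 b).prod (𝓡 f)) ∞ e e.source ∧
    ContMDiffOn ((𝓡 b).prod (𝓡 f)) (𝓡 k) ∞ e.toOpenPartialHomeomorph.symm e.target

/-- `h` is an extension of `hb`: the restriction of `h` to `[0,1] × Y` is `ρ^* hb`. -/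
def IsExtension {n m : ℕ} {V W : Type*} [TopologicalSpace V]
    [ChartedSpace (EuclideanSpace ℝ (Fin (2 * n + 1))) V] [TopologicalSpace W]
    [ChartedSpace (EuclideanSpace ℝ (Fin (2 * m + 1))) W] {Y : Set V} (ρ : Y → W)
    (hb : Ham m W) (h : Ham n V) : Prop :=
  ∀ (t : I) (y : Y), h (t, (y : V)) = hb (t, ρ y)

end ContactGeom

end

/-!
The function `μb` is well defined because of a statement about isotopies instead of Hamiltonians.
By strict coisotropy, along `Y` the contact vector field of an extension `h` of `hb` is tangent to
`Y` and projects to the contact vector field of `hb` (`IsReduction.exists_tangent`). Hence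
`h` extends `hb` if and only if the isotopy generated by `h` preserves `Y` and covers, via `ρ`, the
isotopy generated by `hb` (`IsReduction.covers_of_isExtension`,
`IsReduction.isExtension_of_covers`). Covering is compatible with products, inverses and powers.

Let `Φ` be an isotopy covering the identity and `Θ` the flow of the constant Hamiltonian `-1`. The
Hamiltonian of `Θ Φ` equals `-1` on `Y`, so it lies below an autonomous Hamiltonian vanishing on
`Y`. Monotonicity and subheaviness give `μ(Θ Φ) ≤ 0`, whence an upper bound for `μ(Φ)` that does not
depend on `Φ` (`IsReduction.exists_bound_of_covers_one`). If `Φ` and `Ψ` cover the same isotopy,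
this bound applies to `Φ^j Ψ^{-j}` for all `j`; homogeneity then gives `μ(Φ) = μ(Ψ)`
(`IsReduction.eq_of_covers`). A homotopy of isotopies of `W` is covered by a homotopy with fixed
endpoints of isotopies of `V`: its generators in the direction of the homotopy are extended to `V`,
and they vanish at the ends (`IsReduction.exists_homotopic`). So `μ(φ̃_h)` depends only on the class
of `φ̃_hb` (`IsReduction.lift_congr`), and `μb` inherits the quasi-morphism inequality and
homogeneity from `μ`. It is nonzero because a monotone quasi-morphism vanishing on all constant
Hamiltonians vanishes identically, and constants extend constants. Monotonicity, the vanishing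
property and `C⁰`-continuity follow from the existence of extensions which are nonnegative,
supported in displaceable sets, and sup-norm continuous in `hb`.

The analysis underneath is carried out in a Euclidean space `E` containing the closed manifold `M`.
Averaging local left inverses of the embedding with a partition of unity gives an operator extending
functions, vector fields and one-forms from `M` to `E` (`RetractData.ext`, `RetractData.form`).
Flows on `M` are restrictions of flows of compactly supported fields on `E`, which preserve `M`
(`IsEmb.invariant`); their smoothness up to the boundary of the parameter intervals is
`contDiffOn_flow`. Cartan's formula (`RetractData.hasDerivWithinAt_form`) shows that contact vector
fields integrate to contact isotopies (`exists_contactFamily`) and that contact isotopies are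
generated by Hamiltonians (`exists_integrates`). The same extension operator, applied to the
embedding of `Y`, extends Hamiltonians from `Y` to `V` (`IsReduction.exists_extension_operator`).
-/

noncomputable section

namespace ContactGeom

/-! ### Smooth dependence of solutions of ordinary differential equations -/

section ODE

universe u

theorem hasDerivWithinAt_Ici_of_Icc {E : Type*} [NormedAddCommGroup E] [NormedSpace ℝ E]
    {f : ℝ → E} {f' : E} {a b t : ℝ} (ht : t ∈ Ico a b) (h : HasDerivWithinAt f f' (Icc a b) t) :
    HasDerivWithinAt f f' (Ici t) t :=
  h.mono_of_mem_nhdsWithin (Icc_mem_nhdsGE_of_mem ht)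

/-- A bounded, uniformly Lipschitz field has solutions on the whole unit interval. -/
theorem exists_solution_of_bounded {E : Type*} [NormedAddCommGroup E] [NormedSpace ℝ E]
    [CompleteSpace E] {X : ℝ → E → E} {K L : NNReal}
    (hK : ∀ t ∈ Icc (0 : ℝ) 1, LipschitzWith K (X t))
    (hc : ∀ x, ContinuousOn (fun t => X t x) (Icc 0 1))
    (hL : ∀ t ∈ Icc (0 : ℝ) 1, ∀ x, ‖X t x‖ ≤ L) (x : E) :
    ∃ u : ℝ → E, u 0 = x ∧ ∀ t ∈ Icc (0 : ℝ) 1, HasDerivWithinAt u (X t (u t)) (Icc 0 1) t := by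
  have : IsPicardLindelof X (tmin := 0) (tmax := 1) ⟨0, by simp⟩ x L 0 L K :=
    ⟨fun t ht => (hK t ht).lipschitzOnWith, fun x _ => hc x, fun t ht x _ => hL t ht x, by simp⟩
  exact this.exists_eq_forall_mem_Icc_hasDerivWithinAt₀

/-- Grönwall's inequality on the unit interval. -/
theorem norm_le_of_norm_deriv_le {E : Type*} [NormedAddCommGroup E] [NormedSpace ℝ E]
    {u u' : ℝ → E} {K c : ℝ} (hK : 0 ≤ K)
    (hu : ∀ t ∈ Icc (0 : ℝ) 1, HasDerivWithinAt u (u' t) (Icc 0 1) t) (h0 : ‖u 0‖ ≤ c)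
    (hb : ∀ t ∈ Icc (0 : ℝ) 1, ‖u' t‖ ≤ K * ‖u t‖) :
    ∀ t ∈ Icc (0 : ℝ) 1, ‖u t‖ ≤ c * Real.exp K := by
  intro t ht
  have := norm_le_gronwallBound_of_norm_deriv_right_le (f := u) (f' := u') (δ := c) (K := K)
    (ε := 0) (a := 0) (b := 1) (fun t ht => (hu t ht).continuousWithinAt)
    (fun t ht => hasDerivWithinAt_Ici_of_Icc ht (hu t (Ico_subset_Icc_self ht))) h0
    (fun t ht => by simpa using hb t (Ico_subset_Icc_self ht)) t ht
  rw [gronwallBound_ε0] at this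
  refine this.trans ?_
  have hc : 0 ≤ c := (norm_nonneg _).trans h0
  gcongr
  nlinarith [ht.1, ht.2]

/-- Grönwall's inequality with a perturbation; the bound is linear in the size `c` of the initial
value and of the perturbation. -/
theorem norm_le_of_norm_deriv_le_add {E : Type*} [NormedAddCommGroup E] [NormedSpace ℝ E]
    {u u' : ℝ → E} {K c : ℝ} (hK : 0 ≤ K) (hc : 0 ≤ c)
    (hu : ∀ t ∈ Icc (0 : ℝ) 1, HasDerivWithinAt u (u' t) (Icc 0 1) t) (h0 : ‖u 0‖ ≤ c)
    (hb : ∀ t ∈ Icc (0 : ℝ) 1, ‖u' t‖ ≤ K * ‖u t‖ + c) :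
    ∀ t ∈ Icc (0 : ℝ) 1, ‖u t‖ ≤ c * (2 * Real.exp (K + 1)) := by
  intro t ht
  have := norm_le_gronwallBound_of_norm_deriv_right_le (f := u) (f' := u') (δ := c) (K := K + 1)
    (ε := c) (a := 0) (b := 1) (fun t ht => (hu t ht).continuousWithinAt)
    (fun t ht => hasDerivWithinAt_Ici_of_Icc ht (hu t (Ico_subset_Icc_self ht))) h0
    (fun t ht => by
      have := hb t (Ico_subset_Icc_self ht)
      nlinarith [norm_nonneg (u t)]) t ht
  rw [gronwallBound_of_K_ne_0 (by positivity)] at this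
  have e1 : Real.exp ((K + 1) * (t - 0)) ≤ Real.exp (K + 1) := by
    gcongr
    nlinarith [ht.1, ht.2]
  have e2 : c / (K + 1) ≤ c := div_le_self hc (by linarith)
  have e3 : 0 ≤ c / (K + 1) := by positivity
  have e4 : 0 < Real.exp ((K + 1) * (t - 0)) := Real.exp_pos _
  have e5 : 0 < Real.exp (K + 1) := Real.exp_pos _
  refine this.trans ?_
  nlinarith [mul_le_mul e2 e1 e4.le hc, mul_le_mul_of_nonneg_left e1 hc]

/-- A linear ODE with continuous coefficients has solutions on the whole time interval: the field
is cut off outside a ball which, by Grönwall's inequality, solutions do not leave. -/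
theorem exists_solution_linear {F : Type*} [NormedAddCommGroup F] [NormedSpace ℝ F]
    [FiniteDimensional ℝ F] {A : ℝ → F →L[ℝ] F} (hA : ContinuousOn A (Icc 0 1)) (w₀ : F) :
    ∃ w : ℝ → F, w 0 = w₀ ∧ ∀ t ∈ Icc (0 : ℝ) 1, HasDerivWithinAt w (A t (w t)) (Icc 0 1) t := by
  have : CompleteSpace F := FiniteDimensional.complete ℝ F
  obtain ⟨C, hC⟩ := isCompact_Icc.exists_bound_of_continuousOn hA
  have hC0 : 0 ≤ C := (norm_nonneg _).trans (hC 0 (by simp))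
  set R : ℝ := ‖w₀‖ * Real.exp C + 1 with hR
  have hRpos : 0 < R := by positivity
  let φ : ContDiffBump (0 : F) := ⟨R, R + 1, hRpos, by linarith⟩
  have hg : ContDiff ℝ 1 (fun w : F => φ w • w) := φ.contDiff.smul contDiff_id
  have hgs : HasCompactSupport (fun w : F => φ w • w) := φ.hasCompactSupport.smul_right
  obtain ⟨K, hK⟩ := hg.lipschitzWith_of_hasCompactSupport hgs one_ne_zero
  obtain ⟨B, hB⟩ := hgs.exists_bound_of_continuous hg.continuous
  have hB0 : 0 ≤ B := (norm_nonneg _).trans (hB 0)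
  obtain ⟨w, hw0, hw⟩ := exists_solution_of_bounded (X := fun t w => A t (φ w • w))
    (K := C.toNNReal * K) (L := (C * B).toNNReal)
    (fun t ht => ((A t).lipschitz.weaken (by
      rw [← NNReal.coe_le_coe, coe_nnnorm, Real.coe_toNNReal _ hC0]; exact hC t ht)).comp hK)
    (fun x => hA.clm_apply continuousOn_const)
    (fun t ht x => by
      rw [Real.coe_toNNReal _ (by positivity)]
      exact ((A t).le_opNorm _).trans (mul_le_mul (hC t ht) (hB x) (norm_nonneg _) hC0)) w₀
  refine ⟨w, hw0, fun t ht => ?_⟩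
  have hle := norm_le_of_norm_deriv_le hC0 hw (by rw [hw0]) (fun t ht => by
    refine ((A t).le_opNorm _).trans (mul_le_mul (hC t ht) ?_ (norm_nonneg _) hC0)
    rw [norm_smul, Real.norm_of_nonneg φ.nonneg]
    exact mul_le_of_le_one_left (norm_nonneg _) φ.le_one) t ht
  have h1 : φ (w t) = 1 := φ.one_of_mem_closedBall (by
    rw [mem_closedBall_zero_iff]; exact hle.trans (by change _ ≤ R; linarith))
  simpa [h1] using hw t ht

theorem eventually_forall_Icc_norm_sub_lt {P F : Type*} [TopologicalSpace P]
    [NormedAddCommGroup F] {S : Set P} {B : P → ℝ → F}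
    (hB : ContinuousOn (fun q : P × ℝ => B q.1 q.2) (S ×ˢ Icc 0 1)) {p : P} (hp : p ∈ S)
    {ε : ℝ} (hε : 0 < ε) :
    ∀ᶠ p' in 𝓝[S] p, ∀ t ∈ Icc (0 : ℝ) 1, ‖B p' t - B p t‖ < ε := by
  rw [eventually_nhdsWithin_iff]
  have := (isCompact_Icc (a := (0 : ℝ)) (b := 1)).eventually_forall_of_forall_eventually
    (x₀ := p) (P := fun p' t => p' ∈ S → t ∈ Icc (0 : ℝ) 1 → ‖B p' t - B p t‖ < ε) ?_
  · filter_upwards [this] with p' h hS t ht using h t ht hS ht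
  intro t ht
  have h1 : ContinuousWithinAt (fun q : P × ℝ => B q.1 q.2 - B p q.2) (S ×ˢ Icc 0 1) (p, t) := by
    refine (hB (p, t) ⟨hp, ht⟩).sub ?_
    exact (hB.comp (f := fun q : P × ℝ => (p, q.2)) (by fun_prop)
      (fun q hq => ⟨hp, hq.2⟩)) (p, t) ⟨hp, ht⟩
  have h2 : ∀ᶠ q in 𝓝[S ×ˢ Icc 0 1] (p, t), ‖B q.1 q.2 - B p q.2‖ < ε := by
    have h3 := h1.norm
    simp only [ContinuousWithinAt, sub_self, norm_zero] at h3
    exact h3.eventually (gt_mem_nhds hε)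
  rw [eventually_nhdsWithin_iff] at h2
  filter_upwards [h2] with q hq h3 h4 using hq ⟨h3, h4⟩

theorem continuousOn_uncurry_of_uniform {P F : Type*} [TopologicalSpace P]
    [NormedAddCommGroup F] {S : Set P} {B : P → ℝ → F}
    (hc : ∀ p ∈ S, ContinuousOn (B p) (Icc 0 1))
    (h : ∀ p ∈ S, ∀ ε > 0, ∀ᶠ p' in 𝓝[S] p, ∀ t ∈ Icc (0 : ℝ) 1, ‖B p' t - B p t‖ ≤ ε) :
    ContinuousOn (fun q : P × ℝ => B q.1 q.2) (S ×ˢ Icc 0 1) := by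
  rintro ⟨p, t⟩ ⟨hp, ht⟩
  rw [ContinuousWithinAt, Metric.tendsto_nhds]
  intro ε hε
  have h1 := h p hp (ε / 2) (half_pos hε)
  have h2 := (Metric.tendsto_nhds.1 (hc p hp t ht) (ε / 2) (half_pos hε))
  rw [nhdsWithin_prod_eq]
  filter_upwards [prod_mem_prod h1 (inter_mem h2 self_mem_nhdsWithin)] with q hq
  simp only [mem_prod, mem_inter_iff, mem_ofPred_eq] at hq
  calc dist (B q.1 q.2) (B p t) ≤ dist (B q.1 q.2) (B p q.2) + dist (B p q.2) (B p t) :=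
        dist_triangle _ _ _
    _ < ε := by
        have := hq.1 q.2 hq.2.2
        rw [← dist_eq_norm] at this
        linarith [hq.2.1]

/-- Solutions of a linear ODE depend continuously on parameters in the coefficients. -/
theorem continuousOn_solution_linear {P F : Type*} [TopologicalSpace P]
    [NormedAddCommGroup F] [NormedSpace ℝ F] {S : Set P} {A : P → ℝ → F →L[ℝ] F}
    (hA : ContinuousOn (fun q : P × ℝ => A q.1 q.2) (S ×ˢ Icc 0 1)) {w : P → ℝ → F} {w₀ : F}
    (h0 : ∀ p ∈ S, w p 0 = w₀)
    (hw : ∀ p ∈ S, ∀ t ∈ Icc (0 : ℝ) 1, HasDerivWithinAt (w p) (A p t (w p t)) (Icc 0 1) t) :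
    ContinuousOn (fun q : P × ℝ => w q.1 q.2) (S ×ˢ Icc 0 1) := by
  have hwc : ∀ p ∈ S, ContinuousOn (w p) (Icc 0 1) :=
    fun p hp t ht => (hw p hp t ht).continuousWithinAt
  refine continuousOn_uncurry_of_uniform hwc fun p hp ε hε => ?_
  obtain ⟨C, hC⟩ := isCompact_Icc.exists_bound_of_continuousOn
    (hA.comp (f := fun t : ℝ => (p, t)) (by fun_prop) (fun t ht => ⟨hp, ht⟩))
  obtain ⟨D, hD⟩ := isCompact_Icc.exists_bound_of_continuousOn (hwc p hp)
  have hC0 : 0 ≤ C := (norm_nonneg _).trans (hC 0 (by simp))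
  have hD0 : 0 ≤ D := (norm_nonneg _).trans (hD 0 (by simp))
  obtain ⟨η, hη, hη'⟩ : ∃ η > 0, D * η * (2 * Real.exp (C + 1 + 1)) ≤ ε := by
    refine ⟨ε / ((D + 1) * (2 * Real.exp (C + 1 + 1))), by positivity, ?_⟩
    rw [← mul_div_assoc, div_mul_eq_mul_div, div_le_iff₀ (by positivity)]
    have : 0 ≤ ε * (2 * Real.exp (C + 1 + 1)) := by positivity
    nlinarith
  filter_upwards [eventually_forall_Icc_norm_sub_lt hA hp (lt_min hη one_pos),
    self_mem_nhdsWithin] with p' hp' hpS t ht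
  refine le_trans ?_ hη'
  refine norm_le_of_norm_deriv_le_add (u := fun t => w p' t - w p t) (c := D * η) (K := C + 1)
    (by positivity) (by positivity)
    (fun t ht => (hw p' hpS t ht).sub (hw p hp t ht)) (by simp [h0 p hp, h0 p' hpS]; positivity)
    (fun t ht => ?_) t ht
  have e : A p' t (w p' t) - A p t (w p t)
      = A p' t (w p' t - w p t) + (A p' t - A p t) (w p t) := by
    simp
  have h1 : ‖A p' t - A p t‖ ≤ η := (hp' t ht).le.trans (min_le_left _ _)
  have h2 : ‖A p' t‖ ≤ C + 1 := by
    have h3 : ‖A p' t - A p t‖ ≤ 1 := (hp' t ht).le.trans (min_le_right _ _)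
    have h4 := hC t ht
    calc ‖A p' t‖ = ‖A p t + (A p' t - A p t)‖ := by congr 1; abel
      _ ≤ C + 1 := (norm_add_le _ _).trans (add_le_add h4 h3)
  rw [e]
  refine (norm_add_le _ _).trans (add_le_add ?_ ?_)
  · exact ((A p' t).le_opNorm _).trans (by gcongr)
  · refine ((A p' t - A p t).le_opNorm _).trans ?_
    rw [mul_comm]
    exact mul_le_mul (hD t ht) h1 (norm_nonneg _) hD0

/-- First order dependence on the initial value: the derivative of the flow solves the linearised
equation. -/
theorem hasFDerivWithinAt_flow {E : Type*} [NormedAddCommGroup E] [NormedSpace ℝ E]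
    {S : Set E} (hS : Convex ℝ S) {X : ℝ → E → E} {DX : ℝ → E → E →L[ℝ] E}
    (hX : ∀ t ∈ Icc (0 : ℝ) 1, ∀ x ∈ S, HasFDerivWithinAt (X t) (DX t x) S x)
    (hDX : ContinuousOn (fun q : ℝ × E => DX q.1 q.2) (Icc 0 1 ×ˢ S))
    {Φ : E → ℝ → E} (hΦS : ∀ x ∈ S, ∀ t ∈ Icc (0 : ℝ) 1, Φ x t ∈ S)
    (hΦ0 : ∀ x ∈ S, Φ x 0 = x)
    (hΦ : ∀ x ∈ S, ∀ t ∈ Icc (0 : ℝ) 1, HasDerivWithinAt (Φ x) (X t (Φ x t)) (Icc 0 1) t)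
    (hΦc : ContinuousOn (fun q : E × ℝ => Φ q.1 q.2) (S ×ˢ Icc 0 1))
    {w : E → ℝ → E →L[ℝ] E} (hw0 : ∀ x ∈ S, w x 0 = .id ℝ E)
    (hw : ∀ x ∈ S, ∀ t ∈ Icc (0 : ℝ) 1,
      HasDerivWithinAt (w x) ((DX t (Φ x t)).comp (w x t)) (Icc 0 1) t)
    {x : E} (hx : x ∈ S) {t : ℝ} (ht : t ∈ Icc (0 : ℝ) 1) :
    HasFDerivWithinAt (fun x => Φ x t) (w x t) S x := by
  have hcurve : ContinuousOn (fun t => Φ x t) (Icc 0 1) :=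
    fun t ht => (hΦ x hx t ht).continuousWithinAt
  obtain ⟨L, hL⟩ := isCompact_Icc.exists_bound_of_continuousOn
    (hDX.comp (f := fun t : ℝ => (t, Φ x t)) (continuousOn_id.prodMk hcurve)
      (fun t ht => ⟨ht, hΦS x hx t ht⟩))
  have hL0 : 0 ≤ L := (norm_nonneg _).trans (hL 0 (by simp))
  set C : ℝ := Real.exp (L + 1) * (2 * Real.exp (L + 1)) with hC
  have hCpos : 0 < C := by positivity
  refine HasFDerivWithinAt.of_isLittleO (Asymptotics.isLittleO_iff.2 fun c hc => ?_)
  obtain ⟨ε, hε, hε1, hεC⟩ : ∃ ε > 0, ε ≤ 1 ∧ ε * C ≤ c := by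
    refine ⟨min 1 (c / C), lt_min one_pos (by positivity), min_le_left _ _, ?_⟩
    calc min 1 (c / C) * C ≤ c / C * C := by gcongr; exact min_le_right _ _
      _ = c := by field_simp
  -- uniform continuity of the derivative of the field along the compact curve `t ↦ Φ x t`
  have hunif : ∀ᶠ e in 𝓝 (0 : E), ∀ t ∈ Icc (0 : ℝ) 1, Φ x t + e ∈ S →
      ‖DX t (Φ x t + e) - DX t (Φ x t)‖ ≤ ε := by
    have := (isCompact_Icc (a := (0 : ℝ)) (b := 1)).eventually_forall_of_forall_eventually
      (x₀ := (0 : E)) (P := fun e t => t ∈ Icc (0 : ℝ) 1 → Φ x t + e ∈ S →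
        ‖DX t (Φ x t + e) - DX t (Φ x t)‖ ≤ ε) ?_
    · filter_upwards [this] with e h t ht using h t ht ht
    intro t ht
    set T : Set (E × ℝ) := {q | q.2 ∈ Icc (0 : ℝ) 1 ∧ Φ x q.2 + q.1 ∈ S} with hT
    have hmem : ((0 : E), t) ∈ T := ⟨ht, by simpa using hΦS x hx t ht⟩
    have hc2 : ContinuousOn (fun q : E × ℝ => Φ x q.2) T :=
      hcurve.comp continuousOn_snd (fun q hq => hq.1)
    have h1 : ContinuousWithinAt (fun q : E × ℝ => DX q.2 (Φ x q.2 + q.1) - DX q.2 (Φ x q.2))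
        T ((0 : E), t) := by
      refine ContinuousWithinAt.sub ?_ ?_
      · exact (hDX.comp (f := fun q : E × ℝ => (q.2, Φ x q.2 + q.1))
          (continuousOn_snd.prodMk (hc2.add continuousOn_fst)) (fun q hq => ⟨hq.1, hq.2⟩)) _ hmem
      · exact (hDX.comp (f := fun q : E × ℝ => (q.2, Φ x q.2))
          (continuousOn_snd.prodMk hc2) (fun q hq => ⟨hq.1, hΦS x hx _ hq.1⟩)) _ hmem
    have h3 := h1.norm
    simp only [ContinuousWithinAt, add_zero, sub_self, norm_zero] at h3
    have h2 := h3.eventually (gt_mem_nhds hε)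
    rw [eventually_nhdsWithin_iff] at h2
    filter_upwards [h2] with q hq h3 h4 using (hq ⟨h3, h4⟩).le
  obtain ⟨δ, hδ, hball⟩ := Metric.eventually_nhds_iff_ball.1 hunif
  filter_upwards [eventually_forall_Icc_norm_sub_lt hΦc hx hδ, self_mem_nhdsWithin] with y hy hyS
  have hlin : ∀ t ∈ Icc (0 : ℝ) 1,
      ‖X t (Φ y t) - X t (Φ x t) - DX t (Φ x t) (Φ y t - Φ x t)‖ ≤ ε * ‖Φ y t - Φ x t‖ := by
    intro t ht
    refine Convex.norm_image_sub_le_of_norm_hasFDerivWithin_le' (s := S ∩ Metric.ball (Φ x t) δ)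
      (f' := DX t) (fun z hz => (hX t ht z hz.1).mono inter_subset_left) (fun z hz => ?_)
      (hS.inter (convex_ball _ _)) ⟨hΦS x hx t ht, Metric.mem_ball_self hδ⟩
      ⟨hΦS y hyS t ht, by rw [mem_ball_iff_norm]; exact hy t ht⟩
    have := hball (z - Φ x t) (by rw [mem_ball_zero_iff, ← mem_ball_iff_norm]; exact hz.2) t ht
      (by simpa using hz.1)
    simpa using this
  have hρ : ∀ t ∈ Icc (0 : ℝ) 1, ‖Φ y t - Φ x t‖ ≤ ‖y - x‖ * Real.exp (L + 1) := by
    refine norm_le_of_norm_deriv_le (by positivity)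
      (fun t ht => (hΦ y hyS t ht).sub (hΦ x hx t ht)) (by rw [hΦ0 y hyS, hΦ0 x hx])
      (fun t ht => ?_)
    calc ‖X t (Φ y t) - X t (Φ x t)‖
        = ‖(X t (Φ y t) - X t (Φ x t) - DX t (Φ x t) (Φ y t - Φ x t))
          + DX t (Φ x t) (Φ y t - Φ x t)‖ := by congr 1; abel
      _ ≤ ε * ‖Φ y t - Φ x t‖ + L * ‖Φ y t - Φ x t‖ := by
          refine (norm_add_le _ _).trans (add_le_add (hlin t ht) ?_)
          exact ((DX t (Φ x t)).le_opNorm _).trans (by gcongr; exact hL t ht)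
      _ ≤ (L + 1) * ‖Φ y t - Φ x t‖ := by nlinarith [norm_nonneg (Φ y t - Φ x t)]
  have hfin := norm_le_of_norm_deriv_le_add (u := fun t => Φ y t - Φ x t - w x t (y - x))
    (u' := fun t => X t (Φ y t) - X t (Φ x t) - DX t (Φ x t) (w x t (y - x)))
    (c := ε * (‖y - x‖ * Real.exp (L + 1))) (K := L) hL0 (by positivity)
    (fun t ht => by
      refine ((hΦ y hyS t ht).sub (hΦ x hx t ht)).sub ?_
      have := (hw x hx t ht).clm_apply (hasDerivWithinAt_const t (Icc 0 1) (y - x))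
      simpa using this)
    (by simp only [hΦ0 y hyS, hΦ0 x hx, hw0 x hx]; simp; positivity)
    (fun t ht => by
      have e : X t (Φ y t) - X t (Φ x t) - DX t (Φ x t) (w x t (y - x))
          = DX t (Φ x t) (Φ y t - Φ x t - w x t (y - x))
            + (X t (Φ y t) - X t (Φ x t) - DX t (Φ x t) (Φ y t - Φ x t)) := by
        rw [map_sub (DX t (Φ x t)) (Φ y t - Φ x t)]; abel
      rw [e]
      refine (norm_add_le _ _).trans (add_le_add ?_ ?_)
      · exact ((DX t (Φ x t)).le_opNorm _).trans (by gcongr; exact hL t ht)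
      · exact (hlin t ht).trans (by gcongr; exact hρ t ht)) t ht
  refine hfin.trans ?_
  calc ε * (‖y - x‖ * Real.exp (L + 1)) * (2 * Real.exp (L + 1)) = ε * C * ‖y - x‖ := by
        rw [hC]; ring
    _ ≤ c * ‖y - x‖ := by gcongr

/-- A function of `(x, t)` with a continuous partial derivative in `x` and a partial derivative
in `t` is differentiable. -/
theorem hasFDerivWithinAt_of_partial {E F : Type*} [NormedAddCommGroup E] [NormedSpace ℝ E]
    [NormedAddCommGroup F] [NormedSpace ℝ F] {S : Set E} (hS : Convex ℝ S) {J : Set ℝ}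
    {f : E → ℝ → F} {w : E → ℝ → E →L[ℝ] F} {v : F}
    (hw : ∀ x ∈ S, ∀ t ∈ J, HasFDerivWithinAt (fun x => f x t) (w x t) S x)
    (hwc : ContinuousOn (fun q : E × ℝ => w q.1 q.2) (S ×ˢ J)) {x : E} (hx : x ∈ S) {t : ℝ}
    (ht : t ∈ J) (hv : HasDerivWithinAt (f x) v J t) :
    HasFDerivWithinAt (fun q : E × ℝ => f q.1 q.2)
      ((w x t).comp (.fst ℝ E ℝ) + (ContinuousLinearMap.toSpanSingleton ℝ v).comp (.snd ℝ E ℝ))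
      (S ×ˢ J) (x, t) := by
  refine HasFDerivWithinAt.of_isLittleO (Asymptotics.isLittleO_iff.2 fun c hc => ?_)
  have h1 := hwc (x, t) ⟨hx, ht⟩
  have h2 : ∀ᶠ q in 𝓝[S] x ×ˢ 𝓝[J] t, ‖w q.1 q.2 - w x t‖ < c / 2 := by
    rw [← nhdsWithin_prod_eq]
    have := Metric.tendsto_nhds.1 h1 (c / 2) (half_pos hc)
    simpa only [dist_eq_norm] using this
  have h3 := Asymptotics.isLittleO_iff.1 hv.hasFDerivWithinAt.isLittleO (half_pos hc)
  obtain ⟨U, hU, hU'⟩ := Metric.nhdsWithin_basis_ball.prod Metric.nhdsWithin_basis_ball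
    |>.eventually_iff.1 h2
  have h5 : Metric.ball x U.1 ∩ S ∈ 𝓝[S] x :=
    inter_mem (mem_nhdsWithin_of_mem_nhds (Metric.ball_mem_nhds _ hU.1)) self_mem_nhdsWithin
  have h6 : Metric.ball t U.2 ∩ J ∈ 𝓝[J] t :=
    inter_mem (mem_nhdsWithin_of_mem_nhds (Metric.ball_mem_nhds _ hU.2)) self_mem_nhdsWithin
  rw [nhdsWithin_prod_eq]
  filter_upwards [prod_mem_prod h5 (inter_mem h6 h3)] with q hq
  obtain ⟨⟨hq1, hq2⟩, ⟨hq3, hq4⟩, hq5⟩ := hq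
  simp only [mem_ofPred_eq] at hq5
  have h7 : ‖f q.1 q.2 - f x q.2 - w x t (q.1 - x)‖ ≤ c / 2 * ‖q.1 - x‖ := by
    refine Convex.norm_image_sub_le_of_norm_hasFDerivWithin_le' (s := S ∩ Metric.ball x U.1)
      (f := fun z => f z q.2) (f' := fun z => w z q.2)
      (fun z hz => (hw z hz.1 q.2 hq4).mono inter_subset_left)
      (fun z hz => ?_) (hS.inter (convex_ball _ _)) ⟨hx, Metric.mem_ball_self hU.1⟩ ⟨hq2, hq1⟩
    exact (hU' (x := (z, q.2)) ⟨⟨hz.2, hz.1⟩, hq3, hq4⟩).le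
  have e : f q.1 q.2 - f x t - ((w x t).comp (.fst ℝ E ℝ)
      + (ContinuousLinearMap.toSpanSingleton ℝ v).comp (.snd ℝ E ℝ)) (q - (x, t))
      = (f q.1 q.2 - f x q.2 - w x t (q.1 - x))
        + (f x q.2 - f x t - (ContinuousLinearMap.toSpanSingleton ℝ v) (q.2 - t)) := by
    simp; abel
  rw [e]
  have h8 : ‖q.1 - x‖ ≤ ‖q - (x, t)‖ := norm_fst_le (q - (x, t))
  have h9 : ‖q.2 - t‖ ≤ ‖q - (x, t)‖ := norm_snd_le (q - (x, t))
  calc _ ≤ c / 2 * ‖q.1 - x‖ + c / 2 * ‖q.2 - t‖ := (norm_add_le _ _).trans (add_le_add h7 hq5)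
    _ ≤ c * ‖q - (x, t)‖ := by nlinarith

/-- The flow of a `C^n` time-dependent field on a convex state space is `C^n` in the initial value
and time jointly. By induction on `n`: the spatial derivative of the flow is itself part of a flow,
that of the linearised equation. Convex sets with boundary are allowed as state spaces, so that
parameters ranging over closed intervals can be made part of the state. -/
theorem contDiffOn_flow (n : ℕ) : ∀ {E : Type u} [NormedAddCommGroup E] [NormedSpace ℝ E]
    [FiniteDimensional ℝ E] {S : Set E} (_ : Convex ℝ S) (_ : UniqueDiffOn ℝ S)
    {X : ℝ × E → E} (_ : ContDiffOn ℝ n X (Icc 0 1 ×ˢ S))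
    {Φ : E → ℝ → E} (_ : ∀ x ∈ S, ∀ t ∈ Icc (0 : ℝ) 1, Φ x t ∈ S)
    (_ : ∀ x ∈ S, Φ x 0 = x)
    (_ : ∀ x ∈ S, ∀ t ∈ Icc (0 : ℝ) 1, HasDerivWithinAt (Φ x) (X (t, Φ x t)) (Icc 0 1) t)
    (_ : ContinuousOn (fun q : E × ℝ => Φ q.1 q.2) (S ×ˢ Icc 0 1)),
    ContDiffOn ℝ n (fun q : E × ℝ => Φ q.1 q.2) (S ×ˢ Icc 0 1) := by
  induction n with
  | zero =>
    intro E _ _ _ S _ _ X _ Φ _ _ _ hc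
    exact contDiffOn_zero.2 hc
  | succ n ih =>
    intro E _ _ _ S hS hSu X hX Φ hΦS hΦ0 hΦ hΦc
    have hI : UniqueDiffOn ℝ (Icc (0 : ℝ) 1) := uniqueDiffOn_Icc one_pos
    have hIS := hI.prod hSu
    have hSI := hSu.prod hI
    have hXn : ContDiffOn ℝ n X (Icc 0 1 ×ˢ S) := hX.of_le (by norm_cast; omega)
    have hΦn := ih hS hSu hXn hΦS hΦ0 hΦ hΦc
    have hXd : ContDiffOn ℝ n (fderivWithin ℝ X (Icc 0 1 ×ˢ S)) (Icc 0 1 ×ˢ S) :=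
      hX.fderivWithin hIS (by norm_cast)
    let DX : ℝ → E → E →L[ℝ] E := fun t x =>
      (fderivWithin ℝ X (Icc 0 1 ×ˢ S) (t, x)).comp (.inr ℝ ℝ E)
    have hDXn : ContDiffOn ℝ n (fun q : ℝ × E => DX q.1 q.2) (Icc 0 1 ×ˢ S) :=
      hXd.clm_comp contDiffOn_const
    have hXD : ∀ t ∈ Icc (0 : ℝ) 1, ∀ x ∈ S,
        HasFDerivWithinAt (fun x => X (t, x)) (DX t x) S x := by
      intro t ht x hx
      have h1 : HasFDerivWithinAt X (fderivWithin ℝ X (Icc 0 1 ×ˢ S) (t, x)) (Icc 0 1 ×ˢ S)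
          (t, x) :=
        (hX.differentiableOn (by simp) (t, x) ⟨ht, hx⟩).hasFDerivWithinAt
      exact h1.comp x (hasFDerivAt_prodMk_right t x).hasFDerivWithinAt (fun z hz => ⟨ht, hz⟩)
    let A : E → ℝ → E →L[ℝ] E := fun x t => DX t (Φ x t)
    have hAn : ContDiffOn ℝ n (fun q : E × ℝ => A q.1 q.2) (S ×ˢ Icc 0 1) :=
      hDXn.comp (f := fun q : E × ℝ => (q.2, Φ q.1 q.2)) (contDiffOn_snd.prodMk hΦn)
        (fun q hq => ⟨hq.2, hΦS _ hq.1 _ hq.2⟩)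
    have hex : ∀ x, ∃ w : ℝ → E →L[ℝ] E, x ∈ S → w 0 = .id ℝ E ∧ ∀ t ∈ Icc (0 : ℝ) 1,
        HasDerivWithinAt w ((A x t).comp (w t)) (Icc 0 1) t := by
      intro x
      by_cases hx : x ∈ S
      · have hc : ContinuousOn (fun t => ContinuousLinearMap.compL ℝ E E E (A x t)) (Icc 0 1) :=
          (ContinuousLinearMap.compL ℝ E E E).continuous.comp_continuousOn
            (hAn.continuousOn.comp (f := fun t : ℝ => (x, t)) (by fun_prop) (fun t ht => ⟨hx, ht⟩))
        obtain ⟨w, h0, h1⟩ := exists_solution_linear hc (.id ℝ E)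
        exact ⟨w, fun _ => ⟨h0, h1⟩⟩
      · exact ⟨0, fun h => absurd h hx⟩
    choose w hw using hex
    have hwc : ContinuousOn (fun q : E × ℝ => w q.1 q.2) (S ×ˢ Icc 0 1) :=
      continuousOn_solution_linear (A := fun x t => ContinuousLinearMap.compL ℝ E E E (A x t))
        ((ContinuousLinearMap.compL ℝ E E E).continuous.comp_continuousOn hAn.continuousOn)
        (fun x hx => (hw x hx).1) (fun x hx => (hw x hx).2)
    -- `w` is the second component, at the initial value `id`, of the flow on `E × (E →L E)` of a
    -- field of class `C^n` whose first component, the parameter `x`, is constant in time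
    have hwn : ContDiffOn ℝ n (fun q : E × ℝ => w q.1 q.2) (S ×ˢ Icc 0 1) := by
      have key := ih (E := E × (E →L[ℝ] E)) (S := S ×ˢ univ) (hS.prod convex_univ)
        (hSu.prod uniqueDiffOn_univ)
        (X := fun q => (0, (A q.2.1 q.1).comp q.2.2))
        (contDiffOn_const.prodMk (ContDiffOn.clm_comp
          (hAn.comp (f := fun q : ℝ × E × (E →L[ℝ] E) => (q.2.1, q.1)) (by fun_prop)
            (fun q hq => ⟨hq.2.1, hq.1⟩)) (by fun_prop)))
        (Φ := fun z t => (z.1, (w z.1 t).comp z.2))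
        (fun z hz t ht => ⟨hz.1, trivial⟩)
        (fun z hz => by simp [(hw z.1 hz.1).1])
        (fun z hz t ht => by
          refine (hasDerivWithinAt_const t (Icc (0 : ℝ) 1) z.1).prodMk ?_
          have h1 := ((hw z.1 hz.1).2 t ht).clm_comp (hasDerivWithinAt_const t (Icc (0 : ℝ) 1) z.2)
          simpa [ContinuousLinearMap.comp_assoc] using h1)
        (continuousOn_fst.fst.prodMk (ContinuousOn.clm_comp
          (hwc.comp (f := fun q : (E × (E →L[ℝ] E)) × ℝ => (q.1.1, q.2)) (by fun_prop)
            (fun q hq => ⟨hq.1.1, hq.2⟩)) (by fun_prop)))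
      have h2 := (contDiff_snd.comp_contDiffOn key).comp
        (f := fun q : E × ℝ => ((q.1, ContinuousLinearMap.id ℝ E), q.2)) (s := S ×ˢ Icc 0 1)
        (by fun_prop) (fun q hq => ⟨⟨hq.1, trivial⟩, hq.2⟩)
      simpa [Function.comp_def] using h2
    have hder : ∀ q ∈ S ×ˢ Icc (0 : ℝ) 1, HasFDerivWithinAt (fun q : E × ℝ => Φ q.1 q.2)
        ((w q.1 q.2).comp (.fst ℝ E ℝ)
          + (ContinuousLinearMap.toSpanSingleton ℝ (X (q.2, Φ q.1 q.2))).comp (.snd ℝ E ℝ))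
        (S ×ˢ Icc 0 1) q := fun q hq =>
      hasFDerivWithinAt_of_partial hS
        (fun x hx t ht => hasFDerivWithinAt_flow hS hXD hDXn.continuousOn hΦS hΦ0 hΦ hΦc
          (fun x hx => (hw x hx).1) (fun x hx => (hw x hx).2) hx ht) hwc hq.1 hq.2
        (hΦ q.1 hq.1 q.2 hq.2)
    have hgoal : ContDiffOn ℝ ((n : WithTop ℕ∞) + 1) (fun q : E × ℝ => Φ q.1 q.2)
        (S ×ˢ Icc 0 1) := by
      rw [contDiffOn_succ_iff_fderivWithin hSI]
      refine ⟨fun q hq => (hder q hq).differentiableWithinAt, by simp, ?_⟩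
      refine ContDiffOn.congr ?_ (fun q hq => (hder q hq).fderivWithin (hSI q hq))
      refine (hwn.clm_comp contDiffOn_const).add (ContDiffOn.clm_comp ?_ contDiffOn_const)
      exact (ContinuousLinearMap.toSpanSingletonCLE (𝕜 := ℝ) (E := E)).contDiff.comp_contDiffOn
        (hXn.comp (f := fun q : E × ℝ => (q.2, Φ q.1 q.2)) (contDiffOn_snd.prodMk hΦn)
          (fun q hq => ⟨hq.2, hΦS _ hq.1 _ hq.2⟩))
    exact_mod_cast hgoal

end ODE

/-! ### Flows of compactly supported time-dependent fields -/

section Flow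

theorem eqOn_of_lipschitz {E : Type*} [NormedAddCommGroup E] [NormedSpace ℝ E]
    {X : ℝ → E → E} {K : NNReal} (hK : ∀ t ∈ Icc (0 : ℝ) 1, LipschitzWith K (X t)) {u v : ℝ → E}
    (hu : ∀ t ∈ Icc (0 : ℝ) 1, HasDerivWithinAt u (X t (u t)) (Icc 0 1) t)
    (hv : ∀ t ∈ Icc (0 : ℝ) 1, HasDerivWithinAt v (X t (v t)) (Icc 0 1) t) (h0 : u 0 = v 0) :
    EqOn u v (Icc 0 1) := by
  intro t ht
  have := norm_le_of_norm_deriv_le (u := fun t => u t - v t) (c := 0) K.2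
    (fun t ht => (hu t ht).sub (hv t ht)) (by simp [h0])
    (fun t ht => (hK t ht).norm_sub_le _ _) t ht
  simpa [sub_eq_zero] using this

/-- A smooth field depending on a compact set of parameters and vanishing outside a ball is
uniformly Lipschitz and bounded. -/
theorem exists_lipschitz_of_vanish {P E F : Type*} [NormedAddCommGroup P] [NormedSpace ℝ P]
    [NormedAddCommGroup E] [NormedSpace ℝ E] [FiniteDimensional ℝ E]
    [NormedAddCommGroup F] [NormedSpace ℝ F] {T : Set P} (hT : IsCompact T)
    (hTu : UniqueDiffOn ℝ T) {G : P × E → F} (hG : ContDiffOn ℝ ∞ G (T ×ˢ univ)) {R : ℝ}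
    (hR : ∀ p ∈ T, ∀ z, R ≤ ‖z‖ → G (p, z) = 0) :
    (∃ K : NNReal, ∀ p ∈ T, LipschitzWith K (fun z => G (p, z))) ∧
      ∃ L : NNReal, ∀ p ∈ T, ∀ z, ‖G (p, z)‖ ≤ L := by
  have hcpt : IsCompact (T ×ˢ Metric.closedBall (0 : E) R) :=
    hT.prod (isCompact_closedBall (0 : E) R)
  have hsub : T ×ˢ Metric.closedBall (0 : E) R ⊆ T ×ˢ univ := prod_mono_right (subset_univ _)
  have hu : UniqueDiffOn ℝ (T ×ˢ (univ : Set E)) := hTu.prod uniqueDiffOn_univ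
  have hd : ContinuousOn (fderivWithin ℝ G (T ×ˢ univ)) (T ×ˢ univ) :=
    hG.continuousOn_fderivWithin hu (by simp)
  obtain ⟨L, hL⟩ := hcpt.exists_bound_of_continuousOn (hG.continuousOn.mono hsub)
  obtain ⟨C, hC⟩ := hcpt.exists_bound_of_continuousOn (hd.mono hsub)
  have hder : ∀ p ∈ T, ∀ z, HasFDerivAt (fun z => G (p, z))
      ((fderivWithin ℝ G (T ×ˢ univ) (p, z)).comp (.inr ℝ P E)) z := by
    intro p hp z
    have h1 := (hG.differentiableOn (by simp) (p, z) ⟨hp, trivial⟩).hasFDerivWithinAt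
    have h2 := h1.comp (t := T ×ˢ univ) (s := univ) z
      ((hasFDerivAt_prodMk_right p z).hasFDerivWithinAt) (fun y _ => ⟨hp, trivial⟩)
    exact h2.hasFDerivAt univ_mem
  constructor
  · refine ⟨C.toNNReal, fun p hp => lipschitzWith_of_nnnorm_fderiv_le
      (fun z => (hder p hp z).differentiableAt) fun z => ?_⟩
    rw [← NNReal.coe_le_coe, coe_nnnorm]
    by_cases hz : ‖z‖ ≤ R
    · refine le_trans ?_ (Real.le_coe_toNNReal C)
      rw [(hder p hp z).fderiv]
      have h1 := hC (p, z) ⟨hp, by simpa using hz⟩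
      have h2 : ‖(fderivWithin ℝ G (T ×ˢ univ) (p, z)).comp (.inr ℝ P E)‖
          ≤ ‖fderivWithin ℝ G (T ×ˢ univ) (p, z)‖ * ‖ContinuousLinearMap.inr ℝ P E‖ :=
        ContinuousLinearMap.opNorm_comp_le _ _
      have h3 : ‖ContinuousLinearMap.inr ℝ P E‖ ≤ 1 := ContinuousLinearMap.norm_inr_le_one ℝ P E
      nlinarith [norm_nonneg (fderivWithin ℝ G (T ×ˢ univ) (p, z))]
    · have h1 : (fun z => G (p, z)) =ᶠ[𝓝 z] fun _ => 0 := by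
        filter_upwards [continuous_norm.tendsto z |>.eventually (lt_mem_nhds (not_le.1 hz))]
          with y hy using hR p hp y hy.le
      rw [h1.fderiv_eq]
      simp
  · refine ⟨L.toNNReal, fun p hp z => ?_⟩
    by_cases hz : ‖z‖ ≤ R
    · exact (hL (p, z) ⟨hp, by simpa using hz⟩).trans (Real.le_coe_toNNReal L)
    · rw [hR p hp z (not_le.1 hz).le, norm_zero]
      exact NNReal.coe_nonneg _

/-- Global solutions, smooth in parameters, initial values and time, of a compactly supported
time-dependent field. -/
theorem exists_smooth_flow {P E : Type*} [NormedAddCommGroup P] [NormedSpace ℝ P]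
    [FiniteDimensional ℝ P] [NormedAddCommGroup E] [NormedSpace ℝ E] [FiniteDimensional ℝ E]
    {T : Set P} (hT : IsCompact T) (hTc : Convex ℝ T) (hTu : UniqueDiffOn ℝ T)
    {G : (P × ℝ) × E → E} (hG : ContDiffOn ℝ ∞ G ((T ×ˢ Icc 0 1) ×ˢ univ)) {R : ℝ}
    (hR : ∀ p ∈ T ×ˢ Icc (0 : ℝ) 1, ∀ z, R ≤ ‖z‖ → G (p, z) = 0) :
    ∃ u : P → E → ℝ → E, (∀ p z, u p z 0 = z) ∧
      (∀ p ∈ T, ∀ z, ∀ t ∈ Icc (0 : ℝ) 1,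
        HasDerivWithinAt (u p z) (G ((p, t), u p z t)) (Icc 0 1) t) ∧
      ContDiffOn ℝ ∞ (fun q : (P × E) × ℝ => u q.1.1 q.1.2 q.2) ((T ×ˢ univ) ×ˢ Icc 0 1) := by
  have hI : UniqueDiffOn ℝ (Icc (0 : ℝ) 1) := uniqueDiffOn_Icc one_pos
  have : CompleteSpace E := FiniteDimensional.complete ℝ E
  obtain ⟨⟨K, hK⟩, L, hL⟩ := exists_lipschitz_of_vanish (hT.prod isCompact_Icc) (hTu.prod hI) hG hR
  have hex : ∀ p z, ∃ u : ℝ → E, u 0 = z ∧ (p ∈ T → ∀ t ∈ Icc (0 : ℝ) 1,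
      HasDerivWithinAt u (G ((p, t), u t)) (Icc 0 1) t) := by
    intro p z
    by_cases hp : p ∈ T
    · obtain ⟨u, h0, h1⟩ := exists_solution_of_bounded (X := fun t z => G ((p, t), z))
        (fun t ht => hK (p, t) ⟨hp, ht⟩)
        (fun z => hG.continuousOn.comp (f := fun t : ℝ => ((p, t), z)) (by fun_prop)
          (fun t ht => ⟨⟨hp, ht⟩, trivial⟩)) (fun t ht => hL (p, t) ⟨hp, ht⟩) z
      exact ⟨u, h0, fun _ => h1⟩
    · exact ⟨fun _ => z, rfl, fun h => absurd h hp⟩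
  choose u h0 hu' using hex
  have hu : ∀ p ∈ T, ∀ z, ∀ t ∈ Icc (0 : ℝ) 1,
        HasDerivWithinAt (u p z) (G ((p, t), u p z t)) (Icc 0 1) t := fun p hp z => hu' p z hp
  have hcu : ∀ p ∈ T, ∀ z, ContinuousOn (u p z) (Icc 0 1) :=
    fun p hp z t ht => (hu p hp z t ht).continuousWithinAt
  refine ⟨u, h0, hu, contDiffOn_infty.2 fun n => ?_⟩
  have hcont : ContinuousOn (fun q : (P × E) × ℝ => u q.1.1 q.1.2 q.2)
      ((T ×ˢ univ) ×ˢ Icc 0 1) := by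
    refine continuousOn_uncurry_of_uniform (B := fun (q : P × E) t => u q.1 q.2 t)
      (fun q hq => hcu q.1 hq.1 q.2) ?_
    rintro ⟨p, z⟩ ⟨hp, -⟩ ε hε
    obtain ⟨η, hη, hηε⟩ : ∃ η > 0, η * (2 * Real.exp (K + 1)) ≤ ε :=
      ⟨ε / (2 * Real.exp (K + 1)), by positivity, by field_simp; exact le_rfl⟩
    have hB : ContinuousOn (fun q : (P × E) × ℝ => G ((q.1.1, q.2), u p z q.2))
        ((T ×ˢ univ) ×ˢ Icc 0 1) :=
      hG.continuousOn.comp (f := fun q : (P × E) × ℝ => ((q.1.1, q.2), u p z q.2))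
        ((by fun_prop : ContinuousOn _ _).prodMk
          ((hcu p hp z).comp continuousOn_snd (fun q hq => hq.2)))
        (fun q hq => ⟨⟨hq.1.1, hq.2⟩, trivial⟩)
    have h1 := eventually_forall_Icc_norm_sub_lt
      (B := fun (q : P × E) t => G ((q.1, t), u p z t)) hB (p := (p, z)) ⟨hp, trivial⟩ hη
    have h2 : ∀ᶠ q in 𝓝[T ×ˢ univ] (p, z), ‖q.2 - z‖ < η := by
      refine mem_nhdsWithin_of_mem_nhds ?_
      have : ContinuousAt (fun q : P × E => ‖q.2 - z‖) (p, z) := by fun_prop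
      have h3 := this.tendsto
      simp only [sub_self, norm_zero] at h3
      exact h3.eventually (gt_mem_nhds hη)
    filter_upwards [h1, h2, self_mem_nhdsWithin] with q hq1 hq2 hqS t ht
    refine le_trans ?_ hηε
    refine norm_le_of_norm_deriv_le_add (u := fun t => u q.1 q.2 t - u p z t) (c := η) (K := K)
      K.2 hη.le (fun t ht => (hu q.1 hqS.1 q.2 t ht).sub (hu p hp z t ht))
      (by simp only [h0]; exact hq2.le) (fun t ht => ?_) t ht
    have e : G ((q.1, t), u q.1 q.2 t) - G ((p, t), u p z t)
        = (G ((q.1, t), u q.1 q.2 t) - G ((q.1, t), u p z t))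
          + (G ((q.1, t), u p z t) - G ((p, t), u p z t)) := by abel
    rw [e]
    exact (norm_add_le _ _).trans (add_le_add
      ((hK (q.1, t) ⟨hqS.1, ht⟩).norm_sub_le _ _) (hq1 t ht).le)
  -- the parameter is made part of the state, with zero velocity
  have key := contDiffOn_flow n (S := T ×ˢ (univ : Set E)) (hTc.prod convex_univ)
    (hTu.prod uniqueDiffOn_univ) (X := fun q => (0, G ((q.2.1, q.1), q.2.2)))
    (contDiffOn_const.prodMk ((hG.of_le (by exact_mod_cast le_top)).comp
      (f := fun q : ℝ × P × E => ((q.2.1, q.1), q.2.2)) (by fun_prop)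
      (fun q hq => ⟨⟨hq.2.1, hq.1⟩, trivial⟩)))
    (Φ := fun q t => (q.1, u q.1 q.2 t)) (fun q hq t ht => ⟨hq.1, trivial⟩)
    (fun q hq => by rw [h0])
    (fun q hq t ht => (hasDerivWithinAt_const t _ q.1).prodMk (hu q.1 hq.1 q.2 t ht))
    (continuousOn_fst.fst.prodMk hcont)
  exact contDiff_snd.comp_contDiffOn key

/-- The flow of a compactly supported field depending on time `s` and on a parameter `t`, together
with its inverse, both smooth up to the boundary of the parameter square. The inverse is obtained
by following, for unit time, the field run backwards from time `s`. -/
theorem exists_flow_and_inverse {E : Type*} [NormedAddCommGroup E] [NormedSpace ℝ E]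
    [FiniteDimensional ℝ E] {Z : (ℝ × ℝ) × E → E}
    (hZ : ContDiffOn ℝ ∞ Z ((Icc 0 1 ×ˢ Icc 0 1) ×ˢ univ)) {R : ℝ}
    (hR : ∀ p ∈ Icc (0 : ℝ) 1 ×ˢ Icc (0 : ℝ) 1, ∀ z, R ≤ ‖z‖ → Z (p, z) = 0) :
    ∃ Φ Ψ : (ℝ × ℝ) × E → E,
      ContDiffOn ℝ ∞ Φ ((Icc 0 1 ×ˢ Icc 0 1) ×ˢ univ) ∧
      ContDiffOn ℝ ∞ Ψ ((Icc 0 1 ×ˢ Icc 0 1) ×ˢ univ) ∧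
      (∀ t z, Φ ((0, t), z) = z) ∧
      (∀ t ∈ Icc (0 : ℝ) 1, ∀ z, ∀ s ∈ Icc (0 : ℝ) 1,
        HasDerivWithinAt (fun s => Φ ((s, t), z)) (Z ((s, t), Φ ((s, t), z))) (Icc 0 1) s) ∧
      (∀ s ∈ Icc (0 : ℝ) 1, ∀ t ∈ Icc (0 : ℝ) 1, ∀ z, Ψ ((s, t), Φ ((s, t), z)) = z) ∧
      (∀ s ∈ Icc (0 : ℝ) 1, ∀ t ∈ Icc (0 : ℝ) 1, ∀ z, Φ ((s, t), Ψ ((s, t), z)) = z) ∧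
      (∀ s ∈ Icc (0 : ℝ) 1, ∀ t ∈ Icc (0 : ℝ) 1, ∀ z, ∃ v : ℝ → E, v 0 = z ∧
        v 1 = Ψ ((s, t), z) ∧ ∀ τ ∈ Icc (0 : ℝ) 1,
          HasDerivWithinAt v (-s • Z ((s - s * τ, t), v τ)) (Icc 0 1) τ) := by
  have hI : UniqueDiffOn ℝ (Icc (0 : ℝ) 1) := uniqueDiffOn_Icc one_pos
  have hIc : Convex ℝ (Icc (0 : ℝ) 1) := convex_Icc 0 1
  have hsτ : ∀ s ∈ Icc (0 : ℝ) 1, ∀ τ ∈ Icc (0 : ℝ) 1, s * τ ∈ Icc (0 : ℝ) 1 :=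
    fun s hs τ hτ => unitInterval.mul_mem hs hτ
  have hsτ' : ∀ s ∈ Icc (0 : ℝ) 1, ∀ τ ∈ Icc (0 : ℝ) 1, s - s * τ ∈ Icc (0 : ℝ) 1 :=
    fun s hs τ hτ => ⟨by nlinarith [hs.1, hτ.2], by nlinarith [hs.1, hs.2, hτ.1]⟩
  obtain ⟨⟨K, hK⟩, -⟩ := exists_lipschitz_of_vanish (isCompact_Icc.prod isCompact_Icc)
    (hI.prod hI) hZ hR
  obtain ⟨u, u0, hu, huc⟩ := exists_smooth_flow (P := ℝ) isCompact_Icc hIc hI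
    (G := fun q => Z ((q.1.2, q.1.1), q.2))
    (hZ.comp (f := fun q : (ℝ × ℝ) × E => ((q.1.2, q.1.1), q.2)) (by fun_prop)
      (fun q hq => ⟨⟨hq.1.2, hq.1.1⟩, trivial⟩)) (R := R)
    (fun p hp z hz => hR (p.2, p.1) ⟨hp.2, hp.1⟩ z hz)
  obtain ⟨v, v0, hv, hvc⟩ := exists_smooth_flow (P := ℝ × ℝ) (T := Icc 0 1 ×ˢ Icc 0 1)
    (isCompact_Icc.prod isCompact_Icc) (hIc.prod hIc) (hI.prod hI)
    (G := fun q => -q.1.1.1 • Z ((q.1.1.1 - q.1.1.1 * q.1.2, q.1.1.2), q.2))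
    (ContDiffOn.smul (by fun_prop) (hZ.comp
      (f := fun q : ((ℝ × ℝ) × ℝ) × E => ((q.1.1.1 - q.1.1.1 * q.1.2, q.1.1.2), q.2))
      (by fun_prop) (fun q hq => ⟨⟨hsτ' _ hq.1.1.1 _ hq.1.2, hq.1.1.2⟩, trivial⟩))) (R := R)
    (fun p hp z hz => by
      change -p.1.1 • Z ((p.1.1 - p.1.1 * p.2, p.1.2), z) = 0
      rw [hR (p.1.1 - p.1.1 * p.2, p.1.2) ⟨hsτ' _ hp.1.1 _ hp.2, hp.1.2⟩ z hz, smul_zero])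
  have hmaps : ∀ s ∈ Icc (0 : ℝ) 1, MapsTo (fun τ => s * τ) (Icc 0 1) (Icc 0 1) :=
    fun s hs τ hτ => hsτ s hs τ hτ
  have hmaps' : ∀ s ∈ Icc (0 : ℝ) 1, MapsTo (fun τ => s - s * τ) (Icc 0 1) (Icc 0 1) :=
    fun s hs τ hτ => hsτ' s hs τ hτ
  refine ⟨fun q => u q.1.2 q.2 q.1.1, fun q => v q.1 q.2 1, ?_, ?_, fun t z => u0 t z,
    fun t ht z s hs => hu t ht z s hs, ?_, ?_, ?_⟩
  · exact huc.comp (f := fun q : (ℝ × ℝ) × E => ((q.1.2, q.2), q.1.1)) (by fun_prop)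
      (fun q hq => ⟨⟨hq.1.2, trivial⟩, hq.1.1⟩)
  · exact hvc.comp (f := fun q : (ℝ × ℝ) × E => ((q.1, q.2), 1)) (by fun_prop)
      (fun q hq => ⟨⟨hq.1, trivial⟩, by simp⟩)
  · intro s hs t ht z
    -- `τ ↦ u (s - s τ)` solves the backward equation
    have h1 := eqOn_of_lipschitz (X := fun τ w => -s • Z ((s - s * τ, t), w))
      (K := ‖-s‖₊ * K) (fun τ hτ => (lipschitzWith_smul (-s)).comp
        (hK (s - s * τ, t) ⟨hsτ' s hs τ hτ, ht⟩))
      (u := v (s, t) (u t z s)) (v := fun τ => u t z (s - s * τ))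
      (fun τ hτ => hv (s, t) ⟨hs, ht⟩ _ τ hτ)
      (fun τ hτ => by
        have h2 : HasDerivWithinAt (fun τ : ℝ => s - s * τ) (-s) (Icc 0 1) τ := by
          simpa using ((hasDerivAt_id τ).const_mul s).const_sub s |>.hasDerivWithinAt
        exact (hu t ht z _ (hsτ' s hs τ hτ)).scomp τ h2 (hmaps' s hs))
      (by simp [v0]) (by simp : (1 : ℝ) ∈ Icc (0 : ℝ) 1)
    simpa [u0] using h1
  · intro s hs t ht z
    -- `τ ↦ u (s τ)` and `τ ↦ v (1 - τ)` solve the same forward equation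
    have h1 := eqOn_of_lipschitz (X := fun τ w => s • Z ((s * τ, t), w))
      (K := ‖s‖₊ * K) (fun τ hτ => (lipschitzWith_smul s).comp
        (hK (s * τ, t) ⟨hsτ s hs τ hτ, ht⟩))
      (u := fun τ => u t (v (s, t) z 1) (s * τ)) (v := fun τ => v (s, t) z (1 - τ))
      (fun τ hτ => by
        have h2 : HasDerivWithinAt (fun τ : ℝ => s * τ) s (Icc 0 1) τ := by
          simpa using ((hasDerivAt_id τ).const_mul s).hasDerivWithinAt
        exact (hu t ht _ _ (hsτ s hs τ hτ)).scomp τ h2 (hmaps s hs))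
      (fun τ hτ => by
        have h2 : HasDerivWithinAt (fun τ : ℝ => 1 - τ) (-1) (Icc 0 1) τ := by
          simpa using (hasDerivAt_id τ).const_sub 1 |>.hasDerivWithinAt
        have hτ' : 1 - τ ∈ Icc (0 : ℝ) 1 := ⟨by linarith [hτ.2], by linarith [hτ.1]⟩
        have h3 := (hv (s, t) ⟨hs, ht⟩ z _ hτ').scomp τ h2
          (fun x hx => ⟨by linarith [hx.2], by linarith [hx.1]⟩)
        have e : s - s * (1 - τ) = s * τ := by ring
        simpa [e, Function.comp_def] using h3)
      (by simp [u0]) (by simp : (1 : ℝ) ∈ Icc (0 : ℝ) 1)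
    simpa [v0] using h1
  · intro s hs t ht z
    exact ⟨v (s, t) z, v0 _ _, rfl, fun τ hτ => hv (s, t) ⟨hs, ht⟩ z τ hτ⟩

end Flow

/-! ### Manifolds embedded in a vector space -/

section Embedded

variable {d : ℕ} {M : Type*} [TopologicalSpace M] [ChartedSpace (EuclideanSpace ℝ (Fin d)) M]
  {E : Type*} [NormedAddCommGroup E] [NormedSpace ℝ E]

variable (d) in
/-- The differential at `x` of a map from a manifold to a normed space. -/
def vd (f : M → E) (x : M) : TangentSpace (𝓡 d) x →L[ℝ] E := mfderiv (𝓡 d) 𝓘(ℝ, E) f x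

variable (d) in
/-- Smooth embeddings into a normed space. -/
structure IsEmb (ι : M → E) : Prop where
  smooth : ContMDiff (𝓡 d) 𝓘(ℝ, E) ∞ ι
  emb : IsEmbedding ι
  inj : ∀ x, Function.Injective (vd d ι x)

theorem vd_comp {F : Type*} [NormedAddCommGroup F] [NormedSpace ℝ F] {f : M → E} {g : E → F}
    {x : M} {g' : E →L[ℝ] F} (hg : HasFDerivAt g g' (f x))
    (hf : MDifferentiableAt (𝓡 d) 𝓘(ℝ, E) f x) :
    vd d (fun x => g (f x)) x = g'.comp (vd d f x) := by
  have h := (hg.hasMFDerivAt.comp x hf.hasMFDerivAt).mfderiv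
  exact h

theorem vd_congr {f g : M → E} {x : M} (h : f =ᶠ[𝓝 x] g) : vd d f x = vd d g x :=
  h.mfderiv_eq

theorem vd_eq_fderiv {f : M → E} (hf : ContMDiff (𝓡 d) 𝓘(ℝ, E) ∞ f) (p : M) :
    vd d f p = fderiv ℝ (fun y => f ((extChartAt (𝓡 d) p).symm y)) (extChartAt (𝓡 d) p p) := by
  have h : MDifferentiableAt (𝓡 d) 𝓘(ℝ, E) f p := hf.mdifferentiable (by simp) p
  rw [vd, h.mfderiv]
  simp only [writtenInExtChartAt, extChartAt_model_space_eq_id, PartialEquiv.refl_coe,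
    modelWithCornersSelf_coe, range_id, fderivWithin_univ]
  rfl

variable [IsManifold (𝓡 d) ∞ M]

theorem contDiffOn_comp_chart_symm {f : M → E} (hf : ContMDiff (𝓡 d) 𝓘(ℝ, E) ∞ f) (p : M) :
    ContDiffOn ℝ ∞ (fun y => f ((extChartAt (𝓡 d) p).symm y)) (extChartAt (𝓡 d) p).target := by
  rw [← contMDiffOn_iff_contDiffOn]
  exact hf.comp_contMDiffOn (contMDiffOn_extChartAt_symm p)

theorem vd_comp_chart_symm {f : M → E} (hf : ContMDiff (𝓡 d) 𝓘(ℝ, E) ∞ f) (p : M)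
    {y : EuclideanSpace ℝ (Fin d)} (hy : y ∈ (extChartAt (𝓡 d) p).target) :
    fderiv ℝ (fun y => f ((extChartAt (𝓡 d) p).symm y)) y
      = (vd d f ((extChartAt (𝓡 d) p).symm y)).comp
        (mfderiv 𝓘(ℝ, EuclideanSpace ℝ (Fin d)) (𝓡 d) (extChartAt (𝓡 d) p).symm y) := by
  have hs : MDifferentiableAt 𝓘(ℝ, EuclideanSpace ℝ (Fin d)) (𝓡 d)
      (extChartAt (𝓡 d) p).symm y :=
    ((contMDiffOn_extChartAt_symm (n := ∞) p).contMDiffAt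
      ((isOpen_extChartAt_target p).mem_nhds hy)).mdifferentiableAt (by simp)
  have := mfderiv_comp y (hf.mdifferentiable (by simp) _) hs
  rw [← mfderiv_eq_fderiv]
  exact this

/-- An embedding into a vector space has, near each point of its image, a smooth left inverse
(here composed with a chart): compose with a linear left inverse of the differential and apply
the inverse function theorem. -/
theorem IsEmb.exists_local_leftInverse [FiniteDimensional ℝ E] {ι : M → E}
    (h : IsEmb d ι) (p : M) :
    ∃ (U : Set E) (q : E → EuclideanSpace ℝ (Fin d)), IsOpen U ∧ ι p ∈ U ∧ ContDiffOn ℝ ∞ q U ∧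
      MapsTo q U (extChartAt (𝓡 d) p).target ∧
      ∀ x, ι x ∈ U → x ∈ (extChartAt (𝓡 d) p).source ∧ q (ι x) = extChartAt (𝓡 d) p x := by
  set φ := extChartAt (𝓡 d) p with hφ
  set f : EuclideanSpace ℝ (Fin d) → E := fun y => ι (φ.symm y) with hf
  have hfs : ContDiffOn ℝ ∞ f φ.target := contDiffOn_comp_chart_symm h.smooth p
  have htgt : IsOpen φ.target := isOpen_extChartAt_target p
  have hp : φ p ∈ φ.target := mem_extChartAt_target p
  have hinj : Function.Injective (fderiv ℝ f (φ p)) := by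
    rw [← vd_eq_fderiv h.smooth p]; exact h.inj p
  obtain ⟨L', hL'⟩ := LinearMap.exists_leftInverse_of_injective
    (fderiv ℝ f (φ p)).toLinearMap (LinearMap.ker_eq_bot.2 hinj)
  let L : E →L[ℝ] EuclideanSpace ℝ (Fin d) := LinearMap.toContinuousLinearMap L'
  have hL : L.comp (fderiv ℝ f (φ p)) = .id ℝ _ := by
    ext1 v; exact congrArg (fun l => l v) hL'
  set g : EuclideanSpace ℝ (Fin d) → EuclideanSpace ℝ (Fin d) := fun y => L (f y) with hg
  have hgs : ContDiffOn ℝ ∞ g φ.target := L.contDiff.comp_contDiffOn hfs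
  have hgA : ∀ y ∈ φ.target, ContDiffAt ℝ ∞ g y := fun y hy => hgs.contDiffAt (htgt.mem_nhds hy)
  have hgd : HasFDerivAt g ((ContinuousLinearEquiv.refl ℝ (EuclideanSpace ℝ (Fin d)) :
      EuclideanSpace ℝ (Fin d) →L[ℝ] EuclideanSpace ℝ (Fin d))) (φ p) := by
    have := L.hasFDerivAt.comp (φ p)
      ((hfs.contDiffAt (htgt.mem_nhds hp)).differentiableAt (by simp)).hasFDerivAt
    rw [hL] at this
    exact this
  let e := (hgA _ hp).toOpenPartialHomeomorph g hgd (by simp)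
  have hes : φ p ∈ e.source := (hgA _ hp).mem_toOpenPartialHomeomorph_source hgd (by simp)
  have heg : ∀ y, e y = g y := fun y => rfl
  -- points where the derivative of `g` is invertible
  obtain ⟨W, hW, hWo, hpW⟩ : ∃ W : Set (EuclideanSpace ℝ (Fin d)),
      (∀ y ∈ W, y ∈ φ.target ∧ y ∈ e.source ∧ fderiv ℝ g y ∈
        range ((↑) : (EuclideanSpace ℝ (Fin d) ≃L[ℝ] EuclideanSpace ℝ (Fin d)) → _)) ∧
      IsOpen W ∧ φ p ∈ W := by
    have hc : ContinuousAt (fderiv ℝ g) (φ p) :=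
      ((hgA _ hp).fderiv_right (m := 0) (by simp)).continuousAt
    have h1 : ∀ᶠ y in 𝓝 (φ p), fderiv ℝ g y ∈
        range ((↑) : (EuclideanSpace ℝ (Fin d) ≃L[ℝ] EuclideanSpace ℝ (Fin d)) → _) := by
      refine hc ?_
      rw [hgd.fderiv]
      exact ContinuousLinearEquiv.nhds _
    exact eventually_nhds_iff.1 ((htgt.eventually_mem hp).and
      ((e.open_source.eventually_mem hes).and h1))
  have hWs : W ⊆ e.source := fun y hy => (hW y hy).2.1
  obtain ⟨O, hO, hOeq⟩ : ∃ O : Set E, IsOpen O ∧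
      ι ⁻¹' O = φ.source ∩ φ ⁻¹' W := by
    have : IsOpen (φ.source ∩ φ ⁻¹' W) :=
      (continuousOn_extChartAt p).isOpen_inter_preimage (isOpen_extChartAt_source p) hWo
    exact h.emb.isInducing.isOpen_iff.1 this
  have hOx : ∀ x, ι x ∈ O → x ∈ φ.source ∧ φ x ∈ W := fun x hx => by
    have : x ∈ φ.source ∩ φ ⁻¹' W := by rw [← hOeq]; exact hx
    exact this
  have hLx : ∀ x ∈ φ.source, L (ι x) = e (φ x) := fun x hx => by
    rw [heg, hg, hf]; simp only [φ.left_inv hx]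
  refine ⟨O ∩ L ⁻¹' (e '' W), fun z => e.symm (L z),
    hO.inter ((e.isOpen_image_of_subset_source hWo hWs).preimage L.continuous), ⟨?_, ?_⟩,
    ?_, ?_, ?_⟩
  · have : p ∈ ι ⁻¹' O := by rw [hOeq]; exact ⟨mem_extChartAt_source p, hpW⟩
    exact this
  · exact ⟨φ p, hpW, (hLx p (mem_extChartAt_source p)).symm⟩
  · rintro z ⟨-, y, hy, hyz⟩
    obtain ⟨g', hg'⟩ := (hW y hy).2.2
    have h2 : e.symm (L z) = y := by rw [← hyz, e.left_inv (hWs hy)]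
    have h1 : ContDiffAt ℝ ∞ e.symm (L z) := by
      refine e.contDiffAt_symm (f₀' := g') (by rw [← hyz]; exact e.map_source (hWs hy)) ?_ ?_
      · rw [h2, hg']
        exact ((hgA y (hW y hy).1).differentiableAt (by simp)).hasFDerivAt
      · rw [h2]; exact hgA y (hW y hy).1
    exact (h1.comp z L.contDiff.contDiffAt).contDiffWithinAt
  · rintro z ⟨-, y, hy, hyz⟩
    change e.symm (L z) ∈ φ.target
    rw [← hyz, e.left_inv (hWs hy)]
    exact (hW y hy).1
  · rintro x ⟨hx, -⟩
    obtain ⟨hx1, hx2⟩ := hOx x hx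
    refine ⟨hx1, ?_⟩
    change e.symm (L (ι x)) = φ x
    rw [hLx x hx1, e.left_inv (hWs hx2)]

/-- A map into an embedded manifold is smooth if it is smooth as a map to the ambient space. -/
theorem IsEmb.contMDiff_of_comp [FiniteDimensional ℝ E] {ι : M → E} (h : IsEmb d ι)
    {E' H' T : Type*} [NormedAddCommGroup E'] [NormedSpace ℝ E'] [TopologicalSpace H']
    {J : ModelWithCorners ℝ E' H'} [TopologicalSpace T] [ChartedSpace H' T] {g : T → M}
    (hg : ContMDiff J 𝓘(ℝ, E) ∞ (fun t => ι (g t))) : ContMDiff J (𝓡 d) ∞ g := by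
  intro t
  obtain ⟨U, q, hU, hpU, hq, hmaps, hinv⟩ := h.exists_local_leftInverse (g t)
  have h1 : ContMDiffAt J 𝓘(ℝ, EuclideanSpace ℝ (Fin d)) ∞ (fun s => q (ι (g s))) t :=
    ((hq.contDiffAt (hU.mem_nhds hpU)).contMDiffAt).comp t (hg t)
  have h2 : ContMDiffAt J (𝓡 d) ∞ (fun s => (extChartAt (𝓡 d) (g t)).symm (q (ι (g s)))) t := by
    refine ContMDiffAt.comp t (g := (extChartAt (𝓡 d) (g t)).symm) ?_ h1
    exact (contMDiffOn_extChartAt_symm (g t)).contMDiffAt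
      ((isOpen_extChartAt_target (g t)).mem_nhds (hmaps hpU))
  refine h2.congr_of_eventuallyEq ?_
  filter_upwards [hg.continuous.continuousAt.eventually (hU.mem_nhds hpU)] with s hs
  obtain ⟨h3, h4⟩ := hinv (g s) hs
  rw [h4, (extChartAt (𝓡 d) (g t)).left_inv h3]

/-- Near each point of an embedded manifold there is a smooth local retraction onto it. -/
theorem IsEmb.exists_local_retraction [FiniteDimensional ℝ E] {ι : M → E}
    (h : IsEmb d ι) (p : M) :
    ∃ (U : Set E) (π : E → E), IsOpen U ∧ ι p ∈ U ∧ ContDiffOn ℝ ∞ π U ∧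
      (∀ z ∈ U, π z ∈ range ι) ∧ (∀ x, ι x ∈ U → π (ι x) = ι x) ∧
      (∀ x, ι x ∈ U → ∀ v, fderiv ℝ π (ι x) (vd d ι x v) = vd d ι x v) := by
  obtain ⟨U, q, hU, hpU, hq, hmaps, hinv⟩ := h.exists_local_leftInverse p
  set φ := extChartAt (𝓡 d) p with hφ
  have hf := contDiffOn_comp_chart_symm h.smooth p
  have hπ : ContDiffOn ℝ ∞ (fun z => ι (φ.symm (q z))) U := hf.comp hq hmaps
  have hfix : ∀ x, ι x ∈ U → ι (φ.symm (q (ι x))) = ι x := fun x hx => by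
    rw [(hinv x hx).2, φ.left_inv (hinv x hx).1]
  refine ⟨U, fun z => ι (φ.symm (q z)), hU, hpU, hπ, fun z _ => ⟨_, rfl⟩, hfix, ?_⟩
  intro x hx v
  have h1 := ((hπ.contDiffAt (hU.mem_nhds hx)).differentiableAt (by simp)).hasFDerivAt
  have h2 := vd_comp h1 (h.smooth.mdifferentiable (by simp) x)
  have h3 : (fun x => ι (φ.symm (q (ι x)))) =ᶠ[𝓝 x] ι := by
    filter_upwards [h.smooth.continuous.continuousAt.eventually (hU.mem_nhds hx)] with y hy
      using hfix y hy
  rw [vd_congr h3] at h2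
  exact (congrArg (fun l => l v) h2).symm

/-- A solution of an ODE in the ambient space which starts on a compact embedded manifold to which
the field is tangent stays on the manifold: near the manifold, the difference between the solution
and its retraction satisfies a linear differential inequality. -/
theorem IsEmb.invariant [FiniteDimensional ℝ E] [CompactSpace M] {ι : M → E}
    (h : IsEmb d ι) {X : ℝ → E → E} {K L : NNReal}
    (hK : ∀ t ∈ Icc (0 : ℝ) 1, LipschitzWith K (X t))
    (hL : ∀ t ∈ Icc (0 : ℝ) 1, ∀ z, ‖X t z‖ ≤ L)
    (hX : ∀ t ∈ Icc (0 : ℝ) 1, ∀ x, X t (ι x) ∈ range (vd d ι x)) {u : ℝ → E}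
    (hu : ∀ t ∈ Icc (0 : ℝ) 1, HasDerivWithinAt u (X t (u t)) (Icc 0 1) t)
    (h0 : u 0 ∈ range ι) : ∀ t ∈ Icc (0 : ℝ) 1, u t ∈ range ι := by
  have huc : ContinuousOn u (Icc 0 1) := fun t ht => (hu t ht).continuousWithinAt
  have hclosed : IsClosed (range ι) := (isCompact_range h.smooth.continuous).isClosed
  refine IsClosed.Icc_subset_of_forall_exists_gt (s := {t | u t ∈ range ι}) ?_ h0 ?_
  · rw [inter_comm]
    exact huc.preimage_isClosed_of_isClosed isClosed_Icc hclosed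
  -- the set of times in `range ι` is closed; it is shown to be open to the right
  rintro t₀ ⟨⟨p, hp⟩, ht₀⟩ y hy
  obtain ⟨U, π, hU, hpU, hπ, hran, hfix, htan⟩ := h.exists_local_retraction p
  have hDπ : ContDiffAt ℝ 1 (fderiv ℝ π) (ι p) :=
    (hπ.contDiffAt (hU.mem_nhds hpU)).fderiv_right (m := 1)
      (by rw [one_add_one_eq_two]; exact ENat.LEInfty.out)
  obtain ⟨K₁, N₁, hN₁, hlip⟩ := hDπ.exists_lipschitzOnWith
  obtain ⟨C, hC⟩ : ∃ C : ℝ, ∀ᶠ z in 𝓝 (ι p), ‖fderiv ℝ π z‖ ≤ C :=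
    ⟨‖fderiv ℝ π (ι p)‖ + 1, (hDπ.continuousAt.norm.eventually
      (gt_mem_nhds (lt_add_one _))).mono fun z hz => hz.le⟩
  have hπp : π (ι p) = ι p := hfix p hpU
  have hπc : ContinuousAt π (ι p) := (hπ.contDiffAt (hU.mem_nhds hpU)).continuousAt
  have hgood : ∀ᶠ z in 𝓝 (ι p), z ∈ U ∧ z ∈ N₁ ∧ ‖fderiv ℝ π z‖ ≤ C :=
    (hU.eventually_mem hpU).and (Filter.Eventually.and hN₁ hC)
  have hgood' : ∀ᶠ z in 𝓝 (ι p), π z ∈ U ∧ π z ∈ N₁ ∧ ‖fderiv ℝ π (π z)‖ ≤ C := by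
    have := hπc.tendsto
    rw [hπp] at this
    exact this.eventually hgood
  have hev : ∀ᶠ t in 𝓝[Icc 0 1] t₀, (u t ∈ U ∧ u t ∈ N₁ ∧ ‖fderiv ℝ π (u t)‖ ≤ C) ∧
      (π (u t) ∈ U ∧ π (u t) ∈ N₁ ∧ ‖fderiv ℝ π (π (u t))‖ ≤ C) := by
    have := huc t₀ (Ico_subset_Icc_self ht₀)
    rw [ContinuousWithinAt, ← hp] at this
    exact this.eventually (hgood.and hgood')
  have hev2 : ∀ᶠ t in 𝓝[≥] t₀, (u t ∈ U ∧ u t ∈ N₁ ∧ ‖fderiv ℝ π (u t)‖ ≤ C) ∧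
      (π (u t) ∈ U ∧ π (u t) ∈ N₁ ∧ ‖fderiv ℝ π (π (u t))‖ ≤ C) :=
    nhdsWithin_le_of_mem (Icc_mem_nhdsGE_of_mem ht₀) hev
  obtain ⟨t₂, ht₂, hsub⟩ := mem_nhdsGE_iff_exists_Icc_subset.1 hev2
  set t₁ := min t₂ (min y 1) with ht₁
  have ht₁0 : t₀ < t₁ := lt_min ht₂ (lt_min hy ht₀.2)
  have ht₁1 : t₁ ≤ 1 := (min_le_right _ _).trans (min_le_right _ _)
  have hin : ∀ t ∈ Icc t₀ t₁, t ∈ Icc (0 : ℝ) 1 := fun t ht => ⟨ht₀.1.trans ht.1, ht.2.trans ht₁1⟩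
  have hin2 : ∀ t ∈ Icc t₀ t₁, (u t ∈ U ∧ u t ∈ N₁ ∧ ‖fderiv ℝ π (u t)‖ ≤ C) ∧
      (π (u t) ∈ U ∧ π (u t) ∈ N₁ ∧ ‖fderiv ℝ π (π (u t))‖ ≤ C) :=
    fun t ht => hsub ⟨ht.1, ht.2.trans (min_le_left _ _)⟩
  have hder : ∀ t ∈ Icc t₀ t₁, HasDerivWithinAt (fun t => u t - π (u t))
      (X t (u t) - fderiv ℝ π (u t) (X t (u t))) (Icc 0 1) t := by
    intro t ht
    have h1 := ((hπ.contDiffAt (hU.mem_nhds (hin2 t ht).1.1)).differentiableAt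
      (by simp)).hasFDerivAt
    exact (hu t (hin t ht)).sub (h1.comp_hasDerivWithinAt t (hu t (hin t ht)))
  have hzero := eq_zero_of_abs_deriv_le_mul_abs_self_of_eq_zero_right
    (f := fun t => u t - π (u t)) (K := K + (K₁ * L + C * K)) (a := t₀) (b := t₁)
    (fun t ht => ((hder t ht).continuousWithinAt).mono (fun s hs => hin s hs))
    (fun t ht => hasDerivWithinAt_Ici_of_Icc (a := 0) (b := 1)
      ⟨ht₀.1.trans ht.1, ht.2.trans_le ht₁1⟩ (hder t (Ico_subset_Icc_self ht)))
    (by simp only [← hp, hπp, sub_self]) (fun t ht' => by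
      have ht := Ico_subset_Icc_self ht'
      obtain ⟨⟨hz1, hz2, hz3⟩, hz1', hz2', hz3'⟩ := hin2 t ht
      obtain ⟨x, hx⟩ := hran _ hz1
      -- the field is tangent at the retracted point, so the right-hand side vanishes there
      have hQ : X t (π (u t)) - fderiv ℝ π (π (u t)) (X t (π (u t))) = 0 := by
        obtain ⟨v, hv⟩ := hX t (hin t ht) x
        rw [← hx, ← hv, htan x (by rw [hx]; exact hz1'), sub_self]
      have e : X t (u t) - fderiv ℝ π (u t) (X t (u t))
          = (X t (u t) - X t (π (u t))) - ((fderiv ℝ π (u t) - fderiv ℝ π (π (u t))) (X t (u t))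
            + fderiv ℝ π (π (u t)) (X t (u t) - X t (π (u t)))) := by
        rw [← sub_zero (X t (u t) - fderiv ℝ π (u t) (X t (u t))), ← hQ]
        simp only [map_sub, sub_apply]
        abel
      have b1 := (hK t (hin t ht)).norm_sub_le (u t) (π (u t))
      have b2 := hlip.norm_sub_le hz2 hz2'
      rw [e]
      have b3 : ‖(fderiv ℝ π (u t) - fderiv ℝ π (π (u t))) (X t (u t))‖
          ≤ K₁ * ‖u t - π (u t)‖ * L :=
        (ContinuousLinearMap.le_opNorm _ _).trans
          (mul_le_mul b2 (hL t (hin t ht) _) (norm_nonneg _) (by positivity))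
      have b4 : ‖fderiv ℝ π (π (u t)) (X t (u t) - X t (π (u t)))‖
          ≤ C * (K * ‖u t - π (u t)‖) :=
        (ContinuousLinearMap.le_opNorm _ _).trans
          (mul_le_mul hz3' b1 (norm_nonneg _) ((norm_nonneg _).trans hz3'))
      calc _ ≤ K * ‖u t - π (u t)‖ + (K₁ * ‖u t - π (u t)‖ * L + C * (K * ‖u t - π (u t)‖)) :=
            (norm_sub_le _ _).trans (add_le_add b1 ((norm_add_le _ _).trans (add_le_add b3 b4)))
        _ = _ := by ring)
    t₁ ⟨ht₁0.le, le_rfl⟩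
  refine ⟨t₁, ?_, ht₁0, (min_le_right _ _).trans (min_le_left _ _)⟩
  change u t₁ ∈ range ι
  rw [sub_eq_zero.1 hzero]
  exact hran _ (hin2 t₁ ⟨ht₁0.le, le_rfl⟩).1.1

end Embedded

/-! ### Extension of functions to the ambient space -/

section Ext

variable {d : ℕ} {M : Type*} [TopologicalSpace M] [ChartedSpace (EuclideanSpace ℝ (Fin d)) M]
  {E : Type*} [NormedAddCommGroup E] [NormedSpace ℝ E]

/-- Finitely many local left inverses (in charts) of an embedding `ι`, defined on open sets `U p`
of the ambient space, and bump functions `χ p` subordinate to the sets `U p` whose sum is one on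
the image of `ι`. -/
structure RetractData (d : ℕ) {M : Type*} [TopologicalSpace M]
    [ChartedSpace (EuclideanSpace ℝ (Fin d)) M]
    {E : Type*} [NormedAddCommGroup E] [NormedSpace ℝ E] (ι : M → E) where
  s : Finset M
  U : M → Set E
  q : M → E → EuclideanSpace ℝ (Fin d)
  χ : s → E → ℝ
  isOpen : ∀ p, IsOpen (U p)
  smooth_q : ∀ p, ContDiffOn ℝ ∞ (q p) (U p)
  mapsTo : ∀ p, MapsTo (q p) (U p) (extChartAt (𝓡 d) p).target
  leftInv : ∀ p x, ι x ∈ U p → x ∈ (extChartAt (𝓡 d) p).source ∧ q p (ι x) = extChartAt (𝓡 d) p x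
  smooth_χ : ∀ p, ContDiff ℝ ∞ (χ p)
  compact_χ : ∀ p, HasCompactSupport (χ p)
  supp_χ : ∀ p, tsupport (χ p) ⊆ U p
  nonneg_χ : ∀ p z, 0 ≤ χ p z
  sum_le : ∀ z, ∑ p, χ p z ≤ 1
  sum_eq : ∀ x, ∑ p, χ p (ι x) = 1

theorem IsEmb.nonempty_retractData [IsManifold (𝓡 d) ∞ M] [FiniteDimensional ℝ E] [CompactSpace M]
    {ι : M → E} (h : IsEmb d ι) : Nonempty (RetractData d ι) := by
  choose U q hU hpU hq hmaps hinv using h.exists_local_leftInverse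
  have hcover : range ι ⊆ ⋃ p, (U p ∩ Metric.ball (ι p) 1) := by
    rintro _ ⟨p, rfl⟩
    exact mem_iUnion.2 ⟨p, hpU p, Metric.mem_ball_self one_pos⟩
  obtain ⟨s, hs⟩ := (isCompact_range h.smooth.continuous).elim_finite_subcover
    (fun p => U p ∩ Metric.ball (ι p) 1) (fun p => (hU p).inter Metric.isOpen_ball) hcover
  obtain ⟨f, hf⟩ := SmoothPartitionOfUnity.exists_isSubordinate 𝓘(ℝ, E)
    (isCompact_range h.smooth.continuous).isClosed
    (fun p : s => U p ∩ Metric.ball (ι p) 1) (fun p => (hU p).inter Metric.isOpen_ball)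
    (fun z hz => by
      obtain ⟨p, hp⟩ := mem_iUnion.1 (hs hz)
      obtain ⟨hp1, hp2⟩ := mem_iUnion.1 hp
      exact mem_iUnion.2 ⟨⟨p, hp1⟩, hp2⟩)
  exact ⟨{
    s := s
    U := U
    q := q
    χ := fun p => f p
    isOpen := hU
    smooth_q := hq
    mapsTo := hmaps
    leftInv := hinv
    smooth_χ := fun p => (f p).contMDiff.contDiff
    compact_χ := fun p => HasCompactSupport.of_support_subset_isCompact
      (isCompact_closedBall (ι p) 1) ((subset_tsupport _).trans ((hf p).trans
        (inter_subset_right.trans Metric.ball_subset_closedBall)))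
    supp_χ := fun p => (hf p).trans inter_subset_left
    nonneg_χ := fun p z => f.nonneg p z
    sum_le := fun z => by rw [← finsum_eq_sum_of_fintype]; exact f.sum_le_one z
    sum_eq := fun x => by rw [← finsum_eq_sum_of_fintype]; exact f.sum_eq_one ⟨x, rfl⟩ }⟩

namespace RetractData

variable {ι : M → E} (D : RetractData d ι)

/-- The local left inverse of `ι` on `D.U p`. -/
def r (p : M) (z : E) : M := (extChartAt (𝓡 d) p).symm (D.q p z)

theorem r_apply {p x : M} (hx : ι x ∈ D.U p) : D.r p (ι x) = x := by
  obtain ⟨h1, h2⟩ := D.leftInv p x hx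
  rw [r, h2, (extChartAt (𝓡 d) p).left_inv h1]

theorem contMDiffOn_r [IsManifold (𝓡 d) ∞ M] (p : M) :
    ContMDiffOn 𝓘(ℝ, E) (𝓡 d) ∞ (D.r p) (D.U p) :=
  (contMDiffOn_extChartAt_symm p).comp (D.smooth_q p).contMDiffOn (D.mapsTo p)

theorem mem_U_of_ne {p : D.s} {z : E} (h : D.χ p z ≠ 0) : z ∈ D.U p :=
  D.supp_χ p (subset_tsupport _ h)

variable {F : Type*} [NormedAddCommGroup F] [NormedSpace ℝ F]

/-- The extension to the ambient space of a function on an embedded manifold: the average of its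
pullbacks by the local left inverses. It is linear and positive, and does not increase bounds. -/
def ext (f : M → F) (z : E) : F := ∑ p : D.s, D.χ p z • f (D.r p z)

theorem ext_apply (f : M → F) (x : M) : D.ext f (ι x) = f x := by
  have : ∀ p : D.s, D.χ p (ι x) • f (D.r p (ι x)) = D.χ p (ι x) • f x := fun p => by
    by_cases h : D.χ p (ι x) = 0
    · rw [h, zero_smul, zero_smul]
    · rw [D.r_apply (D.mem_U_of_ne h)]
  rw [ext, Finset.sum_congr rfl fun p _ => this p, ← Finset.sum_smul, D.sum_eq, one_smul]

theorem ext_nonneg {f : M → ℝ} (hf : ∀ x, 0 ≤ f x) (z : E) : 0 ≤ D.ext f z :=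
  Finset.sum_nonneg fun p _ => mul_nonneg (D.nonneg_χ p z) (hf _)

theorem abs_ext_le {f : M → ℝ} {c : ℝ} (hc : 0 ≤ c) (hf : ∀ x, |f x| ≤ c) (z : E) :
    |D.ext f z| ≤ c := by
  calc |D.ext f z| ≤ ∑ p : D.s, |D.χ p z • f (D.r p z)| := Finset.abs_sum_le_sum_abs _ _
    _ ≤ ∑ p : D.s, D.χ p z * c := Finset.sum_le_sum fun p _ => by
        rw [smul_eq_mul, abs_mul, abs_of_nonneg (D.nonneg_χ p z)]
        exact mul_le_mul_of_nonneg_left (hf _) (D.nonneg_χ p z)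
    _ = (∑ p : D.s, D.χ p z) * c := (Finset.sum_mul _ _ _).symm
    _ ≤ c := mul_le_of_le_one_left hc (D.sum_le z)

theorem ext_sub (f g : M → F) (z : E) :
    D.ext (fun x => f x - g x) z = D.ext f z - D.ext g z := by
  simp [ext, smul_sub, Finset.sum_sub_distrib]

theorem exists_ext_eq_zero : ∃ R : ℝ, ∀ (f : M → F) (z : E), R ≤ ‖z‖ → D.ext f z = 0 := by
  have hK : IsCompact (⋃ p : D.s, tsupport (D.χ p)) := isCompact_iUnion fun p => D.compact_χ p
  obtain ⟨R, hR⟩ := hK.isBounded.exists_norm_le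
  refine ⟨R + 1, fun f z hz => Finset.sum_eq_zero fun p _ => ?_⟩
  have : D.χ p z = 0 := by
    by_contra h
    have := hR z (mem_iUnion.2 ⟨p, subset_tsupport _ h⟩)
    linarith
  rw [this, zero_smul]

variable [IsManifold (𝓡 d) ∞ M]

theorem contMDiff_ext {E' H' T : Type*} [NormedAddCommGroup E'] [NormedSpace ℝ E']
    [TopologicalSpace H'] {J : ModelWithCorners ℝ E' H'} [TopologicalSpace T] [ChartedSpace H' T]
    {f : T → M → F} (hf : ContMDiff (J.prod (𝓡 d)) 𝓘(ℝ, F) ∞ (fun q : T × M => f q.1 q.2)) :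
    ContMDiff (J.prod 𝓘(ℝ, E)) 𝓘(ℝ, F) ∞ (fun q : T × E => D.ext (f q.1) q.2) := by
  refine ContMDiff.sum fun p _ => ?_
  rintro ⟨t, z⟩
  by_cases hz : z ∈ tsupport (D.χ p)
  · have hzU := D.supp_χ p hz
    have h1 : ContMDiffAt (J.prod 𝓘(ℝ, E)) (J.prod (𝓡 d)) ∞
        (fun q : T × E => (q.1, D.r p q.2)) (t, z) :=
      contMDiffAt_fst.prodMk
        (ContMDiffAt.comp (g := D.r p) (t, z)
          ((D.contMDiffOn_r p).contMDiffAt ((D.isOpen p).mem_nhds hzU)) contMDiffAt_snd)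
    have h2 : ContMDiffAt (J.prod 𝓘(ℝ, E)) 𝓘(ℝ, F) ∞
        (fun q : T × E => f q.1 (D.r p q.2)) (t, z) :=
      (hf (t, D.r p z)).comp (t, z) h1
    have h3 : ContMDiffAt (J.prod 𝓘(ℝ, E)) 𝓘(ℝ, ℝ) ∞ (fun q : T × E => D.χ p q.2) (t, z) :=
      ((D.smooth_χ p).contMDiff z).comp (t, z) contMDiffAt_snd
    exact h3.smul h2
  · have : (fun q : T × E => D.χ p q.2 • f q.1 (D.r p q.2)) =ᶠ[𝓝 (t, z)] fun _ => 0 := by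
      have h1 : ∀ᶠ y in 𝓝 z, D.χ p y = 0 := by
        filter_upwards [(isClosed_tsupport (D.χ p)).isOpen_compl.mem_nhds hz] with y hy
        exact image_eq_zero_of_notMem_tsupport hy
      filter_upwards [(continuous_snd.tendsto (t, z)).eventually h1] with q hq
      rw [hq, zero_smul]
    exact contMDiffAt_const.congr_of_eventuallyEq this

theorem contDiffOn_ext {E' H' T : Type*} [NormedAddCommGroup E'] [NormedSpace ℝ E']
    [TopologicalSpace H'] {J : ModelWithCorners ℝ E' H'} [TopologicalSpace T] [ChartedSpace H' T]
    {f : T → M → F} (hf : ContMDiff (J.prod (𝓡 d)) 𝓘(ℝ, F) ∞ (fun q : T × M => f q.1 q.2))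
    {P : Type*} [NormedAddCommGroup P] [NormedSpace ℝ P] {pr : P → T} {S : Set P}
    (hpr : ContMDiffOn 𝓘(ℝ, P) J ∞ pr S) :
    ContDiffOn ℝ ∞ (fun q : P × E => D.ext (f (pr q.1)) q.2) (S ×ˢ univ) := by
  have h : ContMDiffOn (𝓘(ℝ, P).prod 𝓘(ℝ, E)) (J.prod 𝓘(ℝ, E)) ∞
      (fun q : P × E => (pr q.1, q.2)) (S ×ˢ univ) :=
    (hpr.comp contMDiffOn_fst (fun q hq => hq.1)).prodMk contMDiffOn_snd
  have h2 := (D.contMDiff_ext hf).comp_contMDiffOn h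
  rw [← modelWithCornersSelf_prod, chartedSpaceSelf_prod] at h2
  exact h2.contDiffOn

end RetractData

end Ext

section Interval

/-- The projection of the real line onto the unit interval. -/
def pI (t : ℝ) : I := projIcc 0 1 zero_le_one t

theorem pI_coe (t : I) : pI t = t := projIcc_val _ t

theorem pI_of_mem {t : ℝ} (ht : t ∈ Icc (0 : ℝ) 1) : pI t = ⟨t, ht⟩ := projIcc_of_mem _ ht

theorem coe_pI {t : ℝ} (ht : t ∈ Icc (0 : ℝ) 1) : (pI t : ℝ) = t := by rw [pI_of_mem ht]

theorem pI_zero : pI 0 = 0 := pI_of_mem (by simp)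

theorem contMDiffOn_pI : ContMDiffOn 𝓘(ℝ, ℝ) (𝓡∂ 1) ∞ pI (Icc 0 1) := contMDiffOn_projIcc

/-- The projection of the plane onto the unit square. -/
def pI2 (p : ℝ × ℝ) : I × I := (pI p.1, pI p.2)

theorem contMDiffOn_pI2 :
    ContMDiffOn 𝓘(ℝ, ℝ × ℝ) ((𝓡∂ 1).prod (𝓡∂ 1)) ∞ pI2 (Icc 0 1 ×ˢ Icc 0 1) := by
  rw [modelWithCornersSelf_prod, ← chartedSpaceSelf_prod]
  exact (contMDiffOn_pI.comp contMDiffOn_fst (fun q hq => hq.1)).prodMk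
    (contMDiffOn_pI.comp contMDiffOn_snd (fun q hq => hq.2))

theorem contMDiff_coe_I : ContMDiff (𝓡∂ 1) 𝓘(ℝ, ℝ) ∞ (fun t : I => (t : ℝ)) :=
  contMDiff_subtypeVal_Icc

end Interval

/-! ### One-forms on embedded manifolds -/

section Forms

variable {d : ℕ} {M : Type*} [TopologicalSpace M] [ChartedSpace (EuclideanSpace ℝ (Fin d)) M]

theorem form_congr {α : ∀ x : M, TangentSpace (𝓡 d) x →L[ℝ] ℝ} {x y : M} (h : x = y)
    (v : EuclideanSpace ℝ (Fin d)) : α x v = α y v := by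
  subst h; rfl

variable [IsManifold (𝓡 d) ∞ M]
  {E : Type*} [NormedAddCommGroup E] [NormedSpace ℝ E]

theorem contDiffOn_localRep {α : ∀ x : M, TangentSpace (𝓡 d) x →L[ℝ] ℝ}
    (hα : ContMDiff (𝓡 d) ((𝓡 d).prod 𝓘(ℝ, EuclideanSpace ℝ (Fin d) →L[ℝ] ℝ)) ∞
      (fun x => Bundle.TotalSpace.mk' (EuclideanSpace ℝ (Fin d) →L[ℝ] ℝ) x (α x))) (p : M) :
    ContDiffOn ℝ ∞ (localRep α p) (extChartAt (𝓡 d) p).target := by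
  rw [contDiffOn_clm_apply]
  intro v
  set φ := extChartAt (𝓡 d) p
  have hφ : ContMDiffOn 𝓘(ℝ, EuclideanSpace ℝ (Fin d)) (𝓡 d) ∞ φ.symm φ.target :=
    contMDiffOn_extChartAt_symm p
  have hopen : IsOpen φ.target := isOpen_extChartAt_target p
  have h1 := hα.comp_contMDiffOn hφ
  have h2 : ContMDiffOn 𝓘(ℝ, EuclideanSpace ℝ (Fin d)) (𝓡 d).tangent ∞
      (fun y => Bundle.TotalSpace.mk' (EuclideanSpace ℝ (Fin d)) (E := TangentSpace (𝓡 d))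
        (φ.symm y) (mfderiv 𝓘(ℝ, EuclideanSpace ℝ (Fin d)) (𝓡 d) φ.symm y v)) φ.target := by
    have h3 := hφ.contMDiffOn_tangentMapWithin (m := ∞) (by simp) hopen.uniqueMDiffOn
    have h4 : ContMDiffOn 𝓘(ℝ, EuclideanSpace ℝ (Fin d))
        𝓘(ℝ, EuclideanSpace ℝ (Fin d)).tangent ∞
        (fun y => (⟨y, v⟩ : TangentBundle 𝓘(ℝ, EuclideanSpace ℝ (Fin d))
          (EuclideanSpace ℝ (Fin d)))) φ.target := by
      intro y hy
      rw [Bundle.contMDiffWithinAt_totalSpace]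
      refine ⟨contMDiffWithinAt_id, ?_⟩
      simp only [trivializationAt_model_space_apply]
      exact contMDiffWithinAt_const
    refine (h3.comp h4 (fun y hy => hy)).congr fun y hy => ?_
    simp only [Function.comp_apply, tangentMapWithin]
    rw [mfderivWithin_of_isOpen hopen hy]
  have h5 := ContMDiffOn.clm_bundle_apply (F₂ := ℝ) (E₂ := Bundle.Trivial M ℝ) h1 h2
  intro y hy
  have h6 := (Bundle.contMDiffWithinAt_totalSpace.1 (h5 y hy)).2
  exact h6.contDiffWithinAt

/-- The exterior derivative of a one-form on a vector space. -/
def dForm (A : E → E →L[ℝ] ℝ) (z a b : E) : ℝ := fderiv ℝ A z a b - fderiv ℝ A z b a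

theorem mfderiv_chart_symm_comp {p x : M} (hx : x ∈ (extChartAt (𝓡 d) p).source) :
    (mfderiv 𝓘(ℝ, EuclideanSpace ℝ (Fin d)) (𝓡 d) (extChartAt (𝓡 d) p).symm
      (extChartAt (𝓡 d) p x)).comp (vd d (extChartAt (𝓡 d) p) x) = .id ℝ _ := by
  set φ := extChartAt (𝓡 d) p
  have h1 : MDifferentiableAt (𝓡 d) 𝓘(ℝ, EuclideanSpace ℝ (Fin d)) φ x :=
    (contMDiffAt_extChartAt' (n := ∞) (by rwa [← extChartAt_source (𝓡 d)])).mdifferentiableAt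
      (by simp)
  have h2 : MDifferentiableAt 𝓘(ℝ, EuclideanSpace ℝ (Fin d)) (𝓡 d) φ.symm (φ x) :=
    ((contMDiffOn_extChartAt_symm (n := ∞) p).contMDiffAt
      ((isOpen_extChartAt_target p).mem_nhds (φ.map_source hx))).mdifferentiableAt (by simp)
  have h3 := mfderiv_comp x h2 h1
  have h4 : (φ.symm ∘ φ : M → M) =ᶠ[𝓝 x] id := by
    filter_upwards [(isOpen_extChartAt_source p).mem_nhds hx] with y hy using φ.left_inv hy
  rw [h4.mfderiv_eq, mfderiv_id] at h3
  exact h3.symm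

/-- An extension to the ambient space of a one-form on an embedded manifold. -/
def RetractData.form {ι : M → E} (D : RetractData d ι)
    (α : ∀ x : M, TangentSpace (𝓡 d) x →L[ℝ] ℝ) (z : E) : E →L[ℝ] ℝ :=
  ∑ p : D.s, D.χ p z • (localRep α p (D.q p z)).comp (fderiv ℝ (D.q p) z)

theorem RetractData.contDiff_form {ι : M → E} (D : RetractData d ι)
    {α : ∀ x : M, TangentSpace (𝓡 d) x →L[ℝ] ℝ}
    (hα : ContMDiff (𝓡 d) ((𝓡 d).prod 𝓘(ℝ, EuclideanSpace ℝ (Fin d) →L[ℝ] ℝ)) ∞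
      (fun x => Bundle.TotalSpace.mk' (EuclideanSpace ℝ (Fin d) →L[ℝ] ℝ) x (α x))) :
    ContDiff ℝ ∞ (D.form α) := by
  refine ContDiff.sum fun p _ => ?_
  rw [contDiff_iff_contDiffAt]
  intro z
  by_cases hz : z ∈ tsupport (D.χ p)
  · have hzU := (D.isOpen p).mem_nhds (D.supp_χ p hz)
    have hq := (D.smooth_q p).contDiffAt hzU
    refine (D.smooth_χ p).contDiffAt.smul (ContDiffAt.clm_comp ?_ (hq.fderiv_right (by simp)))
    exact ((contDiffOn_localRep hα p).contDiffAt ((isOpen_extChartAt_target (p : M)).mem_nhds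
      (D.mapsTo p (D.supp_χ p hz)))).comp z hq
  · refine (contDiffAt_const (c := (0 : E →L[ℝ] ℝ))).congr_of_eventuallyEq ?_
    filter_upwards [(isClosed_tsupport (D.χ p)).isOpen_compl.mem_nhds hz] with y hy
    rw [image_eq_zero_of_notMem_tsupport hy, zero_smul]

theorem RetractData.form_apply {ι : M → E} (D : RetractData d ι)
    (hι : ContMDiff (𝓡 d) 𝓘(ℝ, E) ∞ ι)
    (α : ∀ x : M, TangentSpace (𝓡 d) x →L[ℝ] ℝ) (x : M) (v : TangentSpace (𝓡 d) x) :
    D.form α (ι x) (vd d ι x v) = α x v := by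
  have key : ∀ p : D.s, D.χ p (ι x) • (localRep α p (D.q p (ι x))) (fderiv ℝ (D.q p) (ι x)
      (vd d ι x v)) = D.χ p (ι x) • α x v := by
    intro p
    by_cases h : D.χ p (ι x) = 0
    · rw [h, zero_smul, zero_smul]
    have hU := D.mem_U_of_ne h
    obtain ⟨hs, hq⟩ := D.leftInv p x hU
    congr 1
    have hq' : HasFDerivAt (D.q p) (fderiv ℝ (D.q p) (ι x)) (ι x) :=
      (((D.smooth_q p).contDiffAt ((D.isOpen p).mem_nhds hU)).differentiableAt
        (by simp)).hasFDerivAt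
    have h1 := vd_comp hq' (hι.mdifferentiable (by simp) x)
    have h2 : (fun x => D.q p (ι x)) =ᶠ[𝓝 x] extChartAt (𝓡 d) (p : M) := by
      filter_upwards [hι.continuous.continuousAt.eventually ((D.isOpen p).mem_nhds hU)] with y hy
        using (D.leftInv p y hy).2
    rw [vd_congr h2] at h1
    have h3 : fderiv ℝ (D.q p) (ι x) (vd d ι x v) = vd d (extChartAt (𝓡 d) (p : M)) x v :=
      (congrArg (fun l => l v) h1).symm
    rw [h3, hq, localRep]
    have h5 : (mfderiv 𝓘(ℝ, EuclideanSpace ℝ (Fin d)) (𝓡 d) (extChartAt (𝓡 d) (p : M)).symm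
      (extChartAt (𝓡 d) (p : M) x)) (vd d (extChartAt (𝓡 d) (p : M)) x v) = v :=
      congrArg (fun l => l v) (mfderiv_chart_symm_comp hs)
    change α _ ((mfderiv 𝓘(ℝ, EuclideanSpace ℝ (Fin d)) (𝓡 d) (extChartAt (𝓡 d) (p : M)).symm
      (extChartAt (𝓡 d) (p : M) x)) (vd d (extChartAt (𝓡 d) (p : M)) x v)) = _
    rw [h5]
    exact form_congr ((extChartAt (𝓡 d) (p : M)).left_inv hs) v
  have h1 : D.form α (ι x) (vd d ι x v) = ∑ p : D.s, D.χ p (ι x) •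
      (localRep α p (D.q p (ι x))) (fderiv ℝ (D.q p) (ι x) (vd d ι x v)) := by
    simp [RetractData.form, sum_apply]
  rw [h1, Finset.sum_congr rfl fun p _ => key p, ← Finset.sum_smul, D.sum_eq, one_smul]

/-- Naturality of the exterior derivative under smooth maps to a vector space. -/
theorem extD_pullback {g : M → E} (hg : ContMDiff (𝓡 d) 𝓘(ℝ, E) ∞ g) {A : E → E →L[ℝ] ℝ}
    (hA : ContDiff ℝ ∞ A) {γ : ∀ x : M, TangentSpace (𝓡 d) x →L[ℝ] ℝ}
    (hγ : ∀ x v, γ x v = A (g x) (vd d g x v)) (x : M) (u v : TangentSpace (𝓡 d) x) :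
    extD γ x u v = dForm A (g x) (vd d g x u) (vd d g x v) := by
  set φ := extChartAt (𝓡 d) x with hφ
  set f : EuclideanSpace ℝ (Fin d) → E := fun y => g (φ.symm y) with hf
  have htgt : IsOpen φ.target := isOpen_extChartAt_target x
  have hx : φ x ∈ φ.target := mem_extChartAt_target x
  have hfs : ContDiffOn ℝ ∞ f φ.target := contDiffOn_comp_chart_symm hg x
  have hfA : ContDiffAt ℝ ∞ f (φ x) := hfs.contDiffAt (htgt.mem_nhds hx)
  have hloc : localRep γ x =ᶠ[𝓝 (φ x)] fun y => (A (f y)).comp (fderiv ℝ f y) := by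
    filter_upwards [htgt.mem_nhds hx] with y hy
    ext1 w
    rw [vd_comp_chart_symm hg x hy]
    exact hγ _ _
  have hf1 : HasFDerivAt f (fderiv ℝ f (φ x)) (φ x) := (hfA.differentiableAt (by simp)).hasFDerivAt
  have hf2 : HasFDerivAt (fderiv ℝ f) (fderiv ℝ (fderiv ℝ f) (φ x)) (φ x) :=
    ((hfA.fderiv_right (m := 1)
      (by rw [one_add_one_eq_two]; exact ENat.LEInfty.out)).differentiableAt
      one_ne_zero).hasFDerivAt
  have hA1 : HasFDerivAt A (fderiv ℝ A (f (φ x))) (f (φ x)) :=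
    (hA.differentiable (by simp) _).hasFDerivAt
  have hder := ((hA1.comp (φ x) hf1).clm_comp hf2).fderiv
  have hsymm : ∀ a b, fderiv ℝ (fderiv ℝ f) (φ x) a b = fderiv ℝ (fderiv ℝ f) (φ x) b a :=
    fun a b => (hfA.isSymmSndFDerivAt (by simpa using ENat.LEInfty.out)).eq a b
  have hgx : f (φ x) = g x := by simp only [hf]; rw [φ.left_inv (mem_extChartAt_source x)]
  have hchart : ∀ w, fderiv ℝ f (φ x) (chartD x w) = vd d g x w := by
    intro w
    have h1 : MDifferentiableAt (𝓡 d) 𝓘(ℝ, EuclideanSpace ℝ (Fin d)) φ x :=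
      (contMDiffAt_extChartAt (n := ∞)).mdifferentiableAt (by simp)
    have h2 := vd_comp hf1 h1
    have h3 : (fun y => f (φ y)) =ᶠ[𝓝 x] g := by
      have hsrc : IsOpen φ.source := isOpen_extChartAt_source x
      filter_upwards [hsrc.mem_nhds (mem_extChartAt_source x)] with y hy
      simp only [hf]; rw [φ.left_inv hy]
    rw [vd_congr h3] at h2
    exact (congrArg (fun l => l w) h2).symm
  have hfin : ∀ a b, fderiv ℝ (localRep γ x) (φ x) a b
      = fderiv ℝ A (g x) (fderiv ℝ f (φ x) a) (fderiv ℝ f (φ x) b)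
        + A (g x) (fderiv ℝ (fderiv ℝ f) (φ x) a b) := by
    intro a b
    rw [hloc.fderiv_eq]
    have h1 := congrArg (fun l => l a b) hder
    simp only [Function.comp_def] at h1
    rw [h1, ← hgx]
    simp [add_comm]
  rw [extD, dForm, ← hφ, hfin, hfin, hchart, hchart, hsymm]
  ring

end Forms

/-! ### Smooth dependence of contact vector fields on parameters -/

section Field

variable {n : ℕ} {V : Type*} [TopologicalSpace V]
  [ChartedSpace (EuclideanSpace ℝ (Fin (2 * n + 1))) V] [IsManifold (𝓡 (2 * n + 1)) ∞ V]
  (α : ContactForm n V)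
  {E : Type*} [NormedAddCommGroup E] [NormedSpace ℝ E] {ι : V → E}

/-- The bilinear form `α ⊗ α + dα` is nondegenerate. -/
theorem eq_zero_of_flat_eq_zero {x : V} {u : TangentSpace (𝓡 (2 * n + 1)) x}
    (h : ∀ v, α.form x u * α.form x v + extD α.form x u v = 0) : u = 0 := by
  have h1 : α.form x u = 0 := by
    have := h u
    rw [extD_self, add_zero] at this
    exact mul_self_eq_zero.mp this
  exact α.nondegenerate x u h1 fun v _ => by simpa [h1] using h v

theorem RetractData.extD_eq (D : RetractData (2 * n + 1) ι)
    (hι : ContMDiff (𝓡 (2 * n + 1)) 𝓘(ℝ, E) ∞ ι) (x : V)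
    (u v : TangentSpace (𝓡 (2 * n + 1)) x) :
    extD α.form x u v = dForm (D.form α.form) (ι x) (vd (2 * n + 1) ι x u)
      (vd (2 * n + 1) ι x v) :=
  extD_pullback hι (D.contDiff_form α.smooth) (fun x v => (D.form_apply hι α.form x v).symm) x u v

local notation "EE" => EuclideanSpace ℝ (Fin (2 * n + 1))

/-- The velocity of contact vector fields depends smoothly on parameters, in a chart. -/
theorem contDiffOn_contactField_chart (D : RetractData (2 * n + 1) ι)
    (hι : ContMDiff (𝓡 (2 * n + 1)) 𝓘(ℝ, E) ∞ ι) {P : Type*} [NormedAddCommGroup P]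
    [NormedSpace ℝ P] {S : Set P} (hS : UniqueDiffOn ℝ S) {k : P × E → ℝ}
    (hk : ContDiffOn ℝ ∞ k (S ×ˢ univ)) (x₀ : V) :
    ContDiffOn ℝ ∞ (fun q : P × EE => vd (2 * n + 1) ι ((extChartAt (𝓡 (2 * n + 1)) x₀).symm q.2)
      (contactField α (fun x => k (q.1, ι x)) ((extChartAt (𝓡 (2 * n + 1)) x₀).symm q.2)))
      (S ×ˢ (extChartAt (𝓡 (2 * n + 1)) x₀).target) := by
  set φ := extChartAt (𝓡 (2 * n + 1)) x₀ with hφ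
  set A := D.form α.form with hA'
  have hA : ContDiff ℝ ∞ A := D.contDiff_form α.smooth
  set f : EE → E := fun y => ι (φ.symm y) with hf
  have htgt : IsOpen φ.target := isOpen_extChartAt_target x₀
  have hfs : ContDiffOn ℝ ∞ f φ.target := contDiffOn_comp_chart_symm hι x₀
  have hDf : ContDiffOn ℝ ∞ (fderiv ℝ f) φ.target := hfs.fderiv_of_isOpen htgt (by simp)
  set a : EE → (EE →L[ℝ] ℝ) := fun y => (A (f y)).comp (fderiv ℝ f y) with ha
  have has : ContDiffOn ℝ ∞ a φ.target := (hA.comp_contDiffOn hfs).clm_comp hDf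
  -- the nondegenerate bilinear form `α ⊗ α + dα`, in the chart
  set L : EE → (EE →L[ℝ] EE →L[ℝ] ℝ) := fun y => (a y).smulRight (a y)
    + ((fderiv ℝ A (f y)).bilinearComp (fderiv ℝ f y) (fderiv ℝ f y)
    - ((fderiv ℝ A (f y)).bilinearComp (fderiv ℝ f y) (fderiv ℝ f y)).flip) with hL
  have hLapp : ∀ y u v, L y u v = a y u * a y v
      + dForm A (f y) (fderiv ℝ f y u) (fderiv ℝ f y v) := fun y u v => by
    simp [hL, dForm]
  have hLs : ContDiffOn ℝ ∞ L φ.target := by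
    rw [contDiffOn_clm_apply]
    intro u
    rw [contDiffOn_clm_apply]
    intro v
    simp only [hLapp, dForm]
    have hdA : ContDiffOn ℝ ∞ (fun y => fderiv ℝ A (f y)) φ.target :=
      (hA.fderiv_right (m := ∞) (by simp)).comp_contDiffOn hfs
    have hu := hDf.clm_apply (contDiffOn_const (c := u))
    have hv := hDf.clm_apply (contDiffOn_const (c := v))
    exact ((has.clm_apply contDiffOn_const).mul (has.clm_apply contDiffOn_const)).add
      (((hdA.clm_apply hu).clm_apply hv).sub ((hdA.clm_apply hv).clm_apply hu))
  set m : ∀ y : EE, EE →L[ℝ] TangentSpace (𝓡 (2 * n + 1)) (φ.symm y) := fun y =>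
    mfderiv 𝓘(ℝ, EE) (𝓡 (2 * n + 1)) φ.symm y with hm
  have hDfm : ∀ y ∈ φ.target, ∀ u, fderiv ℝ f y u = vd (2 * n + 1) ι (φ.symm y) (m y u) :=
    fun y hy u => congrArg (fun l => l u) (vd_comp_chart_symm hι x₀ hy)
  have ham : ∀ y ∈ φ.target, ∀ u, a y u = α.form (φ.symm y) (m y u) := fun y hy u => by
    rw [← D.form_apply hι α.form, ← hDfm y hy]; rfl
  have hLm : ∀ y ∈ φ.target, ∀ u v, L y u v
      = α.form (φ.symm y) (m y u) * α.form (φ.symm y) (m y v)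
        + extD α.form (φ.symm y) (m y u) (m y v) := fun y hy u v => by
    rw [hLapp, ham y hy, ham y hy, D.extD_eq α hι, ← hDfm y hy, ← hDfm y hy]
  have hmsurj : ∀ y ∈ φ.target, Function.Surjective (m y) := fun y hy w => by
    have h1 := mfderiv_chart_symm_comp (p := x₀) (φ.map_target hy)
    refine ⟨vd (2 * n + 1) φ (φ.symm y) w, ?_⟩
    have h2 := congrArg (fun l => l w) h1
    rw [← hφ, φ.right_inv hy] at h2
    exact h2
  have hminj : ∀ y ∈ φ.target, Function.Injective (m y) := fun y hy => by
    let m' : EE →L[ℝ] EE := m y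
    exact (LinearMap.injective_iff_surjective (f := (m' : EE →ₗ[ℝ] EE))).2 (hmsurj y hy)
  have hLinj : ∀ y ∈ φ.target, Function.Injective (L y) := fun y hy => by
    rw [injective_iff_map_eq_zero]
    intro u hu
    apply hminj y hy
    rw [map_zero]
    refine eq_zero_of_flat_eq_zero α fun w => ?_
    obtain ⟨v, rfl⟩ := hmsurj y hy w
    rw [← hLm y hy, hu]; rfl
  have hLe : ∀ y ∈ φ.target, ∃ e : EE ≃L[ℝ] (EE →L[ℝ] ℝ), (e : EE →L[ℝ] EE →L[ℝ] ℝ) = L y := by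
    intro y hy
    have hfr : Module.finrank ℝ EE = Module.finrank ℝ (EE →L[ℝ] ℝ) := by
      rw [← (LinearMap.toContinuousLinearMap : (EE →ₗ[ℝ] ℝ) ≃ₗ[ℝ] _).finrank_eq]
      exact (Subspace.dual_finrank_eq (K := ℝ) (V := EE)).symm
    refine ⟨(LinearEquiv.ofInjectiveOfFinrankEq ((L y : EE →L[ℝ] EE →L[ℝ] ℝ) :
      EE →ₗ[ℝ] (EE →L[ℝ] ℝ)) (hLinj y hy) hfr).toContinuousLinearEquiv, ?_⟩
    ext u v
    rfl
  have hinvs : ContDiffOn ℝ ∞ (fun y => (L y).inverse) φ.target := fun y hy => by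
    obtain ⟨e, he⟩ := hLe y hy
    have h1 := contDiffAt_map_inverse (n := ∞) e
    rw [he] at h1
    exact h1.comp_contDiffWithinAt y (hLs y hy)
  have hinv : ∀ y ∈ φ.target, ∀ u, (L y).inverse (L y u) = u := fun y hy u => by
    obtain ⟨e, he⟩ := hLe y hy
    rw [← he, ContinuousLinearMap.inverse_equiv]
    exact e.symm_apply_apply u
  -- the differential of the function, in the chart
  set b : P × EE → (EE →L[ℝ] ℝ) := fun q =>
    ((fderivWithin ℝ k (S ×ˢ univ) (q.1, f q.2)).comp (.inr ℝ P E)).comp (fderiv ℝ f q.2) with hb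
  have hf2 : ContDiffOn ℝ ∞ (fun q : P × EE => f q.2) (S ×ˢ φ.target) :=
    hfs.comp contDiffOn_snd fun q hq => hq.2
  have hpf : ContDiffOn ℝ ∞ (fun q : P × EE => (q.1, f q.2)) (S ×ˢ φ.target) :=
    contDiffOn_fst.prodMk hf2
  have hmaps : MapsTo (fun q : P × EE => (q.1, f q.2)) (S ×ˢ φ.target) (S ×ˢ univ) :=
    fun q hq => ⟨hq.1, mem_univ _⟩
  have hkd : ContDiffOn ℝ ∞ (fderivWithin ℝ k (S ×ˢ univ)) (S ×ˢ univ) :=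
    hk.fderivWithin (hS.prod uniqueDiffOn_univ) (by simp)
  have hbs : ContDiffOn ℝ ∞ b (S ×ˢ φ.target) :=
    ((hkd.comp hpf hmaps).clm_comp contDiffOn_const).clm_comp
      (hDf.comp contDiffOn_snd fun q hq => hq.2)
  have hbm : ∀ q ∈ S ×ˢ φ.target, ∀ u, b q u
      = dFun (fun x => k (q.1, ι x)) (φ.symm q.2) (m q.2 u) := by
    intro q hq u
    have h1 : HasFDerivWithinAt k (fderivWithin ℝ k (S ×ˢ univ) (q.1, f q.2)) (S ×ˢ univ)
        (q.1, f q.2) := ((hk (q.1, f q.2) ⟨hq.1, mem_univ _⟩).differentiableWithinAt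
          (by simp)).hasFDerivWithinAt
    have h2 : HasFDerivAt (fun z : E => (q.1, z)) (.inr ℝ P E) (f q.2) :=
      hasFDerivAt_prodMk_right _ _
    have h3 : HasFDerivAt (fun z => k (q.1, z))
        ((fderivWithin ℝ k (S ×ˢ univ) (q.1, f q.2)).comp (.inr ℝ P E)) (ι (φ.symm q.2)) := by
      rw [← hasFDerivWithinAt_univ]
      exact h1.comp (f q.2) h2.hasFDerivWithinAt fun z _ => ⟨hq.1, mem_univ _⟩
    have h4 := vd_comp h3 (hι.mdifferentiable (by simp) (φ.symm q.2))
    have h5 : dFun (fun x => k (q.1, ι x)) (φ.symm q.2) = vd (2 * n + 1) (fun x => k (q.1, ι x))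
      (φ.symm q.2) := rfl
    rw [h5, h4]
    simp only [hb, ContinuousLinearMap.comp_apply, hDfm q.2 hq.2]
  -- the contact vector field, solved from `L X = (f + df(R)) α - df` with `R = L⁻¹ α`
  set G : P × EE → EE := fun q => (L q.2).inverse
    ((k (q.1, f q.2) + b q ((L q.2).inverse (a q.2))) • a q.2 - b q) with hG
  have hGs : ContDiffOn ℝ ∞ G (S ×ˢ φ.target) := by
    have h2 : MapsTo (fun q : P × EE => q.2) (S ×ˢ φ.target) φ.target := fun q hq => hq.2
    have hi := hinvs.comp contDiffOn_snd h2
    have ha2 := has.comp contDiffOn_snd h2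
    exact hi.clm_apply ((((hk.comp hpf hmaps).add (hbs.clm_apply (hi.clm_apply ha2))).smul
      ha2).sub hbs)
  refine ((hDf.comp contDiffOn_snd fun q hq => hq.2).clm_apply hGs).congr ?_
  intro q hq
  obtain ⟨r, hr⟩ := hmsurj q.2 hq.2 (reeb α (φ.symm q.2))
  obtain ⟨ξ, hξ⟩ := hmsurj q.2 hq.2 (contactField α (fun x => k (q.1, ι x)) (φ.symm q.2))
  have hR := reeb_spec α (φ.symm q.2)
  have hX := contactField_spec α (fun x => k (q.1, ι x)) (φ.symm q.2)
  have h1 : L q.2 r = a q.2 := by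
    ext1 v
    rw [hLm q.2 hq.2, hr, hR.1, hR.2, ham q.2 hq.2, one_mul, add_zero]
  have h2 : L q.2 ξ = (k (q.1, f q.2) + b q ((L q.2).inverse (a q.2))) • a q.2 - b q := by
    rw [← h1, hinv q.2 hq.2]
    ext1 v
    rw [hLm q.2 hq.2, hξ, hX.1, hX.2, h1]
    simp only [sub_apply, smul_apply, smul_eq_mul, ham q.2 hq.2, hbm q hq, hr, hf]
    ring
  have h3 : G q = ξ := by rw [hG]; simp only [← h2, hinv q.2 hq.2]
  simp only [Function.comp_apply, h3, hDfm q.2 hq.2, hξ]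

theorem isCompact_sq : IsCompact (Icc (0 : ℝ) 1 ×ˢ Icc (0 : ℝ) 1) :=
  isCompact_Icc.prod isCompact_Icc

theorem uniqueDiffOn_sq : UniqueDiffOn ℝ (Icc (0 : ℝ) 1 ×ˢ Icc (0 : ℝ) 1) :=
  (uniqueDiffOn_Icc zero_lt_one).prod (uniqueDiffOn_Icc zero_lt_one)

theorem pI2_coe (p : I × I) : pI2 ((p.1 : ℝ), (p.2 : ℝ)) = p := by
  simp [pI2, pI_coe]

/-- Contact vector fields of a smooth two-parameter family of functions depend smoothly on the
parameters and the point. -/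
theorem contMDiff_contactField (D : RetractData (2 * n + 1) ι)
    (hι : ContMDiff (𝓡 (2 * n + 1)) 𝓘(ℝ, E) ∞ ι) {k : I × I → V → ℝ}
    (hk : ContMDiff (((𝓡∂ 1).prod (𝓡∂ 1)).prod (𝓡 (2 * n + 1))) 𝓘(ℝ, ℝ) ∞
      (fun q : (I × I) × V => k q.1 q.2)) :
    ContMDiff (((𝓡∂ 1).prod (𝓡∂ 1)).prod (𝓡 (2 * n + 1))) 𝓘(ℝ, E) ∞
      (fun q : (I × I) × V => vd (2 * n + 1) ι q.2 (contactField α (k q.1) q.2)) := by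
  have h1 := D.contDiffOn_ext hk contMDiffOn_pI2
  rintro ⟨p₀, x₀⟩
  have h2 := contDiffOn_contactField_chart α D hι uniqueDiffOn_sq h1 x₀
  set φ := extChartAt (𝓡 (2 * n + 1)) x₀ with hφ
  have hsrc : IsOpen φ.source := isOpen_extChartAt_source x₀
  have h3 : ContMDiffOn (((𝓡∂ 1).prod (𝓡∂ 1)).prod (𝓡 (2 * n + 1))) 𝓘(ℝ, (ℝ × ℝ) × EE) ∞
      (fun q : (I × I) × V => (((q.1.1 : ℝ), (q.1.2 : ℝ)), φ q.2)) (univ ×ˢ φ.source) := by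
    refine ContMDiffOn.prodMk_space (ContMDiff.contMDiffOn ?_) ?_
    · exact (contMDiff_coe_I.comp (contMDiff_fst.comp contMDiff_fst)).prodMk_space
        (contMDiff_coe_I.comp (contMDiff_snd.comp contMDiff_fst))
    · exact (contMDiffOn_extChartAt (x := x₀)).comp contMDiffOn_snd
        (fun q hq => by rw [← extChartAt_source (𝓡 (2 * n + 1))]; exact hq.2)
  have h4 := h2.contMDiffOn.comp h3 (fun q hq =>
    ⟨⟨q.1.1.2, q.1.2.2⟩, φ.map_source hq.2⟩)
  refine (h4.congr fun q hq => ?_).contMDiffAt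
    ((isOpen_univ.prod hsrc).mem_nhds ⟨mem_univ _, mem_extChartAt_source x₀⟩)
  simp only [Function.comp_apply, pI2_coe, D.ext_apply]
  have h5 : ∀ y, q.2 = y → vd (2 * n + 1) ι q.2 (contactField α (k q.1) q.2)
      = vd (2 * n + 1) ι y (contactField α (k q.1) y) := by rintro _ rfl; rfl
  exact h5 _ (φ.left_inv hq.2).symm

end Field

/-! ### Velocities of families of maps and Cartan's formula -/

section Velocity

variable {d : ℕ} {M : Type*} [TopologicalSpace M] [ChartedSpace (EuclideanSpace ℝ (Fin d)) M]
  {E : Type*} [NormedAddCommGroup E] [NormedSpace ℝ E] {ι : M → E}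

/-- The velocity of a curve parametrized by the unit interval. -/
def velocity (c : I → M) (t : I) : TangentSpace (𝓡 d) (c t) := mfderiv (𝓡∂ 1) (𝓡 d) c t 1

theorem hasDerivWithinAt_velocity {c : I → M} {t : I} (hc : MDifferentiableAt (𝓡∂ 1) (𝓡 d) c t)
    (hι : ContMDiff (𝓡 d) 𝓘(ℝ, E) ∞ ι) :
    HasDerivWithinAt (fun τ => ι (c (pI τ))) (vd d ι (c t) (velocity c t)) (Icc 0 1) t := by
  have hιt : MDifferentiableAt (𝓡 d) 𝓘(ℝ, E) ι (c t) := hι.mdifferentiable (by simp) _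
  have hg : MDifferentiableAt (𝓡∂ 1) 𝓘(ℝ, E) (ι ∘ c) t := hιt.comp t hc
  have h1 : MDifferentiableWithinAt 𝓘(ℝ, ℝ) 𝓘(ℝ, E) ((ι ∘ c) ∘ projIcc 0 1 zero_le_one)
    (Icc 0 1) (t : ℝ) := mdifferentiableWithinAt_comp_projIcc_iff.2 hg
  have h2 :=
    (mdifferentiableWithinAt_iff_differentiableWithinAt.1 h1).hasFDerivWithinAt.hasDerivWithinAt
  have h3 : mfderivWithin 𝓘(ℝ, ℝ) 𝓘(ℝ, E) ((ι ∘ c) ∘ projIcc 0 1 zero_le_one) (Icc 0 1) (t : ℝ) 1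
      = mfderiv (𝓡∂ 1) 𝓘(ℝ, E) (ι ∘ c) t 1 := mfderivWithin_comp_projIcc_one
  rw [mfderiv_comp t hιt hc, mfderivWithin_eq_fderivWithin] at h3
  have h4 : fderivWithin ℝ ((ι ∘ c) ∘ projIcc 0 1 zero_le_one) (Icc 0 1) (t : ℝ) (1 : ℝ)
      = vd d ι (c t) (velocity c t) := h3
  rw [h4] at h2
  exact h2

theorem IsEmb.velocity_eq (hι : IsEmb d ι) {c : I → M} {t : I}
    (hc : MDifferentiableAt (𝓡∂ 1) (𝓡 d) c t) {v : TangentSpace (𝓡 d) (c t)}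
    (h : HasDerivWithinAt (fun τ => ι (c (pI τ))) (vd d ι (c t) v) (Icc 0 1) t) :
    velocity c t = v :=
  hι.inj _ (((uniqueDiffOn_Icc zero_lt_one) _ t.2).eq_deriv _
    (hasDerivWithinAt_velocity hc hι.smooth) h)

end Velocity

section Families

variable {d : ℕ} {V : Type*} [TopologicalSpace V]
  [ChartedSpace (EuclideanSpace ℝ (Fin d)) V]
  {E : Type*} [NormedAddCommGroup E] [NormedSpace ℝ E] {ι : V → E}

theorem mdifferentiableAt_curve {Φ : I → V → V}
    (hΦ : ContMDiff ((𝓡∂ 1).prod (𝓡 d)) (𝓡 d) ∞ (fun p : I × V => Φ p.1 p.2)) (x : V) (t : I) :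
    MDifferentiableAt (𝓡∂ 1) (𝓡 d) (fun s => Φ s x) t :=
  (hΦ.comp (contMDiff_id.prodMk (contMDiff_const (c := x)))).mdifferentiable (by simp) t

theorem contMDiff_slice {T E' H' : Type*} [NormedAddCommGroup E'] [NormedSpace ℝ E']
    [TopologicalSpace H'] {J : ModelWithCorners ℝ E' H'} [TopologicalSpace T] [ChartedSpace H' T]
    {Φ : T → V → V}
    (hΦ : ContMDiff (J.prod (𝓡 d)) (𝓡 d) ∞ (fun p : T × V => Φ p.1 p.2)) (t : T) :
    ContMDiff (𝓡 d) (𝓡 d) ∞ (Φ t) :=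
  hΦ.comp (contMDiff_const.prodMk contMDiff_id)

theorem vd_comp_map {f : V → E} (hf : ContMDiff (𝓡 d) 𝓘(ℝ, E) ∞ f) {φ : V → V}
    (hφ : ContMDiff (𝓡 d) (𝓡 d) ∞ φ) (x : V) (w : TangentSpace (𝓡 d) x) :
    vd d (fun y => f (φ y)) x w = vd d f (φ x) (mfderiv (𝓡 d) (𝓡 d) φ x w) :=
  congrArg (fun l => l w) (mfderiv_comp x (hf.mdifferentiable (by simp) _)
    (hφ.mdifferentiable (by simp) x))

/-- A smooth family of maps of an embedded manifold, extended to the ambient space. -/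
def RetractData.amb (D : RetractData d ι) (Φ : I → V → V) (q : ℝ × E) : E :=
  D.ext (fun x => ι (Φ (pI q.1) x)) q.2

theorem RetractData.amb_apply (D : RetractData d ι) {Φ : I → V → V} (τ : ℝ) (x : V) :
    D.amb Φ (τ, ι x) = ι (Φ (pI τ) x) :=
  D.ext_apply _ _

variable [IsManifold (𝓡 d) ∞ V]

theorem RetractData.contDiffOn_amb (D : RetractData d ι) (hι : ContMDiff (𝓡 d) 𝓘(ℝ, E) ∞ ι)
    {Φ : I → V → V}
    (hΦ : ContMDiff ((𝓡∂ 1).prod (𝓡 d)) (𝓡 d) ∞ (fun p : I × V => Φ p.1 p.2)) :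
    ContDiffOn ℝ ∞ (D.amb Φ) (Icc 0 1 ×ˢ univ) :=
  D.contDiffOn_ext (J := 𝓡∂ 1) (T := I) (f := fun t x => ι (Φ t x)) (hι.comp hΦ) contMDiffOn_pI

theorem RetractData.hasFDerivWithinAt_amb (D : RetractData d ι)
    (hι : ContMDiff (𝓡 d) 𝓘(ℝ, E) ∞ ι) {Φ : I → V → V}
    (hΦ : ContMDiff ((𝓡∂ 1).prod (𝓡 d)) (𝓡 d) ∞ (fun p : I × V => Φ p.1 p.2)) (t : I) (z : E) :
    HasFDerivWithinAt (D.amb Φ) (fderivWithin ℝ (D.amb Φ) (Icc 0 1 ×ˢ univ) (t, z))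
      (Icc 0 1 ×ˢ univ) (t, z) :=
  ((D.contDiffOn_amb hι hΦ (t, z) ⟨t.2, mem_univ _⟩).differentiableWithinAt
    (by simp)).hasFDerivWithinAt

theorem mapsTo_prodMk_const {E : Type*} {z : E} {S : Set ℝ} :
    MapsTo (fun τ : ℝ => (τ, z)) S (S ×ˢ univ) := fun _ h => ⟨h, mem_univ _⟩

theorem RetractData.fderivWithin_amb_time (D : RetractData d ι)
    (hι : ContMDiff (𝓡 d) 𝓘(ℝ, E) ∞ ι) {Φ : I → V → V}
    (hΦ : ContMDiff ((𝓡∂ 1).prod (𝓡 d)) (𝓡 d) ∞ (fun p : I × V => Φ p.1 p.2)) (t : I) (x : V) :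
    fderivWithin ℝ (D.amb Φ) (Icc 0 1 ×ˢ univ) (t, ι x) (1, 0)
      = vd d ι (Φ t x) (velocity (fun s => Φ s x) t) := by
  have h1 := hasDerivWithinAt_velocity (mdifferentiableAt_curve hΦ x t) hι
  have h2 : HasDerivWithinAt (fun τ : ℝ => (τ, ι x)) ((1 : ℝ), (0 : E)) (Icc 0 1) (t : ℝ) :=
    (hasDerivWithinAt_id _ _).prodMk (hasDerivWithinAt_const _ _ _)
  have h3 := (D.hasFDerivWithinAt_amb hι hΦ t (ι x)).comp_hasDerivWithinAt (t : ℝ) h2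
    mapsTo_prodMk_const
  refine ((uniqueDiffOn_Icc zero_lt_one) _ t.2).eq_deriv _ h3 (h1.congr (fun τ hτ => ?_) ?_)
  · exact D.amb_apply τ x
  · exact D.amb_apply t x

theorem RetractData.fderivWithin_amb_space (D : RetractData d ι)
    (hι : ContMDiff (𝓡 d) 𝓘(ℝ, E) ∞ ι) {Φ : I → V → V}
    (hΦ : ContMDiff ((𝓡∂ 1).prod (𝓡 d)) (𝓡 d) ∞ (fun p : I × V => Φ p.1 p.2)) (t : I) (x : V)
    (w : TangentSpace (𝓡 d) x) :
    fderivWithin ℝ (D.amb Φ) (Icc 0 1 ×ˢ univ) (t, ι x) (0, vd d ι x w)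
      = vd d ι (Φ t x) (mfderiv (𝓡 d) (𝓡 d) (Φ t) x w) := by
  have h2 : HasFDerivAt (fun z : E => ((t : ℝ), z)) (.inr ℝ ℝ E) (ι x) :=
    hasFDerivAt_prodMk_right _ _
  have h3 : HasFDerivAt (fun z => D.amb Φ (t, z))
      ((fderivWithin ℝ (D.amb Φ) (Icc 0 1 ×ˢ univ) (t, ι x)).comp (.inr ℝ ℝ E)) (ι x) := by
    rw [← hasFDerivWithinAt_univ]
    exact (D.hasFDerivWithinAt_amb hι hΦ t (ι x)).comp (ι x) h2.hasFDerivWithinAt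
      fun z _ => ⟨t.2, mem_univ _⟩
  have h4 := vd_comp h3 (hι.mdifferentiable (by simp) x)
  rw [← vd_comp_map hι (contMDiff_slice hΦ t)]
  have h5 : (fun y => ι (Φ t y)) = fun y => D.amb Φ (t, ι y) := by
    ext y; rw [D.amb_apply, pI_coe]
  rw [h5, h4]
  rfl

/-- Leibniz rule for the composition of two time-dependent maps. -/
theorem RetractData.hasDerivWithinAt_comp (D : RetractData d ι)
    (hι : ContMDiff (𝓡 d) 𝓘(ℝ, E) ∞ ι) {Φ : I → V → V}
    (hΦ : ContMDiff ((𝓡∂ 1).prod (𝓡 d)) (𝓡 d) ∞ (fun p : I × V => Φ p.1 p.2)) {c : I → V} {t : I}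
    (hc : MDifferentiableAt (𝓡∂ 1) (𝓡 d) c t) :
    HasDerivWithinAt (fun τ => ι (Φ (pI τ) (c (pI τ))))
      (vd d ι (Φ t (c t)) (velocity (fun s => Φ s (c t)) t
        + mfderiv (𝓡 d) (𝓡 d) (Φ t) (c t) (velocity c t))) (Icc 0 1) t := by
  have h1 := hasDerivWithinAt_velocity hc hι
  have h2 : HasDerivWithinAt (fun τ : ℝ => (τ, ι (c (pI τ))))
      ((1 : ℝ), vd d ι (c t) (velocity c t)) (Icc 0 1) (t : ℝ) :=
    (hasDerivWithinAt_id _ _).prodMk h1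
  have h0 := D.hasFDerivWithinAt_amb hι hΦ t (ι (c t))
  have h3 := h0.comp_hasDerivWithinAt_of_eq (t : ℝ) h2
    (fun τ hτ => mk_mem_prod hτ (mem_univ _)) (by rw [pI_coe])
  have h4 : ((1 : ℝ), vd d ι (c t) (velocity c t)) = (1, 0) + (0, vd d ι (c t) (velocity c t)) := by
    simp
  rw [h4, map_add, D.fderivWithin_amb_time hι hΦ, D.fderivWithin_amb_space hι hΦ] at h3
  rw [map_add]
  refine h3.congr (fun τ hτ => ?_) ?_
  · exact (D.amb_apply τ _).symm
  · exact (D.amb_apply t _).symm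

end Families

section Evolution

variable {E : Type*} [NormedAddCommGroup E] [NormedSpace ℝ E]

/-- Cartan's formula for a one-form on a vector space pulled back by a time-dependent map. -/
theorem exists_hasDerivWithinAt_form {F : ℝ × E → E} (hFs : ContDiffOn ℝ ∞ F (Icc 0 1 ×ˢ univ))
    {A : E → E →L[ℝ] ℝ} (hA : ContDiff ℝ ∞ A) {t : ℝ} (ht : t ∈ Icc (0 : ℝ) 1) (z u : E) :
    ∃ G : E →L[ℝ] ℝ,
      HasFDerivAt (fun z => A (F (t, z)) (fderivWithin ℝ F (Icc 0 1 ×ˢ univ) (t, z) (1, 0))) G z ∧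
      HasDerivWithinAt (fun τ => A (F (τ, z)) (fderivWithin ℝ F (Icc 0 1 ×ˢ univ) (τ, z) (0, u)))
        (dForm A (F (t, z)) (fderivWithin ℝ F (Icc 0 1 ×ˢ univ) (t, z) (1, 0))
          (fderivWithin ℝ F (Icc 0 1 ×ˢ univ) (t, z) (0, u)) + G u) (Icc 0 1) t := by
  set S : Set (ℝ × E) := Icc 0 1 ×ˢ univ with hS
  have hSu : UniqueDiffOn ℝ S := (uniqueDiffOn_Icc zero_lt_one).prod uniqueDiffOn_univ
  set F' := fderivWithin ℝ F S with hF'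
  have hF's : ContDiffOn ℝ ∞ F' S := hFs.fderivWithin hSu (by simp)
  have htS : (t, z) ∈ S := ⟨ht, mem_univ _⟩
  have hFt : HasFDerivWithinAt F (F' (t, z)) S (t, z) :=
    ((hFs _ htS).differentiableWithinAt (by simp)).hasFDerivWithinAt
  have hF'' : HasFDerivWithinAt F' (fderivWithin ℝ F' S (t, z)) S (t, z) :=
    ((hF's _ htS).differentiableWithinAt (by simp)).hasFDerivWithinAt
  have hsymm : ∀ a b, fderivWithin ℝ F' S (t, z) a b = fderivWithin ℝ F' S (t, z) b a := by
    have hint : (t, z) ∈ closure (interior S) := by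
      rw [hS, interior_prod_eq, interior_univ, interior_Icc, closure_prod_eq, closure_univ,
        closure_Ioo zero_ne_one]
      exact htS
    exact fun a b => ((hFs _ htS).isSymmSndFDerivWithinAt (by simpa using ENat.LEInfty.out) hSu
      hint htS).eq a b
  have hA1 : ∀ z', HasFDerivAt A (fderiv ℝ A z') z' := fun z' =>
    (hA.differentiable (by simp) _).hasFDerivAt
  have e1 : HasDerivWithinAt (fun τ : ℝ => (τ, z)) ((1 : ℝ), (0 : E)) (Icc 0 1) t :=
    (hasDerivWithinAt_id _ _).prodMk (hasDerivWithinAt_const _ _ _)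
  have e2 : HasDerivWithinAt (fun τ => F (τ, z)) (F' (t, z) (1, 0)) (Icc 0 1) t :=
    hFt.comp_hasDerivWithinAt t e1 mapsTo_prodMk_const
  have e2' : HasDerivWithinAt (fun τ => A (F (τ, z))) (fderiv ℝ A (F (t, z)) (F' (t, z) (1, 0)))
    (Icc 0 1) t := (hA1 (F (t, z))).comp_hasDerivWithinAt t e2
  have e3 : HasDerivWithinAt (fun τ => F' (τ, z)) (fderivWithin ℝ F' S (t, z) (1, 0))
    (Icc 0 1) t := hF''.comp_hasDerivWithinAt t e1 mapsTo_prodMk_const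
  have e3' : HasDerivWithinAt (fun τ => F' (τ, z) (0, u))
      (fderivWithin ℝ F' S (t, z) (1, 0) (0, u)) (Icc 0 1) t := by
    have := (ContinuousLinearMap.apply ℝ E ((0 : ℝ), u)).hasFDerivAt.comp_hasDerivWithinAt t e3
    exact this
  have e4 := e2'.clm_apply e3'
  have k2 : HasFDerivWithinAt (fun z : E => (t, z)) (.inr ℝ ℝ E) univ z :=
    (hasFDerivAt_prodMk_right _ _).hasFDerivWithinAt
  have hm : MapsTo (fun z : E => (t, z)) univ S := fun z _ => ⟨ht, mem_univ _⟩
  have k3 : HasFDerivAt (fun z => F (t, z)) ((F' (t, z)).comp (.inr ℝ ℝ E)) z :=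
    hasFDerivWithinAt_univ.1 (hFt.comp z k2 hm)
  have k3' : HasFDerivAt (fun z => A (F (t, z)))
      ((fderiv ℝ A (F (t, z))).comp ((F' (t, z)).comp (.inr ℝ ℝ E))) z :=
    (hA1 (F (t, z))).comp z k3
  have k4 : HasFDerivAt (fun z => F' (t, z)) ((fderivWithin ℝ F' S (t, z)).comp (.inr ℝ ℝ E)) z :=
    hasFDerivWithinAt_univ.1 (hF''.comp z k2 hm)
  have k4' : HasFDerivAt (fun z => F' (t, z) (1, 0))
      ((ContinuousLinearMap.apply ℝ E ((1 : ℝ), (0 : E))).comp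
        ((fderivWithin ℝ F' S (t, z)).comp (.inr ℝ ℝ E))) z :=
    (ContinuousLinearMap.apply ℝ E ((1 : ℝ), (0 : E))).hasFDerivAt.comp z k4
  have k5 := k3'.clm_apply k4'
  refine ⟨_, k5, e4.congr_deriv ?_⟩
  have := hsymm (0, u) (1, 0)
  simp only [dForm, add_apply, ContinuousLinearMap.comp_apply, ContinuousLinearMap.flip_apply,
    ContinuousLinearMap.inr_apply, ContinuousLinearMap.apply_apply, this]
  ring

variable {n : ℕ} {V : Type*} [TopologicalSpace V]
  [ChartedSpace (EuclideanSpace ℝ (Fin (2 * n + 1))) V] [IsManifold (𝓡 (2 * n + 1)) ∞ V]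
  {α : ContactForm n V} {ι : V → E}

/-- Cartan's formula: the evolution of `α` along the images of a tangent vector under a smooth
family of maps. -/
theorem RetractData.hasDerivWithinAt_form (D : RetractData (2 * n + 1) ι)
    (hι : ContMDiff (𝓡 (2 * n + 1)) 𝓘(ℝ, E) ∞ ι) {Φ : I → V → V}
    (hΦ : ContMDiff ((𝓡∂ 1).prod (𝓡 (2 * n + 1))) (𝓡 (2 * n + 1)) ∞ (fun p : I × V => Φ p.1 p.2))
    {h : V → ℝ} (hh : ContMDiff (𝓡 (2 * n + 1)) 𝓘(ℝ, ℝ) ∞ h) {t : I}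
    (hX : ∀ x, α.form (Φ t x) (velocity (fun s => Φ s x) t) = h (Φ t x)) (x : V)
    (w : TangentSpace (𝓡 (2 * n + 1)) x) :
    HasDerivWithinAt
      (fun τ => α.form (Φ (pI τ) x) (mfderiv (𝓡 (2 * n + 1)) (𝓡 (2 * n + 1)) (Φ (pI τ)) x w))
      (extD α.form (Φ t x) (velocity (fun s => Φ s x) t)
          (mfderiv (𝓡 (2 * n + 1)) (𝓡 (2 * n + 1)) (Φ t) x w)
        + dFun h (Φ t x) (mfderiv (𝓡 (2 * n + 1)) (𝓡 (2 * n + 1)) (Φ t) x w)) (Icc 0 1) t := by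
  obtain ⟨G, hG, hder⟩ := exists_hasDerivWithinAt_form (D.contDiffOn_amb hι hΦ)
    (D.contDiff_form α.smooth) t.2 (ι x) (vd (2 * n + 1) ι x w)
  have k6 := vd_comp hG (hι.mdifferentiable (by simp) x)
  have k7 : (fun y : V => D.form α.form (D.amb Φ (t, ι y))
      (fderivWithin ℝ (D.amb Φ) (Icc 0 1 ×ˢ univ) (t, ι y) (1, 0))) = fun y => h (Φ t y) := by
    ext y
    rw [← hX y, D.fderivWithin_amb_time hι hΦ, D.amb_apply, pI_coe, D.form_apply hι]
  rw [k7] at k6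
  have k8 : dFun h (Φ t x) (mfderiv (𝓡 (2 * n + 1)) (𝓡 (2 * n + 1)) (Φ t) x w)
      = G (vd (2 * n + 1) ι x w) :=
    (vd_comp_map hh (contMDiff_slice hΦ t) x w).symm.trans (congrArg (fun l => l w) k6)
  have v3 : ∀ τ : ℝ, τ ∈ Icc (0 : ℝ) 1 →
      α.form (Φ (pI τ) x) (mfderiv (𝓡 (2 * n + 1)) (𝓡 (2 * n + 1)) (Φ (pI τ)) x w)
        = D.form α.form (D.amb Φ (τ, ι x))
          (fderivWithin ℝ (D.amb Φ) (Icc 0 1 ×ˢ univ) (τ, ι x) (0, vd (2 * n + 1) ι x w)) := by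
    intro τ hτ
    have := D.fderivWithin_amb_space hι hΦ (pI τ) x w
    rw [coe_pI hτ] at this
    rw [this, D.amb_apply, D.form_apply hι]
  refine (hder.congr_deriv ?_).congr v3 (v3 t t.2)
  rw [D.extD_eq α hι, k8, D.amb_apply, pI_coe, D.fderivWithin_amb_time hι hΦ,
    D.fderivWithin_amb_space hι hΦ]

end Evolution

/-! ### Integrating contact Hamiltonians -/

/-- The Whitney embedding of a closed manifold. -/
theorem exists_isEmb {d : ℕ} (M : Type*) [TopologicalSpace M]
    [ChartedSpace (EuclideanSpace ℝ (Fin d)) M] [IsManifold (𝓡 d) ∞ M] [T2Space M]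
    [CompactSpace M] :
    ∃ (N : ℕ) (ι : M → EuclideanSpace ℝ (Fin N)), IsEmb d ι := by
  have h : ∃ (N : ℕ) (e : M → EuclideanSpace ℝ (Fin N)), ContMDiff (𝓡 d) (𝓡 N) ∞ e ∧
    IsClosedEmbedding e ∧ ∀ x, Function.Injective (mfderiv (𝓡 d) (𝓡 N) e x) :=
    exists_embedding_euclidean_of_compact
  obtain ⟨N, e, he, hemb, hinj⟩ := h
  exact ⟨N, e, he, hemb.isEmbedding, hinj⟩

section Isotopies

variable {n : ℕ} {V : Type*} [TopologicalSpace V]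
  [ChartedSpace (EuclideanSpace ℝ (Fin (2 * n + 1))) V]

theorem dFun_const (c : ℝ) (x : V) : dFun (n := n) (fun _ : V => c) x = 0 := mfderiv_const

theorem surjective_mfderiv {φ : Equiv.Perm V}
    (sφ : ContMDiff (𝓡 (2 * n + 1)) (𝓡 (2 * n + 1)) ∞ φ)
    (sφ' : ContMDiff (𝓡 (2 * n + 1)) (𝓡 (2 * n + 1)) ∞ (φ⁻¹ : Equiv.Perm V)) (x : V) :
    Function.Surjective (mfderiv (𝓡 (2 * n + 1)) (𝓡 (2 * n + 1)) φ x) := by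
  have h : ∀ z, Function.Surjective
      (mfderiv (𝓡 (2 * n + 1)) (𝓡 (2 * n + 1)) φ ((φ⁻¹ : Equiv.Perm V) z)) := fun z => by
    have h1 := mfderiv_comp z (sφ.mdifferentiable (by simp) _) (sφ'.mdifferentiable (by simp) z)
    have h2 : (φ ∘ (φ⁻¹ : Equiv.Perm V) : V → V) = id := by ext y; simp
    rw [h2, mfderiv_id] at h1
    intro w
    exact ⟨_, (congrArg (fun l => l w) h1).symm⟩
  have e : (φ⁻¹ : Equiv.Perm V) (φ x) = x := by simp
  exact e ▸ h (φ x)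

theorem contMDiff_slice_fst {K : I × I → Equiv.Perm V}
    (hK : ContMDiff (((𝓡∂ 1).prod (𝓡∂ 1)).prod (𝓡 (2 * n + 1))) (𝓡 (2 * n + 1)) ∞
      (fun p : (I × I) × V => K p.1 p.2)) (t : I) :
    ContMDiff ((𝓡∂ 1).prod (𝓡 (2 * n + 1))) (𝓡 (2 * n + 1)) ∞
      (fun p : I × V => K (p.1, t) p.2) :=
  hK.comp (f := fun p : I × V => ((p.1, t), p.2))
    ((contMDiff_fst.prodMk contMDiff_const).prodMk contMDiff_snd)

variable [IsManifold (𝓡 (2 * n + 1)) ∞ V] {α : ContactForm n V}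

theorem contactField_eq {f : V → ℝ} {x : V} {X : TangentSpace (𝓡 (2 * n + 1)) x}
    (h : IsContactVector α f x X) : X = contactField α f x :=
  (existsUnique_isContactVector α f x).unique h (contactField_spec α f x)

theorem reeb_eq_contactField (x : V) : reeb α x = contactField α (fun _ => 1) x :=
  contactField_eq ⟨(reeb_spec α x).1, fun v => by
    rw [(reeb_spec α x).2, dFun_const]; simp⟩

theorem extD_smul_right {x : V} (u v : TangentSpace (𝓡 (2 * n + 1)) x) (c : ℝ) :
    extD α.form x u (c • v) = c * extD α.form x u v :=
  (extDLin α.form x u).map_smul c v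

theorem extD_sub_right {x : V} (u v w : TangentSpace (𝓡 (2 * n + 1)) x) :
    extD α.form x u (v - w) = extD α.form x u v - extD α.form x u w :=
  (extDLin α.form x u).map_sub v w

variable (α) in
/-- The family `K` of bijections is an integral curve of the time-dependent contact vector field
of the functions `k s`. -/
def Integrates (k : I → V → ℝ) (K : I → Equiv.Perm V) : Prop :=
  ∀ s x, velocity (d := 2 * n + 1) (fun s => K s x) s = contactField α (k s) (K s x)

theorem generates_iff {h : Ham n V} {Φ : ContactIsotopy α} :
    Generates α h Φ ↔ Integrates α (fun t y => h (t, y)) Φ.1 := Iff.rfl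

section Ambient

variable {E : Type*} [NormedAddCommGroup E] [NormedSpace ℝ E] {ι : V → E}

/-- The Reeb derivatives of a smooth two-parameter family of functions are uniformly bounded. These
are the coefficients of the linear equation satisfied by `α(dK w)` along a contact flow. -/
theorem RetractData.exists_abs_dFun_reeb_le [CompactSpace V] (D : RetractData (2 * n + 1) ι)
    (hι : ContMDiff (𝓡 (2 * n + 1)) 𝓘(ℝ, E) ∞ ι) (α : ContactForm n V) {k : I × I → V → ℝ}
    (hk : ContMDiff (((𝓡∂ 1).prod (𝓡∂ 1)).prod (𝓡 (2 * n + 1))) 𝓘(ℝ, ℝ) ∞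
      (fun q : (I × I) × V => k q.1 q.2)) :
    ∃ C : ℝ, ∀ p x, |dFun (k p) x (reeb α x)| ≤ C := by
  set S : Set (ℝ × ℝ) := Icc 0 1 ×ˢ Icc 0 1 with hS
  set kk : (ℝ × ℝ) × E → ℝ := fun q => D.ext (k (pI2 q.1)) q.2 with hkk
  have hks : ContDiffOn ℝ ∞ kk (S ×ˢ univ) := D.contDiffOn_ext hk contMDiffOn_pI2
  have hu : UniqueDiffOn ℝ (S ×ˢ (univ : Set E)) := uniqueDiffOn_sq.prod uniqueDiffOn_univ
  have hkd : ContinuousOn (fderivWithin ℝ kk (S ×ˢ univ)) (S ×ˢ univ) :=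
    (hks.fderivWithin (m := ∞) hu (by simp)).continuousOn
  have hR := contMDiff_contactField α D hι (k := fun _ _ => 1) contMDiff_const
  have hRc := hR.continuous
  have hco : Continuous
      (fun q : (I × I) × V => ((((q.1.1 : ℝ), (q.1.2 : ℝ)), ι q.2) : (ℝ × ℝ) × E)) := by
    have := hι.continuous
    fun_prop
  have hc : Continuous (fun q : (I × I) × V => fderivWithin ℝ kk (S ×ˢ univ)
      (((q.1.1 : ℝ), (q.1.2 : ℝ)), ι q.2)
      ((0 : ℝ × ℝ), vd (2 * n + 1) ι q.2 (contactField α (fun _ => 1) q.2))) :=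
    (hkd.comp_continuous hco fun q => ⟨⟨q.1.1.2, q.1.2.2⟩, mem_univ _⟩).clm_apply
      (continuous_const.prodMk hRc)
  obtain ⟨C, hC⟩ := isCompact_univ.exists_bound_of_continuousOn hc.continuousOn
  refine ⟨C, fun p x => ?_⟩
  have h1 := hC (p, x) (mem_univ _)
  rw [← reeb_eq_contactField] at h1
  have hmem : ((((p.1 : ℝ), (p.2 : ℝ)), ι x) : (ℝ × ℝ) × E) ∈ S ×ˢ (univ : Set E) :=
    ⟨⟨p.1.2, p.2.2⟩, mem_univ _⟩
  have h2 := ((hks _ hmem).differentiableWithinAt (by simp)).hasFDerivWithinAt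
  have h3 : HasFDerivAt (fun z => kk (((p.1 : ℝ), (p.2 : ℝ)), z)) _ (ι x) :=
    hasFDerivWithinAt_univ.1 (h2.comp (ι x) (hasFDerivAt_prodMk_right _ _).hasFDerivWithinAt
      fun z _ => ⟨⟨p.1.2, p.2.2⟩, mem_univ _⟩)
  have h4 := vd_comp h3 (hι.mdifferentiable (by simp) x)
  have h5 : (fun y => kk (((p.1 : ℝ), (p.2 : ℝ)), ι y)) = k p := by
    ext y; simp only [hkk, pI2_coe, D.ext_apply]
  rw [h5] at h4
  have h6 : dFun (k p) x = vd (2 * n + 1) (k p) x := rfl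
  rw [h6, h4, ← Real.norm_eq_abs]
  exact h1

/-- A smooth family of diffeomorphisms starting at the identity and integrating contact vector
fields consists of contactomorphisms: `α(dK w)` solves a linear equation. -/
theorem RetractData.preservesXi_of_integrates [CompactSpace V] (D : RetractData (2 * n + 1) ι)
    (hι : ContMDiff (𝓡 (2 * n + 1)) 𝓘(ℝ, E) ∞ ι) {k : I × I → V → ℝ}
    (hk : ContMDiff (((𝓡∂ 1).prod (𝓡∂ 1)).prod (𝓡 (2 * n + 1))) 𝓘(ℝ, ℝ) ∞
      (fun q : (I × I) × V => k q.1 q.2)) {K : I × I → Equiv.Perm V}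
    (hK : ContMDiff (((𝓡∂ 1).prod (𝓡∂ 1)).prod (𝓡 (2 * n + 1))) (𝓡 (2 * n + 1)) ∞
      (fun p : (I × I) × V => K p.1 p.2))
    (hK' : ContMDiff (((𝓡∂ 1).prod (𝓡∂ 1)).prod (𝓡 (2 * n + 1))) (𝓡 (2 * n + 1)) ∞
      (fun p : (I × I) × V => (K p.1)⁻¹ p.2))
    {t : I} (h0 : K (0, t) = 1) (hint : Integrates α (fun s => k (s, t)) (fun s => K (s, t)))
    (s : I) : PreservesXi α (K (s, t)) := by
  obtain ⟨C, hC⟩ := D.exists_abs_dFun_reeb_le hι α hk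
  have hkp : ∀ p, ContMDiff (𝓡 (2 * n + 1)) 𝓘(ℝ, ℝ) ∞ (k p) := fun p =>
    hk.comp (contMDiff_const.prodMk contMDiff_id)
  have key : ∀ x (w : TangentSpace (𝓡 (2 * n + 1)) x), α.form x w = 0 →
      α.form (K (s, t) x) (mfderiv (𝓡 (2 * n + 1)) (𝓡 (2 * n + 1)) (K (s, t)) x w) = 0 := by
    intro x w hw
    have hder : ∀ τ ∈ Icc (0 : ℝ) 1, HasDerivWithinAt
        (fun τ => α.form (K (pI τ, t) x)
          (mfderiv (𝓡 (2 * n + 1)) (𝓡 (2 * n + 1)) (K (pI τ, t)) x w))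
        (dFun (k (pI τ, t)) (K (pI τ, t) x) (reeb α (K (pI τ, t) x)) * α.form (K (pI τ, t) x)
          (mfderiv (𝓡 (2 * n + 1)) (𝓡 (2 * n + 1)) (K (pI τ, t)) x w)) (Icc 0 1) τ := by
      intro τ hτ
      have h1 := D.hasDerivWithinAt_form hι (α := α) (Φ := fun s x => K (s, t) x)
        (contMDiff_slice_fst hK t)
        (hkp (pI τ, t)) (t := pI τ) (fun x => by
          rw [hint]; exact (contactField_spec α _ _).1) x w
      rw [hint, (contactField_spec α _ _).2, coe_pI hτ] at h1
      refine h1.congr_deriv ?_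
      ring
    have := norm_le_of_norm_deriv_le (c := 0) (K := C) ((abs_nonneg _).trans (hC (0, 0) x)) hder ?_
      (fun τ hτ => ?_) s s.2
    · rw [pI_coe, zero_mul] at this
      exact norm_le_zero_iff.1 this
    · rw [pI_zero, h0]
      have h2 := (PreservesXi.one (α := α) x w).2 hw
      rw [h2, norm_zero]
    · rw [norm_mul]
      exact mul_le_mul_of_nonneg_right (hC _ _) (norm_nonneg _)
  intro x v
  refine ⟨fun hv => ?_, key x v⟩
  by_contra hne
  have hsurj := surjective_mfderiv (hK.comp (contMDiff_const.prodMk contMDiff_id))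
    (hK'.comp (contMDiff_const.prodMk contMDiff_id)) (φ := K (s, t)) x
  apply α.ne_zero (K (s, t) x)
  ext y
  obtain ⟨w, rfl⟩ := hsurj y
  have h3 := key x (w - (α.form x w / α.form x v) • v) (by
    rw [map_sub, map_smul, smul_eq_mul, div_mul_cancel₀ _ hne, sub_self])
  rw [map_sub, map_smul, map_sub, map_smul, hv, smul_zero, sub_zero] at h3
  exact h3

end Ambient

variable [T2Space V] [CompactSpace V]

/-- Smooth two-parameter families of functions integrate to smooth families of
contactomorphisms. -/
theorem exists_contactFamily (α : ContactForm n V) {k : I × I → V → ℝ}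
    (hk : ContMDiff (((𝓡∂ 1).prod (𝓡∂ 1)).prod (𝓡 (2 * n + 1))) 𝓘(ℝ, ℝ) ∞
      (fun q : (I × I) × V => k q.1 q.2)) :
    ∃ K : I × I → Equiv.Perm V, IsContactFamily α ((𝓡∂ 1).prod (𝓡∂ 1)) (I × I) K ∧
      (∀ t, K (0, t) = 1) ∧
      ∀ t, Integrates α (fun s => k (s, t)) (fun s => K (s, t)) := by
  obtain ⟨N, ι, hι⟩ := exists_isEmb (d := 2 * n + 1) V
  obtain ⟨D⟩ := hι.nonempty_retractData
  set S : Set (ℝ × ℝ) := Icc 0 1 ×ˢ Icc 0 1 with hS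
  set Z : (ℝ × ℝ) × EuclideanSpace ℝ (Fin N) → EuclideanSpace ℝ (Fin N) := fun q =>
    D.ext (fun x => vd (2 * n + 1) ι x (contactField α (k (pI2 q.1)) x)) q.2 with hZ
  have hZs : ContDiffOn ℝ ∞ Z (S ×ˢ univ) :=
    D.contDiffOn_ext (f := fun p x => vd (2 * n + 1) ι x (contactField α (k p) x))
      (contMDiff_contactField α D hι.smooth hk) contMDiffOn_pI2
  have hZι : ∀ p x, Z (p, ι x) = vd (2 * n + 1) ι x (contactField α (k (pI2 p)) x) :=
    fun p x => D.ext_apply _ _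
  obtain ⟨R, hR⟩ := D.exists_ext_eq_zero (F := EuclideanSpace ℝ (Fin N))
  have hZR : ∀ p ∈ S, ∀ z, R ≤ ‖z‖ → Z (p, z) = 0 := fun p _ z hz => hR _ z hz
  obtain ⟨⟨κ, hκ⟩, L, hL⟩ := exists_lipschitz_of_vanish isCompact_sq uniqueDiffOn_sq hZs hZR
  obtain ⟨Φ, Ψ, hΦs, hΨs, hΦ0, hΦ, hΨΦ, hΦΨ, hΨ⟩ := exists_flow_and_inverse hZs hZR
  have hΦr : ∀ (p : I × I) x, ∃ y, ι y = Φ (((p.1 : ℝ), (p.2 : ℝ)), ι x) := fun p x =>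
    hι.invariant (X := fun s z => Z ((s, p.2), z)) (fun s hs => hκ (s, p.2) ⟨hs, p.2.2⟩)
      (fun s hs => hL (s, p.2) ⟨hs, p.2.2⟩) (fun s hs y => by rw [hZι]; exact mem_range_self _)
      (hΦ p.2 p.2.2 (ι x)) (by rw [hΦ0]; exact mem_range_self _) p.1 p.1.2
  have hΨr : ∀ (p : I × I) x, ∃ y, ι y = Ψ (((p.1 : ℝ), (p.2 : ℝ)), ι x) := fun p x => by
    obtain ⟨v, hv0, hv1, hv⟩ := hΨ p.1 p.1.2 p.2 p.2.2 (ι x)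
    have hmem : ∀ τ ∈ Icc (0 : ℝ) 1, ((p.1 - p.1 * τ : ℝ), (p.2 : ℝ)) ∈ S := fun τ hτ =>
      ⟨⟨by nlinarith [p.1.2.1, hτ.2], by nlinarith [p.1.2.1, p.1.2.2, hτ.1]⟩, p.2.2⟩
    have habs : ‖-(p.1 : ℝ)‖ ≤ 1 := by
      rw [norm_neg, Real.norm_eq_abs, abs_of_nonneg p.1.2.1]; exact p.1.2.2
    have := hι.invariant (X := fun τ z => -(p.1 : ℝ) • Z ((p.1 - p.1 * τ, p.2), z)) (K := κ)
      (L := L)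
      (fun τ hτ => LipschitzWith.of_dist_le_mul fun a b => by
        rw [dist_eq_norm, ← smul_sub, norm_smul, ← dist_eq_norm]
        exact (mul_le_of_le_one_left dist_nonneg habs).trans ((hκ _ (hmem τ hτ)).dist_le_mul a b))
      (fun τ hτ z => by
        rw [norm_smul]
        exact (mul_le_of_le_one_left (norm_nonneg _) habs).trans (hL _ (hmem τ hτ) z))
      (fun τ hτ y => ⟨-(p.1 : ℝ) • contactField α (k (pI2 (p.1 - p.1 * τ, p.2))) y, by
        rw [map_smul, hZι]⟩)
      hv (by rw [hv0]; exact mem_range_self _) 1 (by simp)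
    rwa [hv1] at this
  choose f hf using hΦr
  choose g hg using hΨr
  have hinj : Function.Injective ι := hι.emb.injective
  obtain ⟨K, hKf, hKg⟩ : ∃ K : I × I → Equiv.Perm V,
      (∀ p x, ι (K p x) = Φ (((p.1 : ℝ), (p.2 : ℝ)), ι x)) ∧
      ∀ p x, ι ((K p)⁻¹ x) = Ψ (((p.1 : ℝ), (p.2 : ℝ)), ι x) :=
    ⟨fun p =>
      { toFun := f p
        invFun := g p
        left_inv := fun x => hinj (by rw [hg, hf, hΨΦ _ p.1.2 _ p.2.2])
        right_inv := fun x => hinj (by rw [hf, hg, hΦΨ _ p.1.2 _ p.2.2]) }, hf, hg⟩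
  have hco : ContMDiff (((𝓡∂ 1).prod (𝓡∂ 1)).prod (𝓡 (2 * n + 1)))
      𝓘(ℝ, (ℝ × ℝ) × EuclideanSpace ℝ (Fin N)) ∞
      (fun q : (I × I) × V => (((q.1.1 : ℝ), (q.1.2 : ℝ)), ι q.2)) :=
    ((contMDiff_coe_I.comp (contMDiff_fst.comp contMDiff_fst)).prodMk_space
      (contMDiff_coe_I.comp (contMDiff_snd.comp contMDiff_fst))).prodMk_space
        (hι.smooth.comp contMDiff_snd)
  have hmem : ∀ q : (I × I) × V, (((q.1.1 : ℝ), (q.1.2 : ℝ)), ι q.2) ∈ S ×ˢ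
    (univ : Set (EuclideanSpace ℝ (Fin N))) := fun q => ⟨⟨q.1.1.2, q.1.2.2⟩, mem_univ _⟩
  have hfs : ContMDiff (((𝓡∂ 1).prod (𝓡∂ 1)).prod (𝓡 (2 * n + 1))) (𝓡 (2 * n + 1)) ∞
      (fun p : (I × I) × V => K p.1 p.2) :=
    hι.contMDiff_of_comp ((hΦs.contMDiffOn.comp_contMDiff hco hmem).congr fun q => hKf q.1 q.2)
  have hgs : ContMDiff (((𝓡∂ 1).prod (𝓡∂ 1)).prod (𝓡 (2 * n + 1))) (𝓡 (2 * n + 1)) ∞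
      (fun p : (I × I) × V => (K p.1)⁻¹ p.2) :=
    hι.contMDiff_of_comp ((hΨs.contMDiffOn.comp_contMDiff hco hmem).congr fun q => hKg q.1 q.2)
  have h0 : ∀ t, K (0, t) = 1 := fun t => by
    ext x
    exact hinj ((hKf (0, t) x).trans (hΦ0 _ _))
  have hint : ∀ t, Integrates α (fun s => k (s, t)) (fun s => K (s, t)) := by
    intro t s x
    refine hι.velocity_eq (mdifferentiableAt_curve (Φ := fun s x => K (s, t) x)
      (contMDiff_slice_fst hfs t) x s) ?_
    have h1 := hΦ t t.2 (ι x) s s.2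
    have h2 : Φ (((s : ℝ), (t : ℝ)), ι x) = ι (K (s, t) x) := (hKf (s, t) x).symm
    rw [h2, hZι, pI2_coe (s, t)] at h1
    refine h1.congr (fun τ hτ => ?_) ?_
    · rw [← coe_pI hτ, pI_coe]; exact hKf (pI τ, t) x
    · rw [pI_coe]; exact hKf (s, t) x
  refine ⟨K, ⟨hfs, hgs, ?_⟩, h0, hint⟩
  rintro ⟨s, t⟩
  exact D.preservesXi_of_integrates hι.smooth hk hfs hgs (h0 t) (hint t) s

/-- The contact Hamiltonian of a smooth family of contactomorphisms starting at the identity. -/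
theorem exists_integrates {K : I × I → Equiv.Perm V}
    (hK : IsContactFamily α ((𝓡∂ 1).prod (𝓡∂ 1)) (I × I) K) :
    ∃ k : I × I → V → ℝ, ContMDiff (((𝓡∂ 1).prod (𝓡∂ 1)).prod (𝓡 (2 * n + 1))) 𝓘(ℝ, ℝ) ∞
      (fun q : (I × I) × V => k q.1 q.2) ∧
      ∀ t, Integrates α (fun s => k (s, t)) (fun s => K (s, t)) := by
  obtain ⟨N, ι, hι⟩ := exists_isEmb (d := 2 * n + 1) V
  obtain ⟨D⟩ := hι.nonempty_retractData
  set S : Set (ℝ × ℝ) := Icc 0 1 ×ˢ Icc 0 1 with hS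
  have hSu : UniqueDiffOn ℝ (S ×ˢ (univ : Set (EuclideanSpace ℝ (Fin N)))) :=
    uniqueDiffOn_sq.prod uniqueDiffOn_univ
  set F : (ℝ × ℝ) × EuclideanSpace ℝ (Fin N) → EuclideanSpace ℝ (Fin N) := fun q =>
    D.ext (fun x => ι (K (pI2 q.1) x)) q.2 with hF
  have hFs : ContDiffOn ℝ ∞ F (S ×ˢ univ) :=
    D.contDiffOn_ext (f := fun p x => ι (K p x)) (hι.smooth.comp hK.smooth) contMDiffOn_pI2
  have hFd : ContDiffOn ℝ ∞ (fderivWithin ℝ F (S ×ˢ univ)) (S ×ˢ univ) :=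
    hFs.fderivWithin hSu (by simp)
  have hco : ContMDiff (((𝓡∂ 1).prod (𝓡∂ 1)).prod (𝓡 (2 * n + 1)))
      𝓘(ℝ, (ℝ × ℝ) × EuclideanSpace ℝ (Fin N)) ∞
      (fun q : (I × I) × V => (((q.1.1 : ℝ), (q.1.2 : ℝ)), ι q.2)) :=
    ((contMDiff_coe_I.comp (contMDiff_fst.comp contMDiff_fst)).prodMk_space
      (contMDiff_coe_I.comp (contMDiff_snd.comp contMDiff_fst))).prodMk_space
        (hι.smooth.comp contMDiff_snd)
  have hmem : ∀ q : (I × I) × V, (((q.1.1 : ℝ), (q.1.2 : ℝ)), ι q.2) ∈ S ×ˢ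
    (univ : Set (EuclideanSpace ℝ (Fin N))) := fun q => ⟨⟨q.1.1.2, q.1.2.2⟩, mem_univ _⟩
  set W : (I × I) × V → EuclideanSpace ℝ (Fin N) := fun q =>
    fderivWithin ℝ F (S ×ˢ univ) (((q.1.1 : ℝ), (q.1.2 : ℝ)), ι q.2) ((1, 0), 0) with hW
  have hWs : ContMDiff (((𝓡∂ 1).prod (𝓡∂ 1)).prod (𝓡 (2 * n + 1)))
      𝓘(ℝ, EuclideanSpace ℝ (Fin N)) ∞ W :=
    (hFd.clm_apply contDiffOn_const).contMDiffOn.comp_contMDiff hco hmem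
  have hWv : ∀ s t x, W ((s, t), x) = vd (2 * n + 1) ι (K (s, t) x)
      (velocity (fun s => K (s, t) x) s) := by
    intro s t x
    have h1 := hasDerivWithinAt_velocity
      (mdifferentiableAt_curve (Φ := fun s x => K (s, t) x)
        (contMDiff_slice_fst hK.smooth t) x s) hι.smooth
    have h2 : HasDerivWithinAt (fun τ : ℝ => ((τ, (t : ℝ)), ι x))
        (((1 : ℝ), (0 : ℝ)), (0 : EuclideanSpace ℝ (Fin N))) (Icc 0 1) (s : ℝ) :=
      ((hasDerivWithinAt_id _ _).prodMk (hasDerivWithinAt_const _ _ _)).prodMk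
        (hasDerivWithinAt_const _ _ _)
    have h3 := ((hFs _ (hmem ((s, t), x))).differentiableWithinAt (by simp)).hasFDerivWithinAt
    have h4 := h3.comp_hasDerivWithinAt (s : ℝ) h2
      (fun τ hτ => mk_mem_prod (mk_mem_prod hτ t.2) (mem_univ _))
    refine ((uniqueDiffOn_Icc zero_lt_one) _ s.2).eq_deriv _ h4 (h1.congr (fun τ hτ => ?_) ?_)
    · simp only [Function.comp_apply, hF, D.ext_apply, pI2, pI_coe]
    · simp only [Function.comp_apply, hF, D.ext_apply, pI2, pI_coe]
  set k : I × I → V → ℝ := fun p y => D.form α.form (ι y) (W (p, (K p)⁻¹ y)) with hk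
  have hks : ContMDiff (((𝓡∂ 1).prod (𝓡∂ 1)).prod (𝓡 (2 * n + 1))) 𝓘(ℝ, ℝ) ∞
      (fun q : (I × I) × V => k q.1 q.2) :=
    ContMDiff.clm_apply ((D.contDiff_form α.smooth).contMDiff.comp (hι.smooth.comp contMDiff_snd))
      (hWs.comp (contMDiff_fst.prodMk hK.smooth_inv))
  have hkX : ∀ s t x, α.form (K (s, t) x) (velocity (fun s => K (s, t) x) s)
      = k (s, t) (K (s, t) x) := by
    intro s t x
    have e : (K (s, t))⁻¹ (K (s, t) x) = x := by simp
    change _ = D.form α.form (ι (K (s, t) x)) (W ((s, t), (K (s, t))⁻¹ (K (s, t) x)))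
    rw [e, hWv, D.form_apply hι.smooth]
  refine ⟨k, hks, fun t s x => contactField_eq ⟨hkX s t x, ?_⟩⟩
  have hkp : ContMDiff (𝓡 (2 * n + 1)) 𝓘(ℝ, ℝ) ∞ (k (s, t)) :=
    hks.comp (contMDiff_const.prodMk contMDiff_id)
  have hsurj := surjective_mfderiv (hK.smooth_at (s, t)) (hK.smooth_inv_at (s, t)) x
  have hθ : ∀ v, α.form (K (s, t) x) v = 0 → extD α.form (K (s, t) x)
      (velocity (fun s => K (s, t) x) s) v + dFun (k (s, t)) (K (s, t) x) v = 0 := by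
    intro v hv
    obtain ⟨w, rfl⟩ := hsurj v
    have hw := (hK.preserves (s, t) x w).1 hv
    have h1 := D.hasDerivWithinAt_form hι.smooth (α := α) (Φ := fun s x => K (s, t) x)
      (contMDiff_slice_fst hK.smooth t) hkp
      (t := s) (hkX s t) x w
    refine ((uniqueDiffOn_Icc zero_lt_one) _ s.2).eq_deriv _ h1
      ((hasDerivWithinAt_const (s : ℝ) (Icc 0 1) (0 : ℝ)).congr (fun τ hτ => ?_) ?_)
    · exact (hK.preserves (pI τ, t) x w).2 hw
    · exact (hK.preserves (pI s, t) x w).2 hw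
  intro v
  obtain ⟨hR1, hR2⟩ := reeb_spec α (K (s, t) x)
  have h1 := hθ (v - α.form (K (s, t) x) v • reeb α (K (s, t) x)) (by
    rw [map_sub, map_smul, hR1, smul_eq_mul, mul_one, sub_self])
  rw [extD_sub_right, extD_smul_right, extD_skew _ _ _ (reeb α _), hR2, map_sub, map_smul,
    smul_eq_mul] at h1
  linarith

end Isotopies

/-! ### Isotopies, contact Hamiltonians and the order -/

section Isotopies

variable {n : ℕ} {V : Type*} [TopologicalSpace V]
  [ChartedSpace (EuclideanSpace ℝ (Fin (2 * n + 1))) V]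

theorem Ham.contMDiff_slice (h : Ham n V) (t : I) :
    ContMDiff (𝓡 (2 * n + 1)) 𝓘(ℝ, ℝ) ∞ (fun y => h (t, y)) :=
  h.contMDiff.comp (contMDiff_const.prodMk contMDiff_id)

theorem contMDiff_two_param (h : Ham n V) :
    ContMDiff (((𝓡∂ 1).prod (𝓡∂ 1)).prod (𝓡 (2 * n + 1))) 𝓘(ℝ, ℝ) ∞
      (fun q : (I × I) × V => h (q.1.1, q.2)) :=
  h.contMDiff.comp ((contMDiff_fst.comp contMDiff_fst).prodMk contMDiff_snd)

variable [IsManifold (𝓡 (2 * n + 1)) ∞ V] {α : ContactForm n V}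

theorem IsContactFamily.comp {E E' H H' : Type*} [NormedAddCommGroup E] [NormedSpace ℝ E]
    [TopologicalSpace H] {J : ModelWithCorners ℝ E H} {T : Type*} [TopologicalSpace T]
    [ChartedSpace H T] [NormedAddCommGroup E'] [NormedSpace ℝ E'] [TopologicalSpace H']
    {J' : ModelWithCorners ℝ E' H'} {T' : Type*} [TopologicalSpace T'] [ChartedSpace H' T']
    {K : T → Equiv.Perm V} (hK : IsContactFamily α J T K) {g : T' → T} (hg : ContMDiff J' J ∞ g) :
    IsContactFamily α J' T' (fun t => K (g t)) where
  smooth := hK.smooth.comp (f := fun p : T' × V => (g p.1, p.2))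
    ((hg.comp contMDiff_fst).prodMk contMDiff_snd)
  smooth_inv := hK.smooth_inv.comp (f := fun p : T' × V => (g p.1, p.2))
    ((hg.comp contMDiff_fst).prodMk contMDiff_snd)
  preserves t := hK.preserves (g t)

/-- Leibniz rule for the velocity of `t ↦ Φ t (c t)`. -/
theorem velocity_comp [T2Space V] [CompactSpace V] {Φ : I → V → V}
    (hΦ : ContMDiff ((𝓡∂ 1).prod (𝓡 (2 * n + 1))) (𝓡 (2 * n + 1)) ∞ (fun p : I × V => Φ p.1 p.2))
    {c : I → V} (hc : ContMDiff (𝓡∂ 1) (𝓡 (2 * n + 1)) ∞ c) (t : I) :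
    velocity (d := 2 * n + 1) (fun s => Φ s (c s)) t
      = velocity (d := 2 * n + 1) (fun s => Φ s (c t)) t
        + mfderiv (𝓡 (2 * n + 1)) (𝓡 (2 * n + 1)) (Φ t) (c t) (velocity c t) := by
  obtain ⟨N, ι, hι⟩ := exists_isEmb (d := 2 * n + 1) V
  obtain ⟨D⟩ := hι.nonempty_retractData
  have h1 : ContMDiff (𝓡∂ 1) (𝓡 (2 * n + 1)) ∞ (fun s => Φ s (c s)) :=
    hΦ.comp (contMDiff_id.prodMk hc)
  exact hι.velocity_eq (h1.mdifferentiable (by simp) t)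
    (D.hasDerivWithinAt_comp hι.smooth hΦ (hc.mdifferentiable (by simp) t))

theorem contMDiff_curve (Φ : ContactIsotopy α) (x : V) :
    ContMDiff (𝓡∂ 1) (𝓡 (2 * n + 1)) ∞ (fun t => Φ.1 t x) :=
  Φ.2.1.smooth.comp (contMDiff_id.prodMk (contMDiff_const (c := x)))

theorem Generates.velocity_eq {h : Ham n V} {Φ : ContactIsotopy α} (hΦ : Generates α h Φ) (t : I)
    (x : V) : velocity (d := 2 * n + 1) (fun s => Φ.1 s x) t
      = contactField α (fun y => h (t, y)) (Φ.1 t x) := hΦ t x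

/-- A bounded, uniformly Lipschitz extension of time-dependent contact vector fields to the ambient
space. -/
theorem RetractData.exists_ambient_field {E : Type*} [NormedAddCommGroup E] [NormedSpace ℝ E]
    [FiniteDimensional ℝ E] {ι : V → E} (D : RetractData (2 * n + 1) ι)
    (hι : ContMDiff (𝓡 (2 * n + 1)) 𝓘(ℝ, E) ∞ ι) (α : ContactForm n V) {k : I × I → V → ℝ}
    (hk : ContMDiff (((𝓡∂ 1).prod (𝓡∂ 1)).prod (𝓡 (2 * n + 1))) 𝓘(ℝ, ℝ) ∞
      (fun q : (I × I) × V => k q.1 q.2)) :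
    ∃ (Z : ℝ → E → E) (κ L : NNReal), (∀ t ∈ Icc (0 : ℝ) 1, LipschitzWith κ (Z t)) ∧
      (∀ t ∈ Icc (0 : ℝ) 1, ∀ z, ‖Z t z‖ ≤ L) ∧
      ∀ (t : I) x, Z t (ι x) = vd (2 * n + 1) ι x (contactField α (k (t, 0)) x) := by
  set Z : (ℝ × ℝ) × E → E := fun q =>
    D.ext (fun x => vd (2 * n + 1) ι x (contactField α (k (pI2 q.1)) x)) q.2 with hZ
  have hZs : ContDiffOn ℝ ∞ Z ((Icc 0 1 ×ˢ Icc 0 1) ×ˢ univ) :=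
    D.contDiffOn_ext (f := fun p x => vd (2 * n + 1) ι x (contactField α (k p) x))
      (contMDiff_contactField α D hι hk) contMDiffOn_pI2
  obtain ⟨R, hR⟩ := D.exists_ext_eq_zero (F := E)
  have hZR : ∀ p ∈ Icc (0 : ℝ) 1 ×ˢ Icc (0 : ℝ) 1, ∀ z, R ≤ ‖z‖ → Z (p, z) = 0 :=
    fun p _ z hz => hR _ z hz
  obtain ⟨⟨κ, hκ⟩, L, hL⟩ := exists_lipschitz_of_vanish isCompact_sq uniqueDiffOn_sq hZs hZR
  refine ⟨fun t z => Z ((t, 0), z), κ, L, fun t ht => hκ (t, 0) ⟨ht, by simp⟩,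
    fun t ht => hL (t, 0) ⟨ht, by simp⟩, fun t x => ?_⟩
  simp only [hZ, pI2, pI_coe, pI_zero, D.ext_apply]

variable [T2Space V] [CompactSpace V]

/-- Every contact Hamiltonian on a closed manifold generates a contact isotopy. -/
theorem exists_generates (α : ContactForm n V) (h : Ham n V) :
    ∃ Φ : ContactIsotopy α, Generates α h Φ := by
  obtain ⟨K, hK, h0, hint⟩ := exists_contactFamily α (k := fun p x => h (p.1, x))
    (contMDiff_two_param h)
  refine ⟨⟨fun s => K (s, 0), hK.comp (contMDiff_id.prodMk contMDiff_const), h0 0⟩, ?_⟩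
  exact generates_iff.2 (hint 0)

/-- Every contact isotopy is generated by a contact Hamiltonian. -/
theorem exists_ham (Φ : ContactIsotopy α) : ∃ h : Ham n V, Generates α h Φ := by
  obtain ⟨k, hk, hint⟩ := exists_integrates (K := fun p => Φ.1 p.1) (Φ.2.1.comp contMDiff_fst)
  refine ⟨⟨fun q => k (q.1, 0) q.2, hk.comp (f := fun q : I × V => ((q.1, (0 : I)), q.2))
    ((contMDiff_fst.prodMk contMDiff_const).prodMk contMDiff_snd)⟩, ?_⟩
  exact generates_iff.2 (hint 0)

theorem Generates.unique {h : Ham n V} {Φ Ψ : ContactIsotopy α} (hΦ : Generates α h Φ)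
    (hΨ : Generates α h Ψ) : Φ = Ψ := by
  obtain ⟨N, ι, hι⟩ := exists_isEmb (d := 2 * n + 1) V
  obtain ⟨D⟩ := hι.nonempty_retractData
  obtain ⟨Z, κ, -, hκ, -, hZ⟩ := D.exists_ambient_field hι.smooth α
    (k := fun p x => h (p.1, x)) (contMDiff_two_param h)
  have key : ∀ (Φ : ContactIsotopy α), Generates α h Φ → ∀ x, ∀ t ∈ Icc (0 : ℝ) 1,
      HasDerivWithinAt (fun τ => ι (Φ.1 (pI τ) x)) (Z t (ι (Φ.1 (pI t) x))) (Icc 0 1) t := by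
    intro Φ hΦ x t ht
    have h1 := hasDerivWithinAt_velocity
      ((contMDiff_curve Φ x).mdifferentiable (by simp) (pI t)) hι.smooth
    rw [hΦ.velocity_eq] at h1
    rw [← coe_pI ht, hZ, coe_pI ht]
    rwa [coe_pI ht] at h1
  have hΦΨ : ∀ t x, Φ.1 t x = Ψ.1 t x := fun t x => by
    have := eqOn_of_lipschitz hκ (key Φ hΦ x) (key Ψ hΨ x)
      (by simp [pI_zero, Φ.2.2, Ψ.2.2]) t.2
    simp only [pI_coe] at this
    exact hι.emb.injective this
  exact Subtype.ext (funext fun t => Equiv.ext fun x => hΦΨ t x)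

/-- The isotopy chosen in the definition of `lift` may be replaced by any isotopy generated by
`h`, since it is unique. -/
theorem lift_eq {h : Ham n V} {Φ : ContactIsotopy α} (hΦ : Generates α h Φ) :
    lift α h = (Φ : (homotopyCon α).Quotient) := by
  have h1 : Generates α h (flow α h) := Classical.epsilon_spec ⟨Φ, hΦ⟩
  rw [lift, h1.unique hΦ]

theorem exists_lift_eq (a : UnivCont α) : ∃ h : Ham n V, lift α h = a := by
  induction a using Con.induction_on with
  | _ Φ =>
    obtain ⟨h, hh⟩ := exists_ham Φ
    exact ⟨h, lift_eq hh⟩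

/-- The sign of `α(dΦ_t w)` does not depend on `t`: it can only vanish identically. -/
theorem nonneg_of_nonneg_mfderiv (Φ : ContactIsotopy α) (t : I) (x : V)
    (w : TangentSpace (𝓡 (2 * n + 1)) x)
    (hw : 0 ≤ α.form (Φ.1 t x) (mfderiv (𝓡 (2 * n + 1)) (𝓡 (2 * n + 1)) (Φ.1 t) x w)) :
    0 ≤ α.form x w := by
  obtain ⟨N, ι, hι⟩ := exists_isEmb (d := 2 * n + 1) V
  obtain ⟨D⟩ := hι.nonempty_retractData
  obtain ⟨h, hh⟩ := exists_ham Φ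
  set f : ℝ → ℝ := fun τ =>
    α.form (Φ.1 (pI τ) x) (mfderiv (𝓡 (2 * n + 1)) (𝓡 (2 * n + 1)) (Φ.1 (pI τ)) x w) with hf
  have hfc : ContinuousOn f (Icc 0 1) := fun τ hτ => by
    have h1 := D.hasDerivWithinAt_form hι.smooth (α := α) (Φ := fun s x => Φ.1 s x) Φ.2.1.smooth
      (h.contMDiff_slice (pI τ)) (t := pI τ)
      (fun x => by rw [hh.velocity_eq]; exact (contactField_spec α _ _).1) x w
    rw [coe_pI hτ] at h1
    exact h1.continuousWithinAt
  have hf0 : f 0 = α.form x w := by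
    change α.form (Φ.1 (pI 0) x) (mfderiv (𝓡 (2 * n + 1)) (𝓡 (2 * n + 1)) (Φ.1 (pI 0)) x w) = _
    rw [pI_zero, Φ.2.2]
    have : mfderiv (𝓡 (2 * n + 1)) (𝓡 (2 * n + 1)) ((1 : Equiv.Perm V) : V → V) x
      = ContinuousLinearMap.id ℝ _ := mfderiv_id
    rw [this]; rfl
  have hft : 0 ≤ f t := by
    change 0 ≤ α.form (Φ.1 (pI t) x) (mfderiv (𝓡 (2 * n + 1)) (𝓡 (2 * n + 1)) (Φ.1 (pI t)) x w)
    rwa [pI_coe]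
  by_contra hneg
  rw [← hf0] at hneg
  obtain ⟨τ, hτ, hτ0⟩ := intermediate_value_Icc t.2.1
    (hfc.mono (Icc_subset_Icc_right t.2.2)) ⟨(not_le.1 hneg).le, hft⟩
  have h2 := (Φ.2.1.preserves (pI τ) x w).1 hτ0
  rw [hf0, h2] at hneg
  exact hneg le_rfl

/-- If `Φ` is generated by `h` and `Φ Θ` by `g ≥ h`, then `Θ` is generated by a nonnegative
Hamiltonian: `dΦ_t` maps the field of `Θ` to the difference of the fields of `Φ Θ` and `Φ`, and does
not change the sign of `α`. -/
theorem Generates.nonneg_right {h g f : Ham n V} {Φ Θ : ContactIsotopy α} (hΦ : Generates α h Φ)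
    (hΦΘ : Generates α g (Φ * Θ)) (hΘ : Generates α f Θ) (hle : ∀ p, h p ≤ g p) (p : I × V) :
    0 ≤ f p := by
  obtain ⟨t, y⟩ := p
  set x := (Θ.1 t)⁻¹ y with hx
  have hy : Θ.1 t x = y := by simp [hx]
  have h1 := velocity_comp (Φ := fun s x => Φ.1 s x) Φ.2.1.smooth (contMDiff_curve Θ x) t
  have h2 : velocity (d := 2 * n + 1) (fun s => Φ.1 s (Θ.1 s x)) t
    = contactField α (fun y => g (t, y)) (Φ.1 t (Θ.1 t x)) := hΦΘ t x
  rw [h2, hΦ.velocity_eq, hΘ.velocity_eq] at h1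
  have h5 := congrArg (α.form (Φ.1 t (Θ.1 t x))) h1
  rw [map_add, (contactField_spec α _ _).1, (contactField_spec α _ _).1] at h5
  have h6 := hle (t, Φ.1 t (Θ.1 t x))
  have h7 := nonneg_of_nonneg_mfderiv Φ t (Θ.1 t x) (contactField α (fun y => f (t, y)) (Θ.1 t x))
    (by linarith)
  rw [(contactField_spec α _ _).1, hy] at h7
  exact h7

/-- The order on contact Hamiltonians is compatible with the order on the universal cover. -/
theorem prec_of_le {h g : Ham n V} (hle : ∀ p, h p ≤ g p) : Prec α (lift α h) (lift α g) := by
  obtain ⟨Φ, hΦ⟩ := exists_generates α h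
  obtain ⟨Ψ, hΨ⟩ := exists_generates α g
  obtain ⟨f, hf⟩ := exists_ham (Φ⁻¹ * Ψ)
  refine ⟨f, hΦ.nonneg_right (by rwa [mul_inv_cancel_left]) hf hle, ?_⟩
  rw [lift_eq hΦ, lift_eq hΨ, lift_eq hf]
  rfl

end Isotopies

/-! ### The infinitesimal reduction -/

section Reduction

variable {n m k : ℕ} {V : Type*} [TopologicalSpace V]
  [ChartedSpace (EuclideanSpace ℝ (Fin (2 * n + 1))) V] [IsManifold (𝓡 (2 * n + 1)) ∞ V]
  {W : Type*} [TopologicalSpace W]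
  [ChartedSpace (EuclideanSpace ℝ (Fin (2 * m + 1))) W] [IsManifold (𝓡 (2 * m + 1)) ∞ W]
  {Y : Set V} [ChartedSpace (EuclideanSpace ℝ (Fin k)) Y]

/-- The infinitesimal data of the reduction of `V` along `Y`: `Y` is closed and its inclusion is an
immersion, `ρ` is a submersion, `ρ^* β = α|_Y`, and `TY` contains the Reeb field and the vectors
of `ξ` which are `dα`-orthogonal to `TY`. -/
structure IsReduction (k : ℕ) [ChartedSpace (EuclideanSpace ℝ (Fin k)) Y] (α : ContactForm n V)
    (β : ContactForm m W) (ρ : Y → W) : Prop where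
  isClosed : IsClosed Y
  smooth_incl : ContMDiff (𝓡 k) (𝓡 (2 * n + 1)) ∞ (Subtype.val : Y → V)
  inj_incl : ∀ y : Y, Function.Injective (inclD (n := n) (k := k) y)
  smooth : ContMDiff (𝓡 k) (𝓡 (2 * m + 1)) ∞ ρ
  submersion : ∀ y, Function.Surjective (mfderiv (𝓡 k) (𝓡 (2 * m + 1)) ρ y)
  pull : ∀ (y : Y) (v : TangentSpace (𝓡 k) y),
    β.form (ρ y) (mfderiv (𝓡 k) (𝓡 (2 * m + 1)) ρ y v) = α.form (y : V) (inclD (n := n) y v)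
  coisotropic : ∀ (y : Y) (X : TangentSpace (𝓡 (2 * n + 1)) (y : V)), α.form y X = 0 →
    (∀ z : TangentSpace (𝓡 k) y, extD α.form y X (inclD (n := n) y z) = 0) →
    ∃ v : TangentSpace (𝓡 k) y, inclD (n := n) y v = X
  reeb_mem : ∀ y : Y, ∃ r : TangentSpace (𝓡 k) y, inclD (n := n) y r = reeb α y

/-- In the charts of the immersion, a linear projection of the codomain is a left inverse. -/
theorem injective_mfderiv_of_isImmersionAt {d e : ℕ} {M N : Type*} [TopologicalSpace M]
    [ChartedSpace (EuclideanSpace ℝ (Fin d)) M] [TopologicalSpace N]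
    [ChartedSpace (EuclideanSpace ℝ (Fin e)) N] {f : M → N} {x : M}
    (hf : IsImmersionAt (𝓡 d) (𝓡 e) ∞ f x) :
    Function.Injective (mfderiv (𝓡 d) (𝓡 e) f x) := by
  have hfs : MDifferentiableAt (𝓡 d) (𝓡 e) f x := hf.contMDiffAt.mdifferentiableAt (by simp)
  have hdom := hf.domChart_mem_maximalAtlas
  have hcod := hf.codChart_mem_maximalAtlas
  have hdm : hf.domChart.MDifferentiable (𝓡 d) (𝓡 d) :=
    ⟨(contMDiffOn_of_mem_maximalAtlas hdom).mdifferentiableOn (by simp),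
      (contMDiffOn_symm_of_mem_maximalAtlas hdom).mdifferentiableOn (by simp)⟩
  have hinj := hdm.mfderiv_injective hf.mem_domChart_source
  let L : EuclideanSpace ℝ (Fin e) →L[ℝ] EuclideanSpace ℝ (Fin d) :=
    (ContinuousLinearMap.fst ℝ _ _).comp
      (hf.equiv.symm : EuclideanSpace ℝ (Fin e) →L[ℝ] EuclideanSpace ℝ (Fin d) × hf.complement)
  have hc : MDifferentiableAt (𝓡 e) (𝓡 e) hf.codChart (f x) :=
    (contMDiffAt_of_mem_maximalAtlas hcod hf.mem_codChart_source).mdifferentiableAt (by simp)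
  have hL : MDifferentiableAt (𝓡 e) (𝓡 d) (L ∘ hf.codChart) (f x) :=
    L.differentiableAt.mdifferentiableAt.comp (f x) hc
  have heq : hf.domChart =ᶠ[𝓝 x] (L ∘ hf.codChart) ∘ f := by
    filter_upwards [hf.domChart.open_source.mem_nhds hf.mem_domChart_source] with z hz
    have h0 : hf.domChart z ∈ (hf.domChart.extend (𝓡 d)).target := by
      simpa using hf.domChart.map_source hz
    have h1 := hf.writtenInCharts h0
    have h2 : hf.codChart (f z) = hf.equiv (hf.domChart z, 0) := by
      simpa [hf.domChart.left_inv hz] using h1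
    simp [L, h2]
  rw [heq.mfderiv_eq, mfderiv_comp x hL hfs] at hinj
  exact Function.Injective.of_comp hinj

theorem IsSmoothFiberBundle.contMDiff {b f : ℕ} {M B F : Type*}
    [TopologicalSpace M] [ChartedSpace (EuclideanSpace ℝ (Fin k)) M]
    [TopologicalSpace B] [ChartedSpace (EuclideanSpace ℝ (Fin b)) B]
    [TopologicalSpace F] [ChartedSpace (EuclideanSpace ℝ (Fin f)) F] {ρ : M → B}
    (hρ : IsSmoothFiberBundle (k := k) (b := b) (f := f) F ρ) : ContMDiff (𝓡 k) (𝓡 b) ∞ ρ := by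
  intro y
  obtain ⟨e, he, hes, -⟩ := hρ (ρ y)
  have hy : y ∈ e.source := e.mem_source.2 he
  refine ((contMDiff_fst.comp_contMDiffOn hes).contMDiffAt
    (e.open_source.mem_nhds hy)).congr_of_eventuallyEq ?_
  filter_upwards [e.open_source.mem_nhds hy] with z hz using (e.coe_fst hz).symm

/-- The projection of a smooth fiber bundle is a submersion: it has local sections through every
point. -/
theorem IsSmoothFiberBundle.surjective_mfderiv {b f : ℕ} {M B F : Type*}
    [TopologicalSpace M] [ChartedSpace (EuclideanSpace ℝ (Fin k)) M]
    [TopologicalSpace B] [ChartedSpace (EuclideanSpace ℝ (Fin b)) B]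
    [TopologicalSpace F] [ChartedSpace (EuclideanSpace ℝ (Fin f)) F] {ρ : M → B}
    (hρ : IsSmoothFiberBundle (k := k) (b := b) (f := f) F ρ) (y : M) :
    Function.Surjective (mfderiv (𝓡 k) (𝓡 b) ρ y) := by
  have hs := hρ.contMDiff
  obtain ⟨e, he, hes, hes'⟩ := hρ (ρ y)
  have hy : y ∈ e.source := e.mem_source.2 he
  have hey : e y = (ρ y, (e y).2) := Prod.ext (e.coe_fst hy) rfl
  set sec : B → M := fun x => e.toOpenPartialHomeomorph.symm (x, (e y).2) with hsec
  have hsecy : sec (ρ y) = y := by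
    simp only [hsec]; rw [← hey]; exact e.toOpenPartialHomeomorph.left_inv hy
  have htgt : (ρ y, (e y).2) ∈ e.target := e.mem_target.2 he
  have hsecs : MDifferentiableAt (𝓡 b) (𝓡 k) sec (ρ y) :=
    ((hes'.contMDiffAt (e.open_target.mem_nhds htgt)).comp (ρ y)
      (contMDiffAt_id.prodMk contMDiffAt_const)).mdifferentiableAt (by simp)
  have heq : ρ ∘ sec =ᶠ[𝓝 (ρ y)] id := by
    filter_upwards [e.open_baseSet.mem_nhds he] with x hx
    exact e.proj_symm_apply (e.mem_target.2 hx)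
  have h1 := mfderiv_comp (ρ y) (hs.mdifferentiable (by simp) (sec (ρ y))) hsecs
  rw [heq.mfderiv_eq, mfderiv_id] at h1
  have key : Function.Surjective (mfderiv (𝓡 k) (𝓡 b) ρ (sec (ρ y))) := fun w =>
    ⟨_, (congrArg (fun l => l w) h1).symm⟩
  exact hsecy ▸ key

theorem isReduction [IsManifold (𝓡 k) ∞ Y] {α : ContactForm n V} {β : ContactForm m W}
    (hY : IsStrictlyCoisotropic α k Y) {f : ℕ} {F : Type*} [TopologicalSpace F]
    [ChartedSpace (EuclideanSpace ℝ (Fin f)) F] {ρ : Y → W}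
    (hρ : IsSmoothFiberBundle (k := k) (b := 2 * m + 1) (f := f) F ρ)
    (hpull : ∀ (y : Y) (v : TangentSpace (𝓡 k) y),
      β.form (ρ y) (mfderiv (𝓡 k) (𝓡 (2 * m + 1)) ρ y v) = α.form (y : V) (inclD (n := n) y v)) :
    IsReduction k α β ρ where
  isClosed := hY.isClosed
  smooth_incl := hY.embedding.contMDiff
  inj_incl y := injective_mfderiv_of_isImmersionAt (hY.embedding.isImmersion.isImmersionAt y)
  smooth := hρ.contMDiff
  submersion := hρ.surjective_mfderiv
  pull := hpull
  coisotropic y X hX h := hY.coisotropic y X hX (by rintro _ ⟨z, rfl⟩ -; exact h z)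
  reeb_mem := hY.reeb_mem

namespace IsReduction

variable {α : ContactForm n V} {β : ContactForm m W} {ρ : Y → W}

theorem isEmb {E : Type*} [NormedAddCommGroup E] [NormedSpace ℝ E] {ι : V → E}
    (R : IsReduction k α β ρ) (hι : IsEmb (2 * n + 1) ι) : IsEmb k (fun y : Y => ι y) where
  smooth := hι.smooth.comp R.smooth_incl
  emb := hι.emb.comp IsEmbedding.subtypeVal
  inj y := by
    have h := mfderiv_comp y (hι.smooth.mdifferentiable (by simp) (y : V))
      (R.smooth_incl.mdifferentiable (by simp) y)
    have h2 : vd k (fun y : Y => ι y) y = (vd (2 * n + 1) ι y).comp (inclD (n := n) y) := h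
    rw [h2]
    exact (hι.inj y).comp (R.inj_incl y)

theorem vd_incl {E : Type*} [NormedAddCommGroup E] [NormedSpace ℝ E] {f : V → E}
    (R : IsReduction k α β ρ) (hf : ContMDiff (𝓡 (2 * n + 1)) 𝓘(ℝ, E) ∞ f) (y : Y)
    (v : TangentSpace (𝓡 k) y) :
    vd k (fun y : Y => f y) y v = vd (2 * n + 1) f y (inclD (n := n) y v) :=
  congrArg (fun l => l v) (mfderiv_comp y (hf.mdifferentiable (by simp) (y : V))
      (R.smooth_incl.mdifferentiable (by simp) y))

theorem vd_proj {E : Type*} [NormedAddCommGroup E] [NormedSpace ℝ E] {f : W → E}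
    (R : IsReduction k α β ρ) (hf : ContMDiff (𝓡 (2 * m + 1)) 𝓘(ℝ, E) ∞ f) (y : Y)
    (v : TangentSpace (𝓡 k) y) :
    vd k (fun y : Y => f (ρ y)) y v
      = vd (2 * m + 1) f (ρ y) (mfderiv (𝓡 k) (𝓡 (2 * m + 1)) ρ y v) :=
  congrArg (fun l => l v) (mfderiv_comp y (hf.mdifferentiable (by simp) (ρ y))
      (R.smooth.mdifferentiable (by simp) y))

theorem contMDiff_curve_sub [T2Space V] [CompactSpace V] [IsManifold (𝓡 k) ∞ Y]
    (R : IsReduction k α β ρ) (Φ : ContactIsotopy α) {x : V} {c : I → Y}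
    (hc : ∀ t, (c t : V) = Φ.1 t x) : ContMDiff (𝓡∂ 1) (𝓡 k) ∞ c := by
  obtain ⟨N, ι, hι⟩ := exists_isEmb (d := 2 * n + 1) V
  refine (R.isEmb hι).contMDiff_of_comp ?_
  simp only [hc]
  exact hι.smooth.comp (contMDiff_curve Φ x)

theorem inclD_velocity (R : IsReduction k α β ρ) {c : I → Y} (hc : ContMDiff (𝓡∂ 1) (𝓡 k) ∞ c)
    (t : I) : inclD (n := n) (k := k) (c t) (velocity (d := k) c t)
      = velocity (d := 2 * n + 1) (fun s => (c s : V)) t :=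
  (congrArg (fun l => l 1) (mfderiv_comp t (R.smooth_incl.mdifferentiable (by simp) (c t))
    (hc.mdifferentiable (by simp) t))).symm

theorem mfderiv_velocity (R : IsReduction k α β ρ) {c : I → Y} (hc : ContMDiff (𝓡∂ 1) (𝓡 k) ∞ c)
    (t : I) : mfderiv (𝓡 k) (𝓡 (2 * m + 1)) ρ (c t) (velocity (d := k) c t)
      = velocity (d := 2 * m + 1) (fun s => ρ (c s)) t :=
  (congrArg (fun l => l 1) (mfderiv_comp t (R.smooth.mdifferentiable (by simp) (c t))
    (hc.mdifferentiable (by simp) t))).symm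

/-- `ρ^* dβ = dα|_Y`: both are the exterior derivative of the one-form `ρ^* β = α|_Y` on `Y`. -/
theorem extD_eq [T2Space V] [CompactSpace V] [T2Space W] [CompactSpace W] [IsManifold (𝓡 k) ∞ Y]
    (R : IsReduction k α β ρ) (y : Y) (u v : TangentSpace (𝓡 k) y) :
    extD α.form (y : V) (inclD (n := n) y u) (inclD (n := n) y v)
      = extD β.form (ρ y) (mfderiv (𝓡 k) (𝓡 (2 * m + 1)) ρ y u)
        (mfderiv (𝓡 k) (𝓡 (2 * m + 1)) ρ y v) := by
  obtain ⟨N, ι, hι⟩ := exists_isEmb (d := 2 * n + 1) V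
  obtain ⟨D⟩ := hι.nonempty_retractData
  obtain ⟨N', j, hj⟩ := exists_isEmb (d := 2 * m + 1) W
  obtain ⟨D'⟩ := hj.nonempty_retractData
  set γ : ∀ y : Y, TangentSpace (𝓡 k) y →L[ℝ] ℝ := fun y =>
    (α.form (y : V)).comp (inclD (n := n) y) with hγ
  have h1 := extD_pullback (g := fun y : Y => ι y) (hι.smooth.comp R.smooth_incl)
    (D.contDiff_form α.smooth) (γ := γ)
    (fun y v => by rw [R.vd_incl hι.smooth, D.form_apply hι.smooth]; rfl) y u v
  have h2 := extD_pullback (g := fun y : Y => j (ρ y)) (hj.smooth.comp R.smooth)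
    (D'.contDiff_form β.smooth) (γ := γ)
    (fun y v => by rw [R.vd_proj hj.smooth, D'.form_apply hj.smooth, R.pull]; rfl) y u v
  rw [R.vd_incl hι.smooth, R.vd_incl hι.smooth, ← D.extD_eq α hι.smooth] at h1
  rw [R.vd_proj hj.smooth, R.vd_proj hj.smooth, ← D'.extD_eq β hj.smooth] at h2
  rw [← h1, h2]

/-- Along `Y`, the contact vector field of an extension of `hb` is tangent to `Y` and projects to
the contact vector field of `hb`. -/
theorem exists_tangent [T2Space V] [CompactSpace V] [T2Space W] [CompactSpace W]
    [IsManifold (𝓡 k) ∞ Y] (R : IsReduction k α β ρ) {h : V → ℝ} {hb : W → ℝ}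
    (hh : ContMDiff (𝓡 (2 * n + 1)) 𝓘(ℝ, ℝ) ∞ h) (hhb : ContMDiff (𝓡 (2 * m + 1)) 𝓘(ℝ, ℝ) ∞ hb)
    (hext : ∀ y : Y, h y = hb (ρ y)) (y : Y) :
    ∃ v : TangentSpace (𝓡 k) y, inclD (n := n) y v = contactField α h y ∧
      mfderiv (𝓡 k) (𝓡 (2 * m + 1)) ρ y v = contactField β hb (ρ y) := by
  set P := mfderiv (𝓡 k) (𝓡 (2 * m + 1)) ρ y with hP
  have hsurj : Function.Surjective P := R.submersion y
  have hpull : ∀ v, β.form (ρ y) (P v) = α.form (y : V) (inclD (n := n) y v) := R.pull y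
  have hextD : ∀ u v, extD α.form (y : V) (inclD (n := n) y u) (inclD (n := n) y v)
    = extD β.form (ρ y) (P u) (P v) := R.extD_eq y
  have hd : ∀ z, dFun h (y : V) (inclD (n := n) y z) = dFun hb (ρ y) (P z) := fun z => by
    have h1 := R.vd_incl hh y z
    have h2 := R.vd_proj hhb y z
    rw [show (fun y : Y => h y) = fun y => hb (ρ y) from funext hext, h2] at h1
    exact h1.symm
  obtain ⟨r, hr⟩ := R.reeb_mem y
  obtain ⟨hR1, hR2⟩ := reeb_spec α (y : V)
  have hPr : P r = reeb β (ρ y) := by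
    rw [reeb_eq_contactField]
    refine contactField_eq ⟨by rw [hpull, hr, hR1], fun w => ?_⟩
    obtain ⟨z, rfl⟩ := hsurj w
    rw [← hextD, hr, hR2, dFun_const]
    simp
  -- `v` projects to the contact vector of `hb`; its difference with the contact vector of `h` is
  -- skew-orthogonal to `TY ∩ ξ`, hence tangent to `Y`, and its projection `P ν` is zero
  obtain ⟨v, hv⟩ := hsurj (contactField β hb (ρ y))
  obtain ⟨hX1, hX2⟩ := contactField_spec α h (y : V)
  obtain ⟨hB1, hB2⟩ := contactField_spec β hb (ρ y)
  have hsubl : ∀ (a b c : TangentSpace (𝓡 (2 * n + 1)) (y : V)),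
      extD α.form (y : V) (a - b) c = extD α.form (y : V) a c - extD α.form (y : V) b c := by
    intro a b c
    rw [extD_skew, extD_sub_right, extD_skew _ _ a, extD_skew _ _ b]; ring
  have hα0 : α.form (y : V) (contactField α h y - inclD (n := n) y v) = 0 := by
    rw [map_sub, ← hpull, hv, hX1, hB1, hext, sub_self]
  have hperp : ∀ z : TangentSpace (𝓡 k) y,
      extD α.form (y : V) (contactField α h y - inclD (n := n) y v) (inclD (n := n) y z) = 0 := by
    intro z
    rw [hsubl, hextD, hv, hX2, hB2, hd, ← hr, hd, hPr, hpull, sub_self]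
  obtain ⟨ν, hν⟩ := R.coisotropic y _ hα0 hperp
  have hPν : P ν = 0 := by
    refine β.nondegenerate (ρ y) (P ν) (by rw [hpull, hν, hα0]) fun w _ => ?_
    obtain ⟨z, rfl⟩ := hsurj w
    rw [← hextD, hν, hperp]
  refine ⟨v + ν, ?_, by rw [map_add, hv, hPν, add_zero]⟩
  rw [map_add, hν]
  abel

end IsReduction

end Reduction

/-! ### Isotopies covering isotopies of the base -/

section Covering

variable {V W : Type*} {Y : Set V}

/-- The bijection `φ` of `V` preserves `Y` and induces `φb` on the base of `ρ : Y → W`. -/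
def Covers (ρ : Y → W) (φ : Equiv.Perm V) (φb : Equiv.Perm W) : Prop :=
  (∀ y : Y, ∃ y' : Y, (y' : V) = φ y ∧ ρ y' = φb (ρ y)) ∧
    ∀ y : Y, ∃ y' : Y, (y' : V) = φ⁻¹ y ∧ ρ y' = φb⁻¹ (ρ y)

theorem Covers.one (ρ : Y → W) : Covers ρ 1 1 :=
  ⟨fun y => ⟨y, rfl, rfl⟩, fun y => ⟨y, by simp, by simp⟩⟩

theorem Covers.inv {ρ : Y → W} {φ : Equiv.Perm V} {φb : Equiv.Perm W} (h : Covers ρ φ φb) :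
    Covers ρ φ⁻¹ φb⁻¹ := ⟨h.2, by simpa using h.1⟩

theorem Covers.mul {ρ : Y → W} {φ ψ : Equiv.Perm V} {φb ψb : Equiv.Perm W} (h : Covers ρ φ φb)
    (h' : Covers ρ ψ ψb) : Covers ρ (φ * ψ) (φb * ψb) := by
  refine ⟨fun y => ?_, fun y => ?_⟩
  · obtain ⟨y', h1, h2⟩ := h'.1 y
    obtain ⟨y'', h3, h4⟩ := h.1 y'
    exact ⟨y'', by rw [h3, h1]; rfl, by rw [h4, h2]; rfl⟩
  · obtain ⟨y', h1, h2⟩ := h.2 y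
    obtain ⟨y'', h3, h4⟩ := h'.2 y'
    exact ⟨y'', by rw [h3, h1, mul_inv_rev]; rfl, by rw [h4, h2, mul_inv_rev]; rfl⟩

theorem Covers.of_maps {ρ : Y → W} {φ : Equiv.Perm V} {φb : Equiv.Perm W}
    (h1 : ∀ y : Y, ∃ y' : Y, (y' : V) = φ y ∧ ρ y' = φb (ρ y))
    (h2 : ∀ y : Y, ∃ y' : Y, (y' : V) = φ⁻¹ y) : Covers ρ φ φb := by
  refine ⟨h1, fun y => ?_⟩
  obtain ⟨y', hy'⟩ := h2 y
  obtain ⟨y'', h3, h4⟩ := h1 y'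
  have : y'' = y := Subtype.ext (by rw [h3, hy']; simp)
  exact ⟨y', hy', by rw [← this, h4]; simp⟩

end Covering

theorem hasDerivWithinAt_reverse {E : Type*} [NormedAddCommGroup E] [NormedSpace ℝ E] {u : ℝ → E}
    {u' : ℝ → E} (hu : ∀ t ∈ Icc (0 : ℝ) 1, HasDerivWithinAt u (u' t) (Icc 0 1) t) {s : ℝ}
    (hs : s ∈ Icc (0 : ℝ) 1) {τ : ℝ} (hτ : τ ∈ Icc (0 : ℝ) 1) :
    HasDerivWithinAt (fun τ => u (s - s * τ)) (-s • u' (s - s * τ)) (Icc 0 1) τ := by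
  have hmaps : MapsTo (fun τ : ℝ => s - s * τ) (Icc 0 1) (Icc 0 1) := fun τ hτ =>
    ⟨by nlinarith [hs.1, hτ.2], by nlinarith [hs.1, hs.2, hτ.1]⟩
  have h1 : HasDerivWithinAt (fun τ : ℝ => s - s * τ) (-s) (Icc 0 1) τ := by
    have := ((hasDerivWithinAt_id τ (Icc (0 : ℝ) 1)).const_mul s).const_sub s
    simpa using this
  exact (hu _ (hmaps hτ)).scomp τ h1 hmaps

section Reduction

variable {n m k : ℕ} {V : Type*} [TopologicalSpace V] [T2Space V] [CompactSpace V]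
  [ChartedSpace (EuclideanSpace ℝ (Fin (2 * n + 1))) V] [IsManifold (𝓡 (2 * n + 1)) ∞ V]
  {W : Type*} [TopologicalSpace W]
  [ChartedSpace (EuclideanSpace ℝ (Fin (2 * m + 1))) W] [IsManifold (𝓡 (2 * m + 1)) ∞ W]
  {Y : Set V} [ChartedSpace (EuclideanSpace ℝ (Fin k)) Y] [IsManifold (𝓡 k) ∞ Y]
  {α : ContactForm n V} {β : ContactForm m W} {ρ : Y → W}

namespace IsReduction

/-- If the isotopy generated by `h` covers the one generated by `hb`, then `h` extends `hb`. -/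
theorem isExtension_of_covers (R : IsReduction k α β ρ) {h : Ham n V} {hb : Ham m W}
    {Φ : ContactIsotopy α} {Φb : ContactIsotopy β} (hΦ : Generates α h Φ)
    (hΦb : Generates β hb Φb) (hcov : ∀ t, Covers ρ (Φ.1 t) (Φb.1 t)) : IsExtension ρ hb h := by
  intro t y
  obtain ⟨y₀, hy₀, -⟩ := (hcov t).2 y
  choose c hc1 hc2 using fun s => (hcov s).1 y₀
  have hc : ContMDiff (𝓡∂ 1) (𝓡 k) ∞ c := R.contMDiff_curve_sub Φ hc1
  have hct : c t = y := Subtype.ext (by rw [hc1, hy₀]; simp)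
  have h1 := R.pull (c t) (velocity (d := k) c t)
  rw [R.inclD_velocity hc, R.mfderiv_velocity hc] at h1
  have h2 : ∀ g : I → V, g = (fun s => Φ.1 s y₀) →
      α.form (g t) (velocity (d := 2 * n + 1) g t) = h (t, g t) := by
    rintro _ rfl
    rw [hΦ.velocity_eq]
    exact (contactField_spec α (fun y => h (t, y)) (Φ.1 t y₀)).1
  have h3 : ∀ g : I → W, g = (fun s => Φb.1 s (ρ y₀)) →
      β.form (g t) (velocity (d := 2 * m + 1) g t) = hb (t, g t) := by
    rintro _ rfl
    rw [hΦb.velocity_eq]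
    exact (contactField_spec β (fun y => hb (t, y)) (Φb.1 t (ρ y₀))).1
  rw [← hct, ← h2 (fun s => (c s : V)) (funext hc1), ← h3 (fun s => ρ (c s)) (funext hc2), h1]

variable [T2Space W] [CompactSpace W]

/-- The isotopy generated by an extension preserves `Y`. -/
theorem mem_of_generates (R : IsReduction k α β ρ) {h : Ham n V} {hb : Ham m W}
    {Φ : ContactIsotopy α} (hΦ : Generates α h Φ) (hext : IsExtension ρ hb h) (t : I) {x : V}
    (hx : x ∈ Y) : Φ.1 t x ∈ Y ∧ (Φ.1 t)⁻¹ x ∈ Y := by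
  obtain ⟨N, ι, hι⟩ := exists_isEmb (d := 2 * n + 1) V
  obtain ⟨D⟩ := hι.nonempty_retractData
  have hιY := R.isEmb hι
  have : CompactSpace Y := isCompact_iff_compactSpace.1 R.isClosed.isCompact
  obtain ⟨Z, κ, L, hκ, hL, hZ⟩ := D.exists_ambient_field hι.smooth α
    (k := fun p x => h (p.1, x)) (contMDiff_two_param h)
  have hran : ∀ s ∈ Icc (0 : ℝ) 1, ∀ y : Y, Z s (ι y) ∈ range (vd k (fun y : Y => ι y) y) := by
    intro s hs y
    obtain ⟨v, hv, -⟩ := R.exists_tangent (h.contMDiff_slice (pI s)) (hb.contMDiff_slice (pI s))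
      (hext (pI s)) y
    have h1 := hZ (pI s) (y : V)
    rw [coe_pI hs] at h1
    exact ⟨v, by rw [R.vd_incl hι.smooth, hv, h1]⟩
  have hmem : ∀ x : V, ι x ∈ range (fun y : Y => ι y) → x ∈ Y := by
    rintro x ⟨y, hy⟩
    exact hι.emb.injective hy ▸ y.2
  have hder : ∀ x, ∀ t ∈ Icc (0 : ℝ) 1,
      HasDerivWithinAt (fun τ => ι (Φ.1 (pI τ) x)) (Z t (ι (Φ.1 (pI t) x))) (Icc 0 1) t := by
    intro x t ht
    have h1 := hasDerivWithinAt_velocity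
      ((contMDiff_curve Φ x).mdifferentiable (by simp) (pI t)) hι.smooth
    rw [hΦ.velocity_eq] at h1
    rw [← coe_pI ht, hZ, coe_pI ht]
    rwa [coe_pI ht] at h1
  constructor
  · have h1 := hιY.invariant hκ hL hran (hder x) ⟨⟨x, hx⟩, by simp [pI_zero, Φ.2.2]⟩ t t.2
    simp only [pI_coe] at h1
    exact hmem _ h1
  -- for the inverse, the trajectory ending at `x` at time `t` is followed backwards
  · have hr : ∀ τ ∈ Icc (0 : ℝ) 1, (t - t * τ : ℝ) ∈ Icc (0 : ℝ) 1 := fun τ hτ =>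
      ⟨by nlinarith [t.2.1, hτ.2], by nlinarith [t.2.1, t.2.2, hτ.1]⟩
    have habs : ‖-(t : ℝ)‖ ≤ 1 := by
      rw [norm_neg, Real.norm_eq_abs, abs_of_nonneg t.2.1]; exact t.2.2
    have h1 := hιY.invariant (X := fun τ z => -(t : ℝ) • Z (t - t * τ) z) (K := κ) (L := L)
      (fun τ hτ => LipschitzWith.of_dist_le_mul fun a b => by
        rw [dist_eq_norm, ← smul_sub, norm_smul, ← dist_eq_norm]
        exact (mul_le_of_le_one_left dist_nonneg habs).trans ((hκ _ (hr τ hτ)).dist_le_mul a b))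
      (fun τ hτ z => by
        rw [norm_smul]
        exact (mul_le_of_le_one_left (norm_nonneg _) habs).trans (hL _ (hr τ hτ) z))
      (fun τ hτ y => by
        obtain ⟨v, hv⟩ := hran _ (hr τ hτ) y
        exact ⟨-(t : ℝ) • v, by rw [map_smul, hv]⟩)
      (fun τ hτ => hasDerivWithinAt_reverse (hder ((Φ.1 t)⁻¹ x)) t.2 hτ)
      ⟨⟨x, hx⟩, by simp [pI_coe]⟩ 1 (by simp)
    simp only [mul_one, sub_self, pI_zero, Φ.2.2] at h1
    exact hmem _ h1

/-- The isotopy generated by an extension of `hb` covers the isotopy generated by `hb`. -/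
theorem covers_of_isExtension (R : IsReduction k α β ρ) {h : Ham n V} {hb : Ham m W}
    {Φ : ContactIsotopy α} {Φb : ContactIsotopy β} (hΦ : Generates α h Φ)
    (hΦb : Generates β hb Φb) (hext : IsExtension ρ hb h) (t : I) : Covers ρ (Φ.1 t) (Φb.1 t) := by
  refine Covers.of_maps (fun y => ?_)
    fun y => ⟨⟨_, (R.mem_of_generates hΦ hext t y.2).2⟩, rfl⟩
  let c : I → Y := fun t => ⟨Φ.1 t y, (R.mem_of_generates hΦ hext t y.2).1⟩
  have hc : ContMDiff (𝓡∂ 1) (𝓡 k) ∞ c := R.contMDiff_curve_sub Φ (x := y) fun _ => rfl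
  refine ⟨c t, rfl, ?_⟩
  obtain ⟨N, j, hj⟩ := exists_isEmb (d := 2 * m + 1) W
  obtain ⟨D⟩ := hj.nonempty_retractData
  obtain ⟨Z, κ, -, hκ, -, hZ⟩ := D.exists_ambient_field hj.smooth β
    (k := fun p x => hb (p.1, x)) (contMDiff_two_param hb)
  -- the projected trajectory solves the equation of `Φb`
  have hv : ∀ s, velocity (d := 2 * m + 1) (fun s => ρ (c s)) s
      = contactField β (fun x => hb (s, x)) (ρ (c s)) := by
    intro s
    obtain ⟨v, hv1, hv2⟩ := R.exists_tangent (h.contMDiff_slice s) (hb.contMDiff_slice s)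
      (hext s) (c s)
    have h1 : velocity (d := k) c s = v := R.inj_incl (c s) (by
      rw [R.inclD_velocity hc, hv1]
      exact hΦ.velocity_eq s y)
    rw [← R.mfderiv_velocity hc, h1, hv2]
  have hder1 : ∀ t ∈ Icc (0 : ℝ) 1,
      HasDerivWithinAt (fun τ => j (ρ (c (pI τ)))) (Z t (j (ρ (c (pI t))))) (Icc 0 1) t := by
    intro t ht
    have h1 := hasDerivWithinAt_velocity
      ((R.smooth.comp hc).mdifferentiable (by simp) (pI t)) hj.smooth
    have h2 := hv (pI t)
    rw [show velocity (ρ ∘ c) (pI t) = _ from h2, coe_pI ht] at h1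
    have h3 := hZ (pI t) (ρ (c (pI t)))
    rw [coe_pI ht] at h3
    rw [h3]
    exact h1
  have hder2 : ∀ t ∈ Icc (0 : ℝ) 1, HasDerivWithinAt (fun τ => j (Φb.1 (pI τ) (ρ y)))
      (Z t (j (Φb.1 (pI t) (ρ y)))) (Icc 0 1) t := by
    intro t ht
    have h1 := hasDerivWithinAt_velocity
      ((contMDiff_curve Φb (ρ y)).mdifferentiable (by simp) (pI t)) hj.smooth
    rw [hΦb.velocity_eq] at h1
    rw [← coe_pI ht, hZ, coe_pI ht]
    rwa [coe_pI ht] at h1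
  have hc0 : c 0 = y := Subtype.ext (by simp [c, Φ.2.2])
  have := eqOn_of_lipschitz hκ hder1 hder2 (by simp [pI_zero, Φb.2.2, hc0]) t.2
  simp only [pI_coe] at this
  exact hj.emb.injective this

end IsReduction

end Reduction

/-! ### Lifting homotopies -/

section Ambient

variable {n m k : ℕ} {V : Type*} [TopologicalSpace V]
  [ChartedSpace (EuclideanSpace ℝ (Fin (2 * n + 1))) V] [IsManifold (𝓡 (2 * n + 1)) ∞ V]
  {W : Type*} [TopologicalSpace W]
  [ChartedSpace (EuclideanSpace ℝ (Fin (2 * m + 1))) W] [IsManifold (𝓡 (2 * m + 1)) ∞ W]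
  {Y : Set V} [ChartedSpace (EuclideanSpace ℝ (Fin k)) Y]
  {α : ContactForm n V} {β : ContactForm m W} {ρ : Y → W}

/-- The constant contact Hamiltonian. -/
def constHam (n : ℕ) (V : Type*) [TopologicalSpace V]
    [ChartedSpace (EuclideanSpace ℝ (Fin (2 * n + 1))) V] (c : ℝ) : Ham n V :=
  ⟨fun _ => c, contMDiff_const⟩

/-- The functions integrating to a constant family vanish. -/
theorem integrates_const {K : I → Equiv.Perm V} {φ : Equiv.Perm V} (hK : ∀ s, K s = φ)
    {k : I → V → ℝ} (h : Integrates α k K) (s : I) (x : V) : k s x = 0 := by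
  have h1 := h s (φ⁻¹ x)
  have h2 : (fun s => K s (φ⁻¹ x)) = fun _ => x := by ext s; simp [hK]
  have h3 : ∀ g : I → V, (g = fun _ => x) → velocity (d := 2 * n + 1) g s = 0 := by
    rintro _ rfl
    have h1 : mfderiv (𝓡∂ 1) (𝓡 (2 * n + 1)) (fun _ : I => x) s = 0 := mfderiv_const
    exact congrArg (fun l => l 1) h1
  have h4 := (contactField_spec α (k s) (K s (φ⁻¹ x))).1
  rw [← h1, h3 _ h2, map_zero] at h4
  rw [h4, hK]
  simp

/-- The isotopies `s ↦ K (s, t)` of a two-parameter family of contactomorphisms. -/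
def sliceIsotopy {K : I × I → Equiv.Perm V}
    (hK : IsContactFamily α ((𝓡∂ 1).prod (𝓡∂ 1)) (I × I) K) (h0 : ∀ t, K (0, t) = 1) (t : I) :
    ContactIsotopy α :=
  ⟨fun s => K (s, t), hK.comp (contMDiff_id.prodMk contMDiff_const), h0 t⟩

/-- A smooth two-parameter family of functions, restricted to a value of the second parameter. -/
def sliceHam {k : I × I → V → ℝ}
    (hk : ContMDiff (((𝓡∂ 1).prod (𝓡∂ 1)).prod (𝓡 (2 * n + 1))) 𝓘(ℝ, ℝ) ∞
      (fun q : (I × I) × V => k q.1 q.2)) (t : I) : Ham n V :=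
  ⟨fun q => k (q.1, t) q.2, hk.comp (f := fun q : I × V => ((q.1, t), q.2))
    ((contMDiff_fst.prodMk contMDiff_const).prodMk contMDiff_snd)⟩

theorem generates_slice {K : I × I → Equiv.Perm V}
    (hK : IsContactFamily α ((𝓡∂ 1).prod (𝓡∂ 1)) (I × I) K) (h0 : ∀ t, K (0, t) = 1)
    {k : I × I → V → ℝ} (hk : ContMDiff (((𝓡∂ 1).prod (𝓡∂ 1)).prod (𝓡 (2 * n + 1))) 𝓘(ℝ, ℝ) ∞
      (fun q : (I × I) × V => k q.1 q.2)) {t : I}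
    (h : Integrates α (fun s => k (s, t)) (fun s => K (s, t))) :
    Generates α (sliceHam hk t) (sliceIsotopy hK h0 t) := fun s x => h s x

theorem generates_zero {h : Ham n V} (h0 : ∀ p, h p = 0) : Generates α h 1 := by
  intro t x
  have h1 : mfderiv (𝓡∂ 1) (𝓡 (2 * n + 1)) (fun _ : I => x) t = 0 := mfderiv_const
  have h2 : (0 : TangentSpace (𝓡 (2 * n + 1)) x) = contactField α (fun y => h (t, y)) x := by
    have h3 : (fun y => h (t, y)) = fun _ => (0 : ℝ) := funext fun y => h0 _
    rw [h3]
    refine contactField_eq ⟨map_zero _, fun v => ?_⟩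
    rw [dFun_const, extD_skew]
    have h4 : extD α.form x v 0 = 0 := (extDLin α.form x v).map_zero
    rw [h4]
    simp
  exact (congrArg (fun l => l 1) h1).trans h2

variable [T2Space V] [CompactSpace V] [IsManifold (𝓡 k) ∞ Y]

/-- An operator extending the pullbacks to `Y` of functions on `W` to functions on `V`. It is
additive and positive, does not increase sup-norm bounds, and preserves smoothness in
parameters. -/
theorem IsReduction.exists_extension_operator (R : IsReduction k α β ρ) :
    ∃ T : (W → ℝ) → V → ℝ,
      (∀ f (y : Y), T f y = f (ρ y)) ∧
      (∀ f, (∀ x, 0 ≤ f x) → ∀ x, 0 ≤ T f x) ∧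
      (∀ f g x, T (fun y => f y - g y) x = T f x - T g x) ∧
      (∀ f c, 0 ≤ c → (∀ x, |f x| ≤ c) → ∀ x, |T f x| ≤ c) ∧
      (∀ hb : I → W → ℝ, ContMDiff ((𝓡∂ 1).prod (𝓡 (2 * m + 1))) 𝓘(ℝ, ℝ) ∞
          (fun q : I × W => hb q.1 q.2) →
        ContMDiff ((𝓡∂ 1).prod (𝓡 (2 * n + 1))) 𝓘(ℝ, ℝ) ∞
          (fun q : I × V => T (hb q.1) q.2)) ∧
      (∀ hb : I × I → W → ℝ, ContMDiff (((𝓡∂ 1).prod (𝓡∂ 1)).prod (𝓡 (2 * m + 1))) 𝓘(ℝ, ℝ) ∞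
          (fun q : (I × I) × W => hb q.1 q.2) →
        ContMDiff (((𝓡∂ 1).prod (𝓡∂ 1)).prod (𝓡 (2 * n + 1))) 𝓘(ℝ, ℝ) ∞
          (fun q : (I × I) × V => T (hb q.1) q.2)) := by
  obtain ⟨N, ι, hι⟩ := exists_isEmb (d := 2 * n + 1) V
  have : CompactSpace Y := isCompact_iff_compactSpace.1 R.isClosed.isCompact
  obtain ⟨D⟩ := (R.isEmb hι).nonempty_retractData
  refine ⟨fun f x => D.ext (fun y => f (ρ y)) (ι x), fun f y => D.ext_apply _ y,
    fun f hf x => D.ext_nonneg (fun y => hf _) _, fun f g x => D.ext_sub _ _ _,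
    fun f c hc hf x => D.abs_ext_le hc (fun y => hf _) _, fun hb hhb => ?_, fun hb hhb => ?_⟩
  · exact (D.contMDiff_ext (f := fun t y => hb t (ρ y))
      (hhb.comp (contMDiff_fst.prodMk (R.smooth.comp contMDiff_snd)))).comp
      (contMDiff_fst.prodMk (hι.smooth.comp contMDiff_snd))
  · exact (D.contMDiff_ext (f := fun t y => hb t (ρ y))
      (hhb.comp (contMDiff_fst.prodMk (R.smooth.comp contMDiff_snd)))).comp
      (contMDiff_fst.prodMk (hι.smooth.comp contMDiff_snd))

/-- Every contact Hamiltonian has an extension, which can be chosen nonnegative if the Hamiltonian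
is. -/
theorem IsReduction.exists_isExtension (R : IsReduction k α β ρ) (hb : Ham m W) :
    ∃ h : Ham n V, IsExtension ρ hb h ∧ ((∀ p, 0 ≤ hb p) → ∀ p, 0 ≤ h p) := by
  obtain ⟨T, hT, hTn, -, -, hTs, -⟩ := R.exists_extension_operator
  exact ⟨⟨fun q => T (fun x => hb (q.1, x)) q.2, hTs (fun t x => hb (t, x)) hb.contMDiff⟩,
    fun t y => hT _ y, fun h0 p => hTn _ (fun x => h0 _) _⟩

variable [T2Space W] [CompactSpace W]

/-- Homotopies of isotopies of `W` lift to homotopies of covering isotopies. -/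
theorem IsReduction.exists_homotopic (R : IsReduction k α β ρ) {Φb Ψb : ContactIsotopy β}
    (hb : Homotopic β Φb Ψb) {Φ : ContactIsotopy α} (hΦ : ∀ t, Covers ρ (Φ.1 t) (Φb.1 t)) :
    ∃ Ψ : ContactIsotopy α, Homotopic α Φ Ψ ∧ ∀ t, Covers ρ (Ψ.1 t) (Ψb.1 t) := by
  obtain ⟨K, hK, hK0, hK1, hKs0, hKs1⟩ := hb
  obtain ⟨kb, hkb, hkbK⟩ := exists_integrates hK
  obtain ⟨T, hT, -, -, hTabs, -, hTs⟩ := R.exists_extension_operator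
  -- the family `K (s, t) ∘ (Φb t)⁻¹`, which starts at the identity
  have hL : IsContactFamily β ((𝓡∂ 1).prod (𝓡∂ 1)) (I × I) (K * fun p : I × I => (Φb.1 p.2)⁻¹) :=
    hK.mul (isContactFamily_const β Φb).inv
  have hL0 : ∀ t, (K * fun p : I × I => (Φb.1 p.2)⁻¹) (0, t) = 1 := fun t => by simp [hK0]
  have hLk : ∀ t, Integrates β (fun s => kb (s, t))
      (fun s => (K * fun p : I × I => (Φb.1 p.2)⁻¹) (s, t)) := fun t s x =>
    hkbK t s ((Φb.1 t)⁻¹ x)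
  set k : I × I → V → ℝ := fun p => T (kb p) with hk'
  have hk : ContMDiff (((𝓡∂ 1).prod (𝓡∂ 1)).prod (𝓡 (2 * n + 1))) 𝓘(ℝ, ℝ) ∞
      (fun q : (I × I) × V => k q.1 q.2) := hTs kb hkb
  obtain ⟨P, hP, hP0, hPk⟩ := exists_contactFamily α hk
  have hcov : ∀ s t, Covers ρ (P (s, t)) (K (s, t) * (Φb.1 t)⁻¹) := fun s t =>
    R.covers_of_isExtension (generates_slice hP hP0 hk (hPk t))
      (generates_slice hL hL0 hkb (hLk t)) (fun s y => hT _ y) s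
  have hT0 : T (fun _ => 0) = 0 := by
    ext x
    exact abs_nonpos_iff.1 (hTabs (fun _ => 0) 0 le_rfl (fun _ => by simp) x)
  -- where the homotopy `K` is constant in `s`, its generators vanish, and so do their extensions
  have hPend : ∀ t, (∀ s, K (s, t) = K (0, t)) → ∀ s, P (s, t) = 1 := by
    intro t ht s
    have h1 : ∀ p, sliceHam hk t p = 0 := by
      rintro ⟨s, x⟩
      change T (kb (s, t)) x = 0
      have h2 : kb (s, t) = fun _ => 0 := by
        ext x
        exact integrates_const ht (hkbK t) s x
      rw [h2, hT0]; rfl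
    have h2 := (generates_slice hP hP0 hk (hPk t)).unique (generates_zero h1)
    exact congrFun (congrArg Subtype.val h2) s
  have hH : IsContactFamily α ((𝓡∂ 1).prod (𝓡∂ 1)) (I × I) (P * fun p => Φ.1 p.2) :=
    hP.mul (isContactFamily_const α Φ)
  have hPs0 : ∀ s, P (s, 0) = 1 := hPend 0 fun s => by rw [hKs0, hKs0]
  have hPs1 : ∀ s, P (s, 1) = 1 := hPend 1 fun s => by rw [hKs1, hKs1]
  refine ⟨⟨fun t => (P * fun p : I × I => Φ.1 p.2) (1, t),
    hH.comp (contMDiff_const.prodMk contMDiff_id), ?_⟩, ⟨_, hH, fun t => ?_, fun t => rfl,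
    fun s => ?_, fun s => ?_⟩, fun t => ?_⟩
  · simp [hPs0, Φ.2.2]
  · simp [hP0]
  · simp [hPs0, Φ.2.2]
  · simp [hPs1]
  · have h1 := (hcov 1 t).mul (hΦ t)
    rw [hK1, inv_mul_cancel_right] at h1
    exact h1

end Ambient

/-! ### Values of the quasi-morphism on covering isotopies -/

theorem Covers.zpow {V W : Type*} {Y : Set V} {ρ : Y → W} {φ : Equiv.Perm V} {φb : Equiv.Perm W}
    (h : Covers ρ φ φb) (j : ℤ) : Covers ρ (φ ^ j) (φb ^ j) := by
  have key : ∀ i : ℕ, Covers ρ (φ ^ i) (φb ^ i) := fun i => by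
    induction i with
    | zero => simpa using Covers.one ρ
    | succ i ih => rw [pow_succ, pow_succ]; exact ih.mul h
  cases j with
  | ofNat i => simpa using key i
  | negSucc i => simpa [zpow_negSucc] using (key (i + 1)).inv

section Reduction

variable {n m k : ℕ} {V : Type*} [TopologicalSpace V] [T2Space V] [CompactSpace V]
  [ChartedSpace (EuclideanSpace ℝ (Fin (2 * n + 1))) V] [IsManifold (𝓡 (2 * n + 1)) ∞ V]
  {W : Type*} [TopologicalSpace W] [T2Space W] [CompactSpace W]
  [ChartedSpace (EuclideanSpace ℝ (Fin (2 * m + 1))) W] [IsManifold (𝓡 (2 * m + 1)) ∞ W]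
  {Y : Set V} [ChartedSpace (EuclideanSpace ℝ (Fin k)) Y] [IsManifold (𝓡 k) ∞ Y]
  {α : ContactForm n V} {β : ContactForm m W} {ρ : Y → W} {μ : UnivCont α → ℝ}

/-- A contact Hamiltonian which is negative on `Y` is bounded above by an autonomous contact
Hamiltonian vanishing on `Y`. -/
theorem exists_autonomous_ge (hY : IsClosed Y) {g : Ham n V} (hg : ∀ t, ∀ y ∈ Y, g (t, y) < 0) :
    ∃ b : Ham n V, (∀ s t x, b (s, x) = b (t, x)) ∧ (∀ t, ∀ y ∈ Y, b (t, y) = 0) ∧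
      ∀ p, g p ≤ b p := by
  have hgc : Continuous g := g.contMDiff.continuous
  set K : Set V := Prod.snd '' {p : I × V | 0 ≤ g p} with hK
  have hKc : IsClosed K :=
    ((isClosed_le continuous_const hgc).isCompact.image continuous_snd).isClosed
  have hd : Disjoint Y K := by
    rw [Set.disjoint_left]
    rintro y hy ⟨⟨t, x⟩, hp, rfl⟩
    exact absurd (hg t _ hy) (not_lt.2 hp)
  obtain ⟨χ, h0, h1, hχ⟩ :=
    exists_contMDiffMap_zero_one_of_isClosed (n := (⊤ : ℕ∞)) (𝓡 (2 * n + 1)) hY hKc hd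
  obtain ⟨C, hC⟩ := isCompact_univ.exists_bound_of_continuousOn hgc.continuousOn
  have hC' : ∀ p, g p ≤ |C| := fun p =>
    ((le_abs_self _).trans (hC p (mem_univ _))).trans (le_abs_self C)
  refine ⟨⟨fun q => |C| * χ q.2, contMDiff_const.mul (χ.contMDiff.comp contMDiff_snd)⟩,
    fun s t x => rfl, fun t y hy => ?_, fun p => ?_⟩
  · change |C| * χ y = 0
    rw [h0 hy]
    exact mul_zero _
  · change g p ≤ |C| * χ p.2
    by_cases hp : 0 ≤ g p
    · rw [h1 (mem_image_of_mem _ hp)]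
      simpa using hC' p
    · exact (not_le.1 hp).le.trans (mul_nonneg (abs_nonneg _) (hχ _).1)

/-- If `μ` is bounded above on the elements `a^j b^{-j}`, then `μ a ≤ μ b`: by homogeneity these
values are `j (μ a - μ b)` up to a bounded error. -/
theorem IsQuasimorphism.le_of_forall_pow {G : Type*} [Group G] {μ : G → ℝ} (hμ : IsQuasimorphism μ)
    {a b : G} {C : ℝ} (h : ∀ j : ℤ, μ (a ^ j * (b ^ j)⁻¹) ≤ C) : μ a ≤ μ b := by
  obtain ⟨D, -, hD⟩ := hμ.quasi
  by_contra hlt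
  have hpos : 0 < μ a - μ b := by linarith
  obtain ⟨N, hN⟩ := exists_nat_gt ((C + D) / (μ a - μ b))
  rw [div_lt_iff₀ hpos] at hN
  have h1 := (abs_le.1 (hD (a ^ (N : ℤ)) (b ^ (N : ℤ))⁻¹)).1
  have h2 := h N
  rw [← zpow_neg] at h1 h2
  rw [hμ.homogeneous, hμ.homogeneous] at h1
  push_cast at h1
  linarith

namespace IsReduction

/-- Subheaviness bounds `μ` on the isotopies covering the identity: after composition with the
flow of the Hamiltonian `-1` such an isotopy is generated by a Hamiltonian equal to `-1` on `Y`. -/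
theorem exists_bound_of_covers_one (R : IsReduction k α β ρ) (hμ : IsQuasimorphism μ)
    (hmono : IsMonotone α μ) (hsub : IsSubheavy α μ Y) :
    ∃ C : ℝ, ∀ Φ : ContactIsotopy α, (∀ t, Covers ρ (Φ.1 t) 1) →
      μ (Φ : (homotopyCon α).Quotient) ≤ C := by
  obtain ⟨D, -, hD⟩ := hμ.quasi
  obtain ⟨Θ, hΘ⟩ := exists_generates α (constHam n V (-1))
  obtain ⟨Θb, hΘb⟩ := exists_generates β (constHam m W (-1))
  have hcov := R.covers_of_isExtension hΘ hΘb (fun _ _ => rfl)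
  refine ⟨D - μ (Θ : (homotopyCon α).Quotient), fun Φ hΦ => ?_⟩
  obtain ⟨g, hg⟩ := exists_ham (Θ * Φ)
  have hext : IsExtension ρ (constHam m W (-1)) g := R.isExtension_of_covers hg hΘb fun t => by
    have := (hcov t).mul (hΦ t)
    rwa [mul_one] at this
  obtain ⟨b, hb1, hb2, hb3⟩ := exists_autonomous_ge R.isClosed (g := g) (fun t y hy => by
    rw [hext t ⟨y, hy⟩]; exact neg_one_lt_zero)
  have h1 := hmono _ _ (prec_of_le (α := α) hb3)
  rw [hsub.2 b hb1 hb2, lift_eq hg] at h1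
  have h2 := (abs_le.1 (hD (Θ : (homotopyCon α).Quotient) (Φ : (homotopyCon α).Quotient))).1
  have h3 : ((Θ * Φ : ContactIsotopy α) : (homotopyCon α).Quotient)
    = (Θ : (homotopyCon α).Quotient) * (Φ : (homotopyCon α).Quotient) := rfl
  rw [h3] at h1
  linarith

/-- Isotopies covering the same isotopy have the same value under `μ`. -/
theorem eq_of_covers (R : IsReduction k α β ρ) (hμ : IsQuasimorphism μ)
    (hmono : IsMonotone α μ) (hsub : IsSubheavy α μ Y) {Φ Ψ : ContactIsotopy α}
    {Φb : ContactIsotopy β} (hΦ : ∀ t, Covers ρ (Φ.1 t) (Φb.1 t))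
    (hΨ : ∀ t, Covers ρ (Ψ.1 t) (Φb.1 t)) :
    μ (Φ : (homotopyCon α).Quotient) = μ (Ψ : (homotopyCon α).Quotient) := by
  obtain ⟨C, hC⟩ := R.exists_bound_of_covers_one hμ hmono hsub
  have key : ∀ {Φ Ψ : ContactIsotopy α}, (∀ t, Covers ρ (Φ.1 t) (Φb.1 t)) →
      (∀ t, Covers ρ (Ψ.1 t) (Φb.1 t)) →
      μ (Φ : (homotopyCon α).Quotient) ≤ μ (Ψ : (homotopyCon α).Quotient) := by
    intro Φ Ψ hΦ hΨ
    refine hμ.le_of_forall_pow (C := C) fun j => hC (Φ ^ j * (Ψ ^ j)⁻¹) fun t => ?_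
    have h1 := ((hΦ t).zpow j).mul ((hΨ t).zpow j).inv
    rw [mul_inv_cancel] at h1
    exact h1
  exact le_antisymm (key hΦ hΨ) (key hΨ hΦ)

/-- The value of `μ` on the lift of an extension of `hb` depends only on the lift of `hb`. -/
theorem lift_congr (R : IsReduction k α β ρ) (hμ : IsQuasimorphism μ)
    (hmono : IsMonotone α μ) (hsub : IsSubheavy α μ Y) {hb hb' : Ham m W} {h h' : Ham n V}
    (he : IsExtension ρ hb h) (he' : IsExtension ρ hb' h') (hl : lift β hb = lift β hb') :
    μ (lift α h) = μ (lift α h') := by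
  obtain ⟨Φ, hΦ⟩ := exists_generates α h
  obtain ⟨Φ', hΦ'⟩ := exists_generates α h'
  obtain ⟨Φb, hΦb⟩ := exists_generates β hb
  obtain ⟨Φb', hΦb'⟩ := exists_generates β hb'
  rw [lift_eq hΦb, lift_eq hΦb'] at hl
  have hhom : Homotopic β Φb Φb' := (Con.eq _).1 hl
  obtain ⟨Ψ, hΦΨ, hΨ⟩ := R.exists_homotopic hhom (R.covers_of_isExtension hΦ hΦb he)
  have h1 : (Φ : (homotopyCon α).Quotient) = (Ψ : (homotopyCon α).Quotient) :=
    (Con.eq _).2 hΦΨ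
  rw [lift_eq hΦ, lift_eq hΦ', h1]
  exact R.eq_of_covers hμ hmono hsub hΨ (R.covers_of_isExtension hΦ' hΦb' he')

/-- Every class of isotopies of `W` is represented by an isotopy covered by an isotopy of `V`. -/
theorem exists_covers (R : IsReduction k α β ρ) (a : UnivCont β) :
    ∃ (Φ : ContactIsotopy α) (Φb : ContactIsotopy β), a = (Φb : (homotopyCon β).Quotient) ∧
      ∀ t, Covers ρ (Φ.1 t) (Φb.1 t) := by
  obtain ⟨hb, rfl⟩ := exists_lift_eq a
  obtain ⟨h, hh, -⟩ := R.exists_isExtension hb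
  obtain ⟨Φ, hΦ⟩ := exists_generates α h
  obtain ⟨Φb, hΦb⟩ := exists_generates β hb
  exact ⟨Φ, Φb, lift_eq hΦb, R.covers_of_isExtension hΦ hΦb hh⟩

/-- A contact Hamiltonian on `W` supported in a displaceable set has an extension supported in a
displaceable set. -/
theorem exists_extension_displaceable (R : IsReduction k α β ρ) {U : Set W}
    (hU : ∃ ψ, MemCont0 β ψ ∧ (ψ '' U) ∩ U = ∅) {hb : Ham m W}
    (hsupp : tsupport (fun p => hb p) ⊆ univ ×ˢ U) :
    ∃ (U' : Set V) (h : Ham n V), IsOpen U' ∧ (∃ ψ, MemCont0 α ψ ∧ (ψ '' U') ∩ U' = ∅) ∧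
      tsupport (fun p => h p) ⊆ univ ×ˢ U' ∧ IsExtension ρ hb h := by
  obtain ⟨_, ⟨Ψb, rfl⟩, hdisp⟩ := hU
  obtain ⟨gb, hgb⟩ := exists_ham Ψb
  obtain ⟨g, hg, -⟩ := R.exists_isExtension gb
  obtain ⟨Ψ, hΨ⟩ := exists_generates α g
  have hcov := (R.covers_of_isExtension hΨ hgb hg 1).1
  have : CompactSpace Y := isCompact_iff_compactSpace.1 R.isClosed.isCompact
  have hψc : Continuous (Ψ.1 1) := (Ψ.2.1.smooth_at 1).continuous
  -- the projection of the support of `hb`, and its preimage in `Y`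
  set S : Set W := Prod.snd '' tsupport (fun p => hb p) with hS
  have hSc : IsClosed S := ((isClosed_tsupport _).isCompact.image continuous_snd).isClosed
  have hSU : S ⊆ U := by
    rintro _ ⟨p, hp, rfl⟩
    exact (hsupp hp).2
  set A : Set V := Subtype.val '' (ρ ⁻¹' S) with hA
  have hAc : IsCompact A :=
    (hSc.preimage R.smooth.continuous).isCompact.image continuous_subtype_val
  -- a point of the intersection would project to `Ψb(U) ∩ U`
  have hAd : Disjoint A (Ψ.1 1 '' A) := by
    rw [Set.disjoint_left]
    rintro _ ⟨y, hy, rfl⟩ ⟨_, ⟨z, hz, rfl⟩, hyz⟩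
    obtain ⟨z', hz1, hz2⟩ := hcov z
    have h1 : z' = y := Subtype.ext (hz1.trans hyz)
    have h2 : ρ y ∈ (Ψb.1 1 '' U) ∩ U :=
      ⟨⟨ρ z, hSU hz, by rw [← hz2, h1]⟩, hSU hy⟩
    rw [hdisp] at h2
    exact h2
  obtain ⟨O₁, O₂, hO₁, hO₂, hAO₁, hAO₂, hO⟩ :=
    SeparatedNhds.of_isCompact_isCompact hAc (hAc.image hψc) hAd
  obtain ⟨χ, h0, h1, -⟩ := exists_contMDiffMap_zero_one_nhds_of_isClosed (n := (⊤ : ℕ∞))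
    (𝓡 (2 * n + 1)) (s := (O₁ ∩ Ψ.1 1 ⁻¹' O₂)ᶜ) (t := A)
    (hO₁.inter (hO₂.preimage hψc)).isClosed_compl hAc.isClosed
    (Set.disjoint_left.2 fun x hx hxA => hx ⟨hAO₁ hxA, hAO₂ (mem_image_of_mem _ hxA)⟩)
  -- any extension, cut off outside a displaceable neighborhood of `A`
  obtain ⟨e, he, -⟩ := R.exists_isExtension hb
  refine ⟨O₁ ∩ Ψ.1 1 ⁻¹' O₂, ⟨fun q => χ q.2 * e q,
    (χ.contMDiff.comp contMDiff_snd).mul e.contMDiff⟩, hO₁.inter (hO₂.preimage hψc),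
    ⟨Ψ.1 1, ⟨Ψ, rfl⟩, ?_⟩, ?_, fun t y => ?_⟩
  · rw [Set.eq_empty_iff_forall_notMem]
    rintro _ ⟨⟨x, hx, rfl⟩, hx'⟩
    exact Set.disjoint_left.1 hO hx'.1 hx.2
  · intro q hq
    refine ⟨mem_univ _, ?_⟩
    by_contra hq2
    have h2 : ∀ᶠ x in 𝓝 q.2, χ x = 0 := h0.filter_mono (nhds_le_nhdsSet hq2)
    refine notMem_tsupport_iff_eventuallyEq.2 ?_ hq
    filter_upwards [continuous_snd.continuousAt.eventually h2] with p hp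
    change χ p.2 * e p = 0
    rw [hp, zero_mul]
  · change χ y * e (t, y) = hb (t, ρ y)
    rw [he]
    by_cases hy : ρ y ∈ S
    · rw [h1.self_of_nhdsSet y ⟨y, hy, rfl⟩, one_mul]
    · have : hb (t, ρ y) = 0 :=
        image_eq_zero_of_notMem_tsupport (f := fun p => hb p) fun h => hy ⟨_, h, rfl⟩
      rw [this, mul_zero]

end IsReduction

end Reduction

/-! ### The induced quasi-morphism -/

section Reduction

variable {n m k : ℕ} {V : Type*} [TopologicalSpace V] [T2Space V] [CompactSpace V]
  [ChartedSpace (EuclideanSpace ℝ (Fin (2 * n + 1))) V] [IsManifold (𝓡 (2 * n + 1)) ∞ V]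
  {W : Type*} [TopologicalSpace W]
  [ChartedSpace (EuclideanSpace ℝ (Fin (2 * m + 1))) W] [IsManifold (𝓡 (2 * m + 1)) ∞ W]
  {Y : Set V} [ChartedSpace (EuclideanSpace ℝ (Fin k)) Y] [IsManifold (𝓡 k) ∞ Y]
  {α : ContactForm n V} {β : ContactForm m W} {ρ : Y → W} {μ : UnivCont α → ℝ}
  {μb : UnivCont β → ℝ}

/-- A nonzero monotone quasi-morphism does not vanish on all constant Hamiltonians, that is, on
the lifts of the Reeb flow. -/
theorem exists_constHam_ne_zero (hμ : IsQuasimorphism μ) (hmono : IsMonotone α μ) :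
    ∃ c : ℝ, μ (lift α (constHam n V c)) ≠ 0 := by
  by_contra! h0
  obtain ⟨a, ha⟩ := hμ.nonzero
  obtain ⟨h, rfl⟩ := exists_lift_eq a
  obtain ⟨C, hC⟩ := isCompact_univ.exists_bound_of_continuousOn h.contMDiff.continuous.continuousOn
  have h1 := hmono _ _ (prec_of_le (α := α) (h := h) (g := constHam n V C) fun p =>
    (le_abs_self _).trans (hC p (mem_univ _)))
  have h2 := hmono _ _ (prec_of_le (α := α) (h := constHam n V (-C)) (g := h) fun p =>
    (abs_le.1 (hC p (mem_univ _))).1)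
  rw [h0] at h1 h2
  exact ha (le_antisymm h1 h2)

/-- `μb` is the function induced by `μ`: the value of `μb` on the lift of `hb` is the value of `μ`
on the lift of any extension of `hb`. -/
def IsInduced (μ : UnivCont α → ℝ) (μb : UnivCont β → ℝ) (ρ : Y → W) : Prop :=
  ∀ (hb : Ham m W) (h : Ham n V), IsExtension ρ hb h → μb (lift β hb) = μ (lift α h)

theorem IsReduction.induced_isC0Continuous (R : IsReduction k α β ρ) (hμb : IsInduced μ μb ρ)
    (hc : IsC0Continuous α μ) : IsC0Continuous β μb := by
  intro hb hbs hlim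
  obtain ⟨T, hT, -, hTsub, hTabs, hTs, -⟩ := R.exists_extension_operator
  let e : Ham m W → Ham n V := fun hb =>
    ⟨fun q => T (fun x => hb (q.1, x)) q.2, hTs (fun t x => hb (t, x)) hb.contMDiff⟩
  have he : ∀ hb : Ham m W, IsExtension ρ hb (e hb) := fun hb t y => hT _ y
  simp only [hμb _ _ (he _)]
  refine hc _ _ (Metric.tendstoUniformly_iff.2 fun ε hε => ?_)
  filter_upwards [Metric.tendstoUniformly_iff.1 hlim (ε / 2) (half_pos hε)] with j hj p
  refine lt_of_le_of_lt ?_ (half_lt_self hε)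
  change |T (fun x => hb (p.1, x)) p.2 - T (fun x => hbs j (p.1, x)) p.2| ≤ ε / 2
  rw [← hTsub]
  exact hTabs _ _ (half_pos hε).le (fun x => (hj (p.1, x)).le) _

variable [T2Space W] [CompactSpace W]

namespace IsReduction

/-- The induced function exists: the representatives of the classes and the extensions are chosen
arbitrarily, and the result does not depend on them. -/
theorem exists_isInduced (R : IsReduction k α β ρ) (hμ : IsQuasimorphism μ)
    (hmono : IsMonotone α μ) (hsub : IsSubheavy α μ Y) :
    ∃ μb : UnivCont β → ℝ, IsInduced μ μb ρ := by
  choose r hr using fun a : UnivCont β => exists_lift_eq a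
  choose e he _ using fun hb : Ham m W => R.exists_isExtension hb
  exact ⟨fun a => μ (lift α (e (r a))), fun hb h hh =>
    R.lift_congr hμ hmono hsub (he _) hh (hr _)⟩

theorem isInduced_unique (R : IsReduction k α β ρ) {ν : UnivCont β → ℝ} (hν : IsInduced μ ν ρ)
    (hμb : IsInduced μ μb ρ) : ν = μb := by
  funext a
  obtain ⟨hb, rfl⟩ := exists_lift_eq a
  obtain ⟨h, hh, -⟩ := R.exists_isExtension hb
  rw [hν hb h hh, hμb hb h hh]

/-- The induced function in terms of isotopies. -/
theorem induced_apply (R : IsReduction k α β ρ) (hμb : IsInduced μ μb ρ)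
    {Φ : ContactIsotopy α} {Φb : ContactIsotopy β} (h : ∀ t, Covers ρ (Φ.1 t) (Φb.1 t)) :
    μb (Φb : (homotopyCon β).Quotient) = μ (Φ : (homotopyCon α).Quotient) := by
  obtain ⟨g, hg⟩ := exists_ham Φ
  obtain ⟨gb, hgb⟩ := exists_ham Φb
  rw [← lift_eq hg, ← lift_eq hgb]
  exact hμb _ _ (R.isExtension_of_covers hg hgb h)

theorem induced_isQuasimorphism (R : IsReduction k α β ρ) (hμ : IsQuasimorphism μ)
    (hmono : IsMonotone α μ) (hμb : IsInduced μ μb ρ) : IsQuasimorphism μb where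
  quasi := by
    obtain ⟨D, hD0, hD⟩ := hμ.quasi
    refine ⟨D, hD0, fun a b => ?_⟩
    obtain ⟨Φ, Φb, rfl, hΦ⟩ := R.exists_covers a
    obtain ⟨Ψ, Ψb, rfl, hΨ⟩ := R.exists_covers b
    have h1 := R.induced_apply hμb (Φ := Φ * Ψ) (Φb := Φb * Ψb) fun t => (hΦ t).mul (hΨ t)
    have h2 := hD (Φ : (homotopyCon α).Quotient) (Ψ : (homotopyCon α).Quotient)
    rw [Con.coe_mul, Con.coe_mul] at h1
    rwa [h1, R.induced_apply hμb hΦ, R.induced_apply hμb hΨ]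
  homogeneous a j := by
    obtain ⟨Φ, Φb, rfl, hΦ⟩ := R.exists_covers a
    have h1 := R.induced_apply hμb (Φ := Φ ^ j) (Φb := Φb ^ j) fun t => (hΦ t).zpow j
    have h2 := hμ.homogeneous (Φ : (homotopyCon α).Quotient) j
    have h3 := map_zpow (homotopyCon α).mk' Φ j
    have h4 := map_zpow (homotopyCon β).mk' Φb j
    simp only [Con.coe_mk'] at h3 h4
    rw [← h4, h1, h3, h2, R.induced_apply hμb hΦ]
  nonzero := by
    obtain ⟨c, hc⟩ := exists_constHam_ne_zero hμ hmono
    refine ⟨lift β (constHam m W c), ?_⟩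
    rwa [hμb (constHam m W c) (constHam n V c) fun _ _ => rfl]

theorem induced_isMonotone (R : IsReduction k α β ρ) (hmono : IsMonotone α μ)
    (hμb : IsInduced μ μb ρ) : IsMonotone β μb := by
  rintro a b ⟨fb, hfb, hab⟩
  obtain ⟨Φ, Φb, rfl, hΦ⟩ := R.exists_covers a
  obtain ⟨f, hf, hf0⟩ := R.exists_isExtension fb
  obtain ⟨Θ, hΘ⟩ := exists_generates α f
  obtain ⟨Θb, hΘb⟩ := exists_generates β fb
  rw [lift_eq hΘb, inv_mul_eq_iff_eq_mul, ← Con.coe_mul] at hab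
  have hΦΘ : ∀ t, Covers ρ ((Φ * Θ).1 t) ((Φb * Θb).1 t) := fun t =>
    (hΦ t).mul (R.covers_of_isExtension hΘ hΘb hf t)
  rw [hab, R.induced_apply hμb hΦ, R.induced_apply hμb hΦΘ]
  -- `Φ ≼ Φ Θ` is witnessed by the nonnegative extension `f`
  refine hmono _ _ ⟨f, hf0 hfb, ?_⟩
  rw [lift_eq hΘ, Con.coe_mul, inv_mul_cancel_left]

theorem induced_hasVanishing (R : IsReduction k α β ρ) (hμb : IsInduced μ μb ρ)
    (hv : HasVanishing α μ) : HasVanishing β μb := by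
  intro U _ hU hb hsupp
  obtain ⟨U', h, hU', hd, hs, he⟩ := R.exists_extension_displaceable hU hsupp
  rw [hμb _ _ he]
  exact hv U' hU' hd h hs

end IsReduction

end Reduction

end ContactGeom

end

theorem mainTheorem2
    {n m k f : ℕ}
    -- the closed connected contact manifold `(V, ξ, α)`
    {V : Type*} [TopologicalSpace V] [T2Space V] [CompactSpace V] [ConnectedSpace V]
    [ChartedSpace (EuclideanSpace ℝ (Fin (2 * n + 1))) V] [IsManifold (𝓡 (2 * n + 1)) ∞ V]
    (α : ContactGeom.ContactForm n V)
    -- the closed connected contact manifold `(W, ker β)`, the base of the reduction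
    {W : Type*} [TopologicalSpace W] [T2Space W] [CompactSpace W] [ConnectedSpace W]
    [ChartedSpace (EuclideanSpace ℝ (Fin (2 * m + 1))) W] [IsManifold (𝓡 (2 * m + 1)) ∞ W]
    (β : ContactGeom.ContactForm m W)
    -- the closed strictly coisotropic submanifold `Y ⊆ V`
    (Y : Set V) [ChartedSpace (EuclideanSpace ℝ (Fin k)) Y] [IsManifold (𝓡 k) ∞ Y]
    (hY : ContactGeom.IsStrictlyCoisotropic α k Y)
    -- the fiber bundle `ρ : Y → W` with fiber `F` and `ρ^* β = α|_Y`
    {F : Type*} [TopologicalSpace F] [ChartedSpace (EuclideanSpace ℝ (Fin f)) F]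
    [IsManifold (𝓡 f) ∞ F]
    (ρ : Y → W) (hρ : ContactGeom.IsSmoothFiberBundle (k := k) (b := 2 * m + 1) (f := f) F ρ)
    (hpull : ∀ (y : Y) (v : TangentSpace (𝓡 k) y),
      β.form (ρ y) (mfderiv (𝓡 k) (𝓡 (2 * m + 1)) ρ y v)
        = α.form (y : V) (ContactGeom.inclD (n := n) (k := k) y v))
    -- the monotone quasi-morphism `μ`
    (μ : ContactGeom.UnivCont α → ℝ) (hμ : ContactGeom.IsQuasimorphism μ)
    (hmono : ContactGeom.IsMonotone α μ)
    (hsub : ContactGeom.IsSubheavy α μ Y) :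
    -- every contact Hamiltonian on `W` has an extension to `V`
    (∀ hb : ContactGeom.Ham m W, ∃ h : ContactGeom.Ham n V, ContactGeom.IsExtension ρ hb h) ∧
    -- there is exactly one function `μb` with `μb(φ̃_hb) = μ(φ̃_h)` for all extensions `h` of `hb`
    ∃ μb : ContactGeom.UnivCont β → ℝ,
      (∀ (hb : ContactGeom.Ham m W) (h : ContactGeom.Ham n V), ContactGeom.IsExtension ρ hb h →
        μb (ContactGeom.lift β hb) = μ (ContactGeom.lift α h)) ∧
      (∀ ν : ContactGeom.UnivCont β → ℝ,
        (∀ (hb : ContactGeom.Ham m W) (h : ContactGeom.Ham n V), ContactGeom.IsExtension ρ hb h →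
          ν (ContactGeom.lift β hb) = μ (ContactGeom.lift α h)) → ν = μb) ∧
      -- it is a monotone quasi-morphism
      ContactGeom.IsQuasimorphism μb ∧ ContactGeom.IsMonotone β μb ∧
      -- the vanishing property and `C⁰`-continuity pass from `μ` to `μb`
      (ContactGeom.HasVanishing α μ → ContactGeom.HasVanishing β μb) ∧
      (ContactGeom.IsC0Continuous α μ → ContactGeom.IsC0Continuous β μb) := by
  have R : ContactGeom.IsReduction k α β ρ := ContactGeom.isReduction hY hρ hpull
  obtain ⟨μb, hμb⟩ := R.exists_isInduced hμ hmono hsub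
  exact ⟨fun hb => (R.exists_isExtension hb).imp fun _ h => h.1, μb, hμb,
    fun _ hν => R.isInduced_unique hν hμb, R.induced_isQuasimorphism hμ hmono hμb,
    R.induced_isMonotone hmono hμb, R.induced_hasVanishing hμb, R.induced_isC0Continuous hμb⟩
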